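/- Let $G(\lambda)\in\mathbb C(\lambda)^{n\times n}$ satisfy $G^T=-G$, and let $G(\lambda)=P(\lambda)+B^T(\lambda E-A)^{-1}B$ be a minimal realization (the size $r$ of the pencil $\lambda E-A$ is the smallest among all realizations $P'(\lambda)+C'(\lambda E'-A')^{-1}B'$ of $G(\lambda)$ with $P'$ a matrix polynomial and $E'$ nonsingular), where $P(\lambda)=\sum_{j=0}^m\lambda^jA_j$ with $A_m\neq0$, $E\in\mathbb C^{r\times r}$ is nonsingular, and $P(\lambda)$ and $\lambda E-A$ are skew-symmetric. Put $\mathcal S(\lambda)=\begin{bmatrix}P(\lambda)&-B^T\\ B&\lambda E-A\end{bmatrix}$. **Fiedler matrices.** For $X\in\mathbb C^{n\times n}$ and $1\le i\le m-1$ let $M_0(X)=\mathrm{diag}(I_{(m-1)n},X)$, $M_{-m}(X)=\mathrm{diag}(X,I_{(m-1)n})$, $$M_i(X)=\mathrm{diag}\Big(I_{(m-i-1)n},\begin{bmatrix}X&I_n\\I_n&0\end{bmatrix},I_{(i-1)n}\Big),\qquad M_{-i}(X)=\mathrm{diag}\Big(I_{(m-i-1)n},\begin{bmatrix}0&I_n\\I_n&X\end{bmatrix},I_{(i-1)n}\Big).$$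 Let $M^P_i=M_i(-A_i)$ for $i\ge0$, $M^P_i=M_i(A_{-i})$ for $i<0$, and $\mathbb M^P_i=\mathrm{diag}(M^P_i,I_r)$. Let $e_k$ be the $k$-th column of $I_m$, and let $$\mathbb M^{\mathcal S}_0=\begin{bmatrix}M^P_0&e_m\otimes B^T\\-e_m^T\otimes B&A\end{bmatrix},\qquad \mathbb M^{\mathcal S}_{-m}=\mathrm{diag}(M^P_{-m},E),\qquad \mathbb M^{\mathcal S}_{i}=\mathbb M^P_{i}\ (1\le|i|\le m-1).$$ For an index tuple $\mathbf t=(t_1,\dots,t_k)$ write $M^P_{\mathbf t}=M^P_{t_1}\cdots M^P_{t_k}$ and similarly $\mathbb M^P_{\mathbf t}$, $\mathbb M^{\mathcal S}_{\mathbf t}$; let $rev(\mathbf t)=(t_k,\dots,t_1)$ and $\mathbf t+c=(t_1+c,\dots,t_k+c)$; and let $(a:b)=(a,a+1,\dots,b)$, empty if $a>b$. **Index tuples.** The admissible tuple of $\{0:k\}$ with index $p$ ($0\le p\le k$, $k-p$ even) is $(k-1:k,\,k-3:k-2,\dots,p+1:p+2,\,0:p)$; its symmetric complement is $(k-1,k-3,\dots,p+3,p+1,\,0:p-1,\,0:p-2,\dots,0:1,\,0)$,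 where the part after $p+1$ is empty if $p=0$. It is called simple if $p\in\{0,1\}$. The column standard form of a permutation $\alpha$ of $\{0:k\}$ is the tuple $(a_s:b_s,\dots,a_1:b_1)$ with $0\le b_1<\dots<b_s$ and $0\le a_j\le b_j$ that is obtained from $\alpha$ by interchanging neighbouring indices $i,j$ with $|i-j|>1$. An index $s$ is a right index of type-1 relative to $\alpha$ if the column standard form of $\alpha$ has a string $(s:t)$ with $s<t$; then $z_r(\alpha,s)$ is obtained from the column standard form by replacing the strings $(s:t),(a:s-1)$ by $(s+1:t),(a:s)$ if $s\ne0$, and the string $(0:t)$ by $(1:t),(0)$ if $s=0$. A tuple $(s_1,\dots,s_l)$ with indices in $\{0:k-1\}$ is a right index tuple of type-1 relative to $\alpha$ if each $s_i$ is a right index of type-1 relative to $\alpha_{i-1}$, where $\alpha_0=\alpha$ and $\alpha_i=z_r(\alpha_{i-1},s_i)$. Finally, if $0$ occurs in the tuple $\mathbf t$, $c_0(\mathbf t)$ is the largest $p$ such that $(0,1,\dots,p)$ is a (not necessarily contiguous) subtuple of $\mathbf t$. **Pencils.** Let $0\le h\le m-1$ be even, $\mathbf w$ the simple admissible tuple of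 $\{0:h\}$ with symmetric complement $\mathbf c_w$, and $\mathbf z+m$ any admissible tuple of $\{0:m-h-1\}$, with index $Ind(\mathbf z+m)$ and symmetric complement $\mathbf c_z+m$. Let $\mathbf t_w$ (with indices in $\{0:h-1\}$) and $\mathbf t_z+m$ (with indices in $\{0:m-h-2\}$) be right index tuples of type-1 relative to $rev(\mathbf w)$ and $rev(\mathbf z+m)$. Set $\alpha=c_0(\mathbf w,\mathbf c_w,\mathbf t_w)$ and $$L(\lambda)=M^P_{rev(\mathbf t_z)}M^P_{rev(\mathbf t_w)}(\lambda M^P_{\mathbf z}-M^P_{\mathbf w})M^P_{\mathbf c_w}M^P_{\mathbf t_w}M^P_{\mathbf c_z}M^P_{\mathbf t_z},$$ $$\mathbb L(\lambda)=\mathbb M^P_{rev(\mathbf t_z)}\mathbb M^P_{rev(\mathbf t_w)}(\lambda \mathbb M^{\mathcal S}_{\mathbf z}-\mathbb M^{\mathcal S}_{\mathbf w})\mathbb M^P_{\mathbf c_w}\mathbb M^P_{\mathbf t_w}\mathbb M^P_{\mathbf c_z}\mathbb M^P_{\mathbf t_z}.$$ A quasi-identity matrix is $Q=\epsilon_1I_n\oplus\dots\oplus\epsilon_mI_n$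 with all $\epsilon_i\in\{\pm1\}$; $\epsilon_i$ is its $i$-th parameter. **Rosenbrock strong linearization.** A pencil $\mathbb T(\lambda)=\begin{bmatrix}X-\lambda Y&C_1\\B_1&H-\lambda K\end{bmatrix}$ of size $mn+r$ with $K\in\mathbb C^{r\times r}$ nonsingular is a Rosenbrock strong linearization of $G(\lambda)$ if, with $\mathbb G_{\mathbb T}(\lambda)=X-\lambda Y+C_1(\lambda K-H)^{-1}B_1$ (the transfer function), this realization of $\mathbb G_{\mathbb T}$ is minimal; there are $mn\times mn$ unimodular matrix polynomials $U,V$ and nonsingular $U_0,V_0\in\mathbb C^{r\times r}$ with $\mathrm{diag}(U,U_0)\,\mathbb T\,\mathrm{diag}(V,V_0)=\mathrm{diag}(I_{(m-1)n},\mathcal S)$; and there are biproper rational matrices $\mathcal O_\ell,\mathcal O_r$ (each tends to a nonsingular matrix as $\lambda\to\infty$) with $\mathcal O_\ell\,\lambda^{-1}\mathbb G_{\mathbb T}\,\mathcal O_r=\mathrm{diag}(I_{(m-1)n},\lambda^{-m}G)$. **Theorem.** We have $1\le m-\alpha\le m$, and there is a quasi-identity matrix $Q$ such that $QL(\lambda)$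 is skew-symmetric. For every such $Q$, with $\mathbf s$ its $(m-\alpha)$-th parameter and $\mathbb Q=\mathrm{diag}(\mathbf sQ,I_r)$: 1. $\displaystyle \mathbb Q\mathbb L(\lambda)=\begin{bmatrix}\mathbf sQL(\lambda)&-e_{m-\alpha}\otimes B^T\\ e_{m-\alpha}^T\otimes B&\lambda E-A\end{bmatrix}$, and this pencil is skew-symmetric. 2. The transfer function $\mathbf sQL(\lambda)+(e_{m-\alpha}\otimes B^T)(\lambda E-A)^{-1}(e_{m-\alpha}^T\otimes B)$ of $\mathbb Q\mathbb L(\lambda)$ is skew-symmetric. 3. Suppose that $Ind(\mathbf z+m)=0$ and $-m\notin\mathbf t_z$ in case $A_m$ is singular, and that $0\notin\mathbf t_w$ in case $A_0$ is singular. Then $\mathbb Q\mathbb L(\lambda)$ is a Rosenbrock strong linearization of $G(\lambda)$. Moreover, if $A_0\neq0$ or $0\notin\mathbf t_w$, then $\mathbb Q$ is unique: there is exactly one matrix of the form $\mathrm{diag}(Q',I_r)$, with $Q'$ a quasi-identity matrix (whose $(m-\alpha)$-th parameter is required to be $1$ in case $r=0$), for which $\mathrm{diag}(Q',I_r)\,\mathbb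 L(\lambda)$ is skew-symmetric. -/

import Mathlib

open Polynomial Matrix Filter Topology

noncomputable section

namespace GFPR

/-! ### Rational matrices, realizations, system matrices -/

/-- A constant complex matrix, regarded as a matrix polynomial. -/
def cst {ι κ : Type*} (M : Matrix ι κ ℂ) : Matrix ι κ ℂ[X] := M.map (fun a => Polynomial.C a)

/-- A matrix polynomial, regarded as a rational matrix. -/
def toRat {ι κ : Type*} (M : Matrix ι κ ℂ[X]) : Matrix ι κ (RatFunc ℂ) :=
  M.map (fun p => algebraMap ℂ[X] (RatFunc ℂ) p)

/-- The matrix pencil `λ E - A`. -/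
def pencil {ι κ : Type*} (E A : Matrix ι κ ℂ) : Matrix ι κ ℂ[X] :=
  (Polynomial.X : ℂ[X]) • cst E - cst A

def IsSkewSymm {R ι : Type*} [Neg R] (M : Matrix ι ι R) : Prop := Mᵀ = -M

/-- The rational matrix `P(λ) + C (λ E - A)⁻¹ B`. -/
def transfer {ι : Type*} {r : ℕ} (P : Matrix ι ι ℂ[X]) (C : Matrix ι (Fin r) ℂ)
    (E A : Matrix (Fin r) (Fin r) ℂ) (B : Matrix (Fin r) ι ℂ) : Matrix ι ι (RatFunc ℂ) :=
  toRat P + toRat (cst C) * (toRat (pencil E A))⁻¹ * toRat (cst B)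

/-- `G(λ) = P(λ) + C (λ E - A)⁻¹ B` with `E` nonsingular. -/
def IsRealization {ι : Type*} {r : ℕ} (G : Matrix ι ι (RatFunc ℂ)) (P : Matrix ι ι ℂ[X])
    (C : Matrix ι (Fin r) ℂ) (E A : Matrix (Fin r) (Fin r) ℂ) (B : Matrix (Fin r) ι ℂ) : Prop :=
  E.det ≠ 0 ∧ G = transfer P C E A B

/-- A realization is minimal if the size `r` of the pencil `λ E - A` is the smallest among all
realizations of `G(λ)`. -/
def IsMinimalRealization {ι : Type*} {r : ℕ} (G : Matrix ι ι (RatFunc ℂ)) (P : Matrix ι ι ℂ[X])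
    (C : Matrix ι (Fin r) ℂ) (E A : Matrix (Fin r) (Fin r) ℂ) (B : Matrix (Fin r) ι ℂ) : Prop :=
  IsRealization G P C E A B ∧
    ∀ (r' : ℕ) (P' : Matrix ι ι ℂ[X]) (C' : Matrix ι (Fin r') ℂ)
      (E' A' : Matrix (Fin r') (Fin r') ℂ) (B' : Matrix (Fin r') ι ℂ),
      IsRealization G P' C' E' A' B' → r ≤ r'

/-- `∑_{j=0}^m λ^j A_j`. -/
def polyMat {n : ℕ} (m : ℕ) (coef : ℕ → Matrix (Fin n) (Fin n) ℂ) :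
    Matrix (Fin n) (Fin n) ℂ[X] :=
  ∑ j ∈ Finset.range (m + 1), (Polynomial.X : ℂ[X]) ^ j • cst (coef j)

/-- A matrix polynomial whose determinant is a nonzero constant. -/
def IsUnimodular {ι : Type*} [Fintype ι] [DecidableEq ι] (U : Matrix ι ι ℂ[X]) : Prop :=
  ∃ c : ℂ, c ≠ 0 ∧ U.det = Polynomial.C c

/-- `F(λ) → D` as `λ → ∞`, for some nonsingular matrix `D`. -/
def IsBiproper {ι : Type*} [Fintype ι] [DecidableEq ι] (F : Matrix ι ι (RatFunc ℂ)) : Prop :=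
  ∃ D : Matrix ι ι ℂ, D.det ≠ 0 ∧
    ∀ i j, Tendsto (fun x : ℂ => RatFunc.eval (RingHom.id ℂ) x (F i j))
      (Bornology.cobounded ℂ) (𝓝 (D i j))

/-! ### Block matrices: `m × m` blocks of size `n × n`, indexed by `Fin m × Fin n`

Block indices are counted from `1` to `m`: the block with index `p : Fin m` is number `p + 1`. -/

/-- `e_k ⊗ C`, where `e_k` is the `k`-th column of `I_m`. -/
def eCol {R : Type*} [Zero R] {n r : ℕ} (m : ℕ) (k : ℤ) (C : Matrix (Fin n) (Fin r) R) :
    Matrix (Fin m × Fin n) (Fin r) R :=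
  Matrix.of fun p j => if (p.1 : ℤ) + 1 = k then C p.2 j else 0

/-- `e_kᵀ ⊗ B`. -/
def eRow {R : Type*} [Zero R] {n r : ℕ} (m : ℕ) (k : ℤ) (B : Matrix (Fin r) (Fin n) R) :
    Matrix (Fin r) (Fin m × Fin n) R :=
  Matrix.of fun j p => if (p.1 : ℤ) + 1 = k then B j p.2 else 0

/-- `diag(I_{(m-1)n}, X)`. -/
def padId {R : Type*} [Zero R] [One R] {n : ℕ} (m : ℕ) (X : Matrix (Fin n) (Fin n) R) :
    Matrix (Fin m × Fin n) (Fin m × Fin n) R :=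
  Matrix.of fun p q =>
    if p.1 = q.1 then
      (if (p.1 : ℤ) + 1 = m then X p.2 q.2 else (1 : Matrix (Fin n) (Fin n) R) p.2 q.2)
    else 0

/-- `diag(I_{(m-1)n}, S)` for a matrix `S` partitioned as an `(n + r) × (n + r)` block matrix. -/
def padIdSystem {R : Type*} [Zero R] [One R] {n r : ℕ} (m : ℕ)
    (S : Matrix (Fin n ⊕ Fin r) (Fin n ⊕ Fin r) R) :
    Matrix ((Fin m × Fin n) ⊕ Fin r) ((Fin m × Fin n) ⊕ Fin r) R :=
  Matrix.fromBlocks (padId m S.toBlocks₁₁) (eCol m m S.toBlocks₁₂)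
    (eRow m m S.toBlocks₂₁) S.toBlocks₂₂

/-- `L(λ)` is a Rosenbrock strong linearization of the rational matrix `G(λ)` with (irreducible)
system matrix `S(λ)`. Here `L(λ) = [Xc - λ Yc, Cc; Bc, H - λ K]` is an irreducible system matrix
with `K` nonsingular, whose transfer function is `Xc - λ Yc + Cc (λ K - H)⁻¹ Bc`. -/
def IsRosenbrockStrongLinearization {n r : ℕ} (m : ℕ)
    (L : Matrix ((Fin m × Fin n) ⊕ Fin r) ((Fin m × Fin n) ⊕ Fin r) ℂ[X])
    (S : Matrix (Fin n ⊕ Fin r) (Fin n ⊕ Fin r) ℂ[X])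
    (G : Matrix (Fin n) (Fin n) (RatFunc ℂ)) : Prop :=
  ∃ (Xc Yc : Matrix (Fin m × Fin n) (Fin m × Fin n) ℂ) (Cc : Matrix (Fin m × Fin n) (Fin r) ℂ)
    (Bc : Matrix (Fin r) (Fin m × Fin n) ℂ) (H K : Matrix (Fin r) (Fin r) ℂ),
    L = Matrix.fromBlocks (cst Xc - (Polynomial.X : ℂ[X]) • cst Yc) (cst Cc)
          (cst Bc) (cst H - (Polynomial.X : ℂ[X]) • cst K) ∧
    IsMinimalRealization (transfer (cst Xc - (Polynomial.X : ℂ[X]) • cst Yc) Cc K H Bc)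
      (cst Xc - (Polynomial.X : ℂ[X]) • cst Yc) Cc K H Bc ∧
    (∃ (U V : Matrix (Fin m × Fin n) (Fin m × Fin n) ℂ[X]) (U₀ V₀ : Matrix (Fin r) (Fin r) ℂ),
      IsUnimodular U ∧ IsUnimodular V ∧ U₀.det ≠ 0 ∧ V₀.det ≠ 0 ∧
      Matrix.fromBlocks U 0 0 (cst U₀) * L * Matrix.fromBlocks V 0 0 (cst V₀) =
        padIdSystem m S) ∧
    (∃ Ol Or : Matrix (Fin m × Fin n) (Fin m × Fin n) (RatFunc ℂ),
      IsBiproper Ol ∧ IsBiproper Or ∧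
      Ol * ((RatFunc.X : RatFunc ℂ)⁻¹ •
          transfer (cst Xc - (Polynomial.X : ℂ[X]) • cst Yc) Cc K H Bc) * Or =
        padId m (((RatFunc.X : RatFunc ℂ)⁻¹ ^ m) • G))

/-! ### Fiedler matrices -/

/-- The `(p, q)` block of the elementary matrix `M_i(X)`, for `i ∈ {-m : m-1}`. -/
def elemBlock {n : ℕ} (m : ℕ) (i : ℤ) (X : Matrix (Fin n) (Fin n) ℂ) (p q : Fin m) :
    Matrix (Fin n) (Fin n) ℂ :=
  if i = 0 then
    -- diag(I_{(m-1)n}, X)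
    (if p = q then (if (p : ℤ) + 1 = m then X else 1) else 0)
  else if i = -(m : ℤ) then
    -- diag(X, I_{(m-1)n})
    (if p = q then (if (p : ℤ) + 1 = 1 then X else 1) else 0)
  else if 0 < i then
    -- diag(I_{(m-i-1)n}, [X, I; I, 0], I_{(i-1)n})
    (if (p : ℤ) + 1 = m - i ∧ (q : ℤ) + 1 = m - i then X
     else if (p : ℤ) + 1 = m - i ∧ (q : ℤ) + 1 = m - i + 1 then 1
     else if (p : ℤ) + 1 = m - i + 1 ∧ (q : ℤ) + 1 = m - i then 1
     else if (p : ℤ) + 1 = m - i + 1 ∧ (q : ℤ) + 1 = m - i + 1 then 0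
     else if p = q then 1 else 0)
  else
    -- with j = -i: diag(I_{(m-j-1)n}, [0, I; I, X], I_{(j-1)n})
    (if (p : ℤ) + 1 = m + i ∧ (q : ℤ) + 1 = m + i then 0
     else if (p : ℤ) + 1 = m + i ∧ (q : ℤ) + 1 = m + i + 1 then 1
     else if (p : ℤ) + 1 = m + i + 1 ∧ (q : ℤ) + 1 = m + i then 1
     else if (p : ℤ) + 1 = m + i + 1 ∧ (q : ℤ) + 1 = m + i + 1 then X
     else if p = q then 1 else 0)

/-- The elementary matrix `M_i(X)`. -/
def elemMat {n : ℕ} (m : ℕ) (i : ℤ) (X : Matrix (Fin n) (Fin n) ℂ) :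
    Matrix (Fin m × Fin n) (Fin m × Fin n) ℂ :=
  Matrix.of fun p q => elemBlock m i X p.1 q.1 p.2 q.2

/-- The Fiedler matrix `M_i^P` of `P(λ) = ∑ λ^j A_j`: it is `M_i(-A_i)` for `i ≥ 0` and
`M_i(A_{-i})` for `i < 0`. -/
def fiedlerP {n : ℕ} (m : ℕ) (coef : ℕ → Matrix (Fin n) (Fin n) ℂ) (i : ℤ) :
    Matrix (Fin m × Fin n) (Fin m × Fin n) ℂ :=
  if 0 ≤ i then elemMat m i (-coef i.toNat) else elemMat m i (coef (-i).toNat)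

/-- `diag(M_i^P, I_r)`. -/
def fiedlerPExt {n : ℕ} (r m : ℕ) (coef : ℕ → Matrix (Fin n) (Fin n) ℂ) (i : ℤ) :
    Matrix ((Fin m × Fin n) ⊕ Fin r) ((Fin m × Fin n) ⊕ Fin r) ℂ :=
  Matrix.fromBlocks (fiedlerP m coef i) 0 0 1

/-- The Fiedler matrix `𝕄_i^S` of the system matrix `S(λ) = [P(λ), C; B, A - λ E]`. For
`1 ≤ |i| ≤ m-1` it equals `diag(M_i^P, I_r)`, and these matrices are inverse to each other for
`i` and `-i`. -/
def fiedlerS {n r : ℕ} (m : ℕ) (coef : ℕ → Matrix (Fin n) (Fin n) ℂ)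
    (C : Matrix (Fin n) (Fin r) ℂ) (E A : Matrix (Fin r) (Fin r) ℂ)
    (B : Matrix (Fin r) (Fin n) ℂ) (i : ℤ) :
    Matrix ((Fin m × Fin n) ⊕ Fin r) ((Fin m × Fin n) ⊕ Fin r) ℂ :=
  if i = 0 then Matrix.fromBlocks (fiedlerP m coef 0) (-eCol m m C) (-eRow m m B) (-A)
  else if i = -(m : ℤ) then Matrix.fromBlocks (fiedlerP m coef (-(m : ℤ))) 0 0 (-E)
  else fiedlerPExt r m coef i

/-- `f_{t_1} f_{t_2} ⋯ f_{t_k}` for an index tuple `t = (t_1, …, t_k)`. -/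
def tupleProd {M : Type*} [Monoid M] (f : ℤ → M) (t : List ℤ) : M := (t.map f).prod

/-- `M^P_{rev(t_z)} M^P_{rev(t_w)} (λ M^P_z - M^P_w) M^P_{c_w} M^P_{t_w} M^P_{c_z} M^P_{t_z}`. -/
def gfprP {n : ℕ} (m : ℕ) (coef : ℕ → Matrix (Fin n) (Fin n) ℂ) (w cw tw z cz tz : List ℤ) :
    Matrix (Fin m × Fin n) (Fin m × Fin n) ℂ[X] :=
  cst (tupleProd (fiedlerP m coef) tz.reverse * tupleProd (fiedlerP m coef) tw.reverse) *
    pencil (tupleProd (fiedlerP m coef) z) (tupleProd (fiedlerP m coef) w) *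
    cst (tupleProd (fiedlerP m coef) cw * tupleProd (fiedlerP m coef) tw *
      tupleProd (fiedlerP m coef) cz * tupleProd (fiedlerP m coef) tz)

/-- `𝕄^P_{rev(t_z)} 𝕄^P_{rev(t_w)} (λ 𝕄^S_z - 𝕄^S_w) 𝕄^P_{c_w} 𝕄^P_{t_w} 𝕄^P_{c_z} 𝕄^P_{t_z}`
associated with the system matrix `S(λ) = [P(λ), C; B, A - λ E]`. -/
def gfprS {n r : ℕ} (m : ℕ) (coef : ℕ → Matrix (Fin n) (Fin n) ℂ)
    (C : Matrix (Fin n) (Fin r) ℂ) (E A : Matrix (Fin r) (Fin r) ℂ)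
    (B : Matrix (Fin r) (Fin n) ℂ) (w cw tw z cz tz : List ℤ) :
    Matrix ((Fin m × Fin n) ⊕ Fin r) ((Fin m × Fin n) ⊕ Fin r) ℂ[X] :=
  cst (tupleProd (fiedlerPExt r m coef) tz.reverse *
      tupleProd (fiedlerPExt r m coef) tw.reverse) *
    pencil (tupleProd (fiedlerS m coef C E A B) z) (tupleProd (fiedlerS m coef C E A B) w) *
    cst (tupleProd (fiedlerPExt r m coef) cw * tupleProd (fiedlerPExt r m coef) tw *
      tupleProd (fiedlerPExt r m coef) cz * tupleProd (fiedlerPExt r m coef) tz)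

/-- The quasi-identity matrix `ε_1 I_n ⊕ ⋯ ⊕ ε_m I_n`, `ε_i ∈ {1, -1}`. -/
def quasiIdentity (n : ℕ) {m : ℕ} (ε : Fin m → ℤˣ) :
    Matrix (Fin m × Fin n) (Fin m × Fin n) ℂ :=
  Matrix.diagonal fun p => (((ε p.1 : ℤˣ) : ℤ) : ℂ)

/-- `diag(Q, I_r)` for a matrix `Q`. -/
def extId (r : ℕ) {ι : Type*} (Q : Matrix ι ι ℂ) : Matrix (ι ⊕ Fin r) (ι ⊕ Fin r) ℂ :=
  Matrix.fromBlocks Q 0 0 1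

/-! ### Index tuples -/

/-- The string `a : b = (a, a+1, …, b)`, empty if `b < a`. -/
def str (a b : ℤ) : List ℤ := (List.range (b + 1 - a).toNat).map fun i => a + (i : ℤ)

/-- Concatenation of the strings `a : b` for the pairs `(a, b)` in the list. -/
def flat (bl : List (ℤ × ℤ)) : List ℤ := bl.flatMap fun s => str s.1 s.2

/-- Number `c_t(α)` of consecutive consecutions of `α` at `t`: the `p` such that
`(t : t+p)` is a subtuple of `α` and `(t : t+p+1)` is not; `-1` if `t ∉ α`. -/
def consec (t : ℤ) (α : List ℤ) : ℤ :=
  if t ∈ α then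
    ((Nat.findGreatest (fun p : ℕ => List.Sublist (str t (t + p)) α) α.length : ℕ) : ℤ)
  else -1

/-- Exchange of two neighbouring indices `i, j` with `|i - j| > 1`. -/
inductive CommStep : List ℤ → List ℤ → Prop
  | swap (l₁ l₂ : List ℤ) (i j : ℤ) (h : 1 < |i - j|) :
      CommStep (l₁ ++ i :: j :: l₂) (l₁ ++ j :: i :: l₂)

/-- `bl = ((a_s, b_s), …, (a_1, b_1))` lists the strings of the column standard form of `α`:
`0 ≤ b_1 < ⋯ < b_s`, `0 ≤ a_j ≤ b_j`, and `(a_s : b_s, …, a_1 : b_1)` is obtained from `α` by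
exchanges of neighbouring indices that are not consecutive integers. -/
def HasCSF (α : List ℤ) (bl : List (ℤ × ℤ)) : Prop :=
  bl.Pairwise (fun s t => t.2 < s.2) ∧ (∀ s ∈ bl, 0 ≤ s.1 ∧ s.1 ≤ s.2) ∧
    Relation.EqvGen CommStep α (flat bl)

/-- `w` is the admissible tuple `(h-1:h, h-3:h-2, …, p+1:p+2, 0:p)` of `{0:h}` with index `p`. -/
def IsAdmissible (h p : ℕ) (w : List ℤ) : Prop :=
  p ≤ h ∧ Even (h - p) ∧
    w = flat ((List.range ((h - p) / 2)).map
      (fun j => ((h : ℤ) - 2 * j - 1, (h : ℤ) - 2 * j)) ++ [(0, (p : ℤ))])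

/-- The symmetric complement `(h-1, h-3, …, p+3, p+1, 0:p-1, 0:p-2, …, 0:1, 0)` of the admissible
tuple of `{0:h}` with index `p`; the last part is empty if `p = 0`. -/
def symmCompl (h p : ℕ) : List ℤ :=
  (List.range ((h - p) / 2)).map (fun j => (h : ℤ) - 2 * j - 1) ++
    (List.range p).flatMap (fun j => str 0 ((p : ℤ) - 1 - j))

/-- For a column standard form with strings `bl`: `s` is a right index of type-1, i.e. there is a
string `(s : t)` with `s < t`, and `bl'` lists the strings of the associated simple tuple. -/
inductive AssocSimple : List (ℤ × ℤ) → ℤ → List (ℤ × ℤ) → Prop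
  | pos (l₁ l₂ : List (ℤ × ℤ)) (s t a : ℤ) (hs : s ≠ 0) (hst : s < t) :
      AssocSimple (l₁ ++ (s, t) :: (a, s - 1) :: l₂) s (l₁ ++ (s + 1, t) :: (a, s) :: l₂)
  | zero (l₁ : List (ℤ × ℤ)) (t : ℤ) (ht : 0 < t) :
      AssocSimple (l₁ ++ [(0, t)]) 0 (l₁ ++ [(1, t), (0, 0)])

/-- Successive right indices of type-1, starting from the column standard form `bl`. -/
inductive TypeOneFrom : List (ℤ × ℤ) → List ℤ → Prop
  | nil (bl : List (ℤ × ℤ)) : TypeOneFrom bl []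
  | cons (bl bl' : List (ℤ × ℤ)) (s : ℤ) (β : List ℤ)
      (h : AssocSimple bl s bl') (hβ : TypeOneFrom bl' β) : TypeOneFrom bl (s :: β)

/-- `β`, containing indices from `{0 : k-1}`, is a right index tuple of type-1 relative to the
permutation `α` of `{0:k}`. -/
def IsRightTypeOne (k : ℕ) (α β : List ℤ) : Prop :=
  (∀ s ∈ β, 0 ≤ s ∧ s ≤ (k : ℤ) - 1) ∧ ∃ bl, HasCSF α bl ∧ TypeOneFrom bl β

/-- `t + k`. -/
def shift (t : List ℤ) (k : ℤ) : List ℤ := t.map (fun i => i + k)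

end GFPR

end

open GFPR

/-! An `mn × mn` matrix is treated as an `m × m` matrix over the noncommutative ring of `n × n`
blocks. Count the blocks from the bottom (`lw`): for `i > 0`, `M_i^P` carries `[X, 1; 1, 0]` at the
labels `i, i - 1`. Count them from the top (`lz`): then `M_{j-m}^P` has this form at `j, j - 1`. So
the `w`-side and the `z`-side obey the same lemmas. Complements and type-1 tuples of the two sides
act on disjoint labels and commute; only the admissible tuples reach the one block in the middle.

Type-1 tuples become particle moves. Put a particle at `i` when `i` and `i + 1` lie in a common
string of the column standard form. A type-1 index `s` is then a hop of a particle from `s` to an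
empty site `s - 1`, or its disappearance at `0` (`assocSimple_hop`, `rightTypeOne_hop`). All later
arguments use only these moves.

Skew-symmetry. For skew-symmetric blocks, transposition reverses a word and replaces each `X` by
`-X`. The word (admissible tuple, complement) gives the same product as its reversal (`core_pal`).
It remains to undo `X ↦ -X` by signs: a Fiedler matrix allows this when the signs at its two labels
are opposite and get exchanged (`sg_fm`). With sign `+1` at particles and `-1` elsewhere, hops
satisfy this rule, and both cores turn the sign vector into its negative (`exists_signs`).
`isSkewSymm_sandwich` concludes.

The corner blocks. The last block column and row, where `B^T` and `B` enter, remain unit vectors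
under all factors, and their label follows the greedy search for `0, 1, 2, …` that computes `c_0`;
hence they arrive at block `m - α` (`track`, `gfprS_eq`).

The linearization. Up to invertible outer factors the pencil is `λ N - M_0`, where `N` is a product
of inverse Fiedler matrices. Each factor of `N` is eliminated with a pivot `-1`, which performs one
step of Horner's scheme; what is left is `P(λ)` (`elim_block`, `reduces_pencil`). The eliminations
fix the last block column and row, so the same unimodular matrices carry `B^T` and `B` to the corner
of the system matrix. At infinity the argument is repeated from the other end with `λ⁻¹` as
parameter over the ring of proper rational functions; there the strictly proper part of `G` is
absorbed into `A_0` (`exists_infinity_equivalence`). Minimality survives because constant rows and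
columns times unimodular matrices can be divided by `λE - A` (`exists_transfer_eq`).

Uniqueness. The quotient of two valid sign vectors is constant along nonzero blocks of either
coefficient (`signs_eq`), and the graph of these blocks is connected (`blocks_connected`). The
remaining common sign is fixed by `B ≠ 0`, which minimality provides for `r > 0`. -/

noncomputable section

set_option linter.unusedSectionVars false

namespace GFPR

/-! ### Elementary block matrices, their supports, and words in Fiedler matrices -/

section Elementary

variable {ι R : Type*} [Fintype ι] [DecidableEq ι] [Ring R]

/-- The elementary matrix `[X, 1; 1, 0]` in rows and columns `a, b`. -/
def swp (a b : ι) (X : R) : Matrix ι ι R :=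
  Matrix.of fun c d =>
    if c = a then (if d = a then X else if d = b then 1 else 0)
    else if c = b then (if d = a then 1 else 0)
    else if c = d then 1 else 0

/-- The elementary matrix with `X` at the diagonal position `a`. -/
def dgl (a : ι) (X : R) : Matrix ι ι R :=
  Matrix.diagonal fun c => if c = a then X else 1

theorem swp_mul_apply {a b : ι} (hab : a ≠ b) (X : R) (Z : Matrix ι ι R) (c d : ι) :
    (swp a b X * Z) c d =
      if c = a then X * Z a d + Z b d else if c = b then Z a d else Z c d := by
  rw [Matrix.mul_apply]
  by_cases h1 : c = a
  · subst h1
    rw [if_pos rfl, Finset.sum_eq_add c b hab]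
    · simp [swp, hab.symm]
    · intro x _ hx
      simp [swp, hx.1, hx.2]
    · simp
    · simp
  · by_cases h2 : c = b
    · subst h2
      rw [if_neg h1, if_pos rfl, Finset.sum_eq_single a]
      · simp [swp, h1]
      · intro x _ hx
        simp [swp, hx, h1]
      · simp
    · rw [if_neg h1, if_neg h2, Finset.sum_eq_single c]
      · simp [swp, h1, h2]
      · intro x _ hx
        simp [swp, hx.symm, h1, h2]
      · simp

theorem mul_swp_apply {a b : ι} (hab : a ≠ b) (X : R) (Z : Matrix ι ι R) (c d : ι) :
    (Z * swp a b X) c d =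
      if d = a then Z c a * X + Z c b else if d = b then Z c a else Z c d := by
  rw [Matrix.mul_apply]
  by_cases h1 : d = a
  · subst h1
    rw [if_pos rfl, Finset.sum_eq_add d b hab]
    · simp [swp, hab.symm]
    · intro x _ hx
      simp [swp, hx.1, hx.2]
    · simp
    · simp
  · by_cases h2 : d = b
    · subst h2
      rw [if_neg h1, if_pos rfl, Finset.sum_eq_single a]
      · simp [swp, h1]
      · intro x _ hx
        by_cases hxd : x = d <;> simp [swp, hx, h1, hxd]
      · simp
    · rw [if_neg h1, if_neg h2, Finset.sum_eq_single d]
      · simp [swp, h1, h2]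
      · intro x _ hx
        by_cases hxa : x = a <;> by_cases hxb : x = b <;> simp [swp, hx, h1, h2, hxa, hxb]
      · simp

theorem dgl_mul_apply (a : ι) (X : R) (Z : Matrix ι ι R) (c d : ι) :
    (dgl a X * Z) c d = if c = a then X * Z c d else Z c d := by
  simp only [dgl, Matrix.diagonal_mul, ite_mul, one_mul]

theorem mul_dgl_apply (a : ι) (X : R) (Z : Matrix ι ι R) (c d : ι) :
    (Z * dgl a X) c d = if d = a then Z c d * X else Z c d := by
  simp only [dgl, Matrix.mul_diagonal, mul_ite, mul_one]

/-- Fiedler matrix with index `i` with respect to a labelling `ℓ` of the blocks: the blocks with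
labels `i, i - 1` carry `[X, 1; 1, 0]`, and for `i = 0` the block with label `0` carries `X`. -/
def fm (ℓ : ι → ℕ) (i : ℕ) (X : R) : Matrix ι ι R :=
  Matrix.of fun a b =>
    if ℓ a = i ∧ ℓ b = i then X
    else if (ℓ a + 1 = i ∧ ℓ b = i) ∨ (ℓ a = i ∧ ℓ b + 1 = i) then 1
    else if ℓ a + 1 = i ∧ ℓ b + 1 = i then 0
    else if a = b then 1 else 0

/-- Fiedler matrix of the opposite kind: the blocks with labels `j - 1, j` carry `[X, 1; 1, 0]`. -/
def nf (ℓ : ι → ℕ) (j : ℕ) (X : R) : Matrix ι ι R :=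
  Matrix.of fun a b =>
    if ℓ a + 1 = j ∧ ℓ b + 1 = j then X
    else if (ℓ a + 1 = j ∧ ℓ b = j) ∨ (ℓ a = j ∧ ℓ b + 1 = j) then 1
    else if ℓ a = j ∧ ℓ b = j then 0
    else if a = b then 1 else 0

theorem fm_eq_swp {ℓ : ι → ℕ} (hℓ : Function.Injective ℓ) {a b : ι} {i : ℕ}
    (ha : ℓ a = i) (hb : ℓ b + 1 = i) (X : R) : fm ℓ i X = swp a b X := by
  have e1 : ∀ c, ℓ c = i ↔ c = a := fun c => ⟨fun h => hℓ (h.trans ha.symm), fun h => h ▸ ha⟩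
  have e2 : ∀ c, ℓ c + 1 = i ↔ c = b :=
    fun c => ⟨fun h => hℓ (Nat.succ_injective (h.trans hb.symm)), fun h => h ▸ hb⟩
  have hab : a ≠ b := by rintro rfl; omega
  ext c d
  simp only [fm, swp, Matrix.of_apply, e1, e2]
  split_ifs <;> first | rfl | (exfalso; grind)

theorem fm_zero_eq_dgl {ℓ : ι → ℕ} (hℓ : Function.Injective ℓ) {a : ι}
    (ha : ℓ a = 0) (X : R) : fm ℓ 0 X = dgl a X := by
  have e1 : ∀ c, ℓ c = 0 ↔ c = a := fun c => ⟨fun h => hℓ (h.trans ha.symm), fun h => h ▸ ha⟩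
  ext c d
  simp only [fm, dgl, Matrix.of_apply, e1, Matrix.diagonal_apply]
  split_ifs <;> first | rfl | (exfalso; grind)

theorem nf_eq_swp {ℓ : ι → ℕ} (hℓ : Function.Injective ℓ) {a b : ι} {j : ℕ}
    (ha : ℓ a + 1 = j) (hb : ℓ b = j) (X : R) : nf ℓ j X = swp a b X := by
  have e1 : ∀ c, ℓ c + 1 = j ↔ c = a :=
    fun c => ⟨fun h => hℓ (Nat.succ_injective (h.trans ha.symm)), fun h => h ▸ ha⟩
  have e2 : ∀ c, ℓ c = j ↔ c = b := fun c => ⟨fun h => hℓ (h.trans hb.symm), fun h => h ▸ hb⟩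
  have hab : a ≠ b := by rintro rfl; omega
  ext c d
  simp only [nf, swp, Matrix.of_apply, e1, e2]
  split_ifs <;> first | rfl | (exfalso; grind)

/-- Counting from the other end exchanges the labels `i, i - 1` with `m - i - 1, m - i`. Thus the
Fiedler matrices of the `z`-side are, for the labelling of the `w`-side, matrices of the inverse
type. -/
theorem fm_flip {m : ℕ} {ℓ ℓ' : ι → ℕ} (h : ∀ a, ℓ a + ℓ' a + 1 = m) {i : ℕ} (hi : i ≤ m) (X : R) :
    fm ℓ i X = nf ℓ' (m - i) X := by
  have e1 : ∀ c, ℓ' c + 1 = m - i ↔ ℓ c = i := fun c => by have := h c; omega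
  have e2 : ∀ c, ℓ' c = m - i ↔ ℓ c + 1 = i := fun c => by have := h c; omega
  ext c d
  simp only [fm, nf, Matrix.of_apply, e1, e2, or_comm]

theorem swp_mul_swp {a b : ι} (hab : a ≠ b) (X : R) : swp a b X * swp b a (-X) = 1 := by
  ext c d
  rw [swp_mul_apply hab]
  simp only [swp, Matrix.of_apply, Matrix.one_apply]
  split_ifs <;> grind

/-! ### Supports -/

/-- `M` agrees with the identity outside the rows and columns in `S`. -/
def Supp (S : Set ι) (M : Matrix ι ι R) : Prop :=
  ∀ a b, (a ∉ S ∨ b ∉ S) → (M - 1) a b = 0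

theorem Supp.mono {S T : Set ι} {M : Matrix ι ι R} (h : Supp S M) (hST : S ⊆ T) : Supp T M :=
  fun a b hab => h a b (hab.imp (fun ha ha' => ha (hST ha')) (fun ha ha' => ha (hST ha')))

theorem Supp.one (S : Set ι) : Supp S (1 : Matrix ι ι R) := fun a b _ => by simp

theorem Supp.mul {S : Set ι} {M N : Matrix ι ι R} (hM : Supp S M) (hN : Supp S N) :
    Supp S (M * N) := by
  intro a b hab
  have : M * N - 1 = (M - 1) * (N - 1) + (M - 1) + (N - 1) := by noncomm_ring
  rw [this, Matrix.add_apply, Matrix.add_apply, hM a b hab, hN a b hab, Matrix.mul_apply]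
  rw [Finset.sum_eq_zero]
  · simp
  · intro x _
    rcases hab with h | h
    · rw [hM a x (Or.inl h), zero_mul]
    · rw [hN x b (Or.inr h), mul_zero]

theorem Supp.apply_left {S : Set ι} {M : Matrix ι ι R} (hM : Supp S M) {a : ι} (ha : a ∉ S)
    (b : ι) : M a b = (1 : Matrix ι ι R) a b := sub_eq_zero.1 (hM a b (Or.inl ha))

theorem Supp.apply_right {S : Set ι} {M : Matrix ι ι R} (hM : Supp S M) (a : ι) {b : ι}
    (hb : b ∉ S) : M a b = (1 : Matrix ι ι R) a b := sub_eq_zero.1 (hM a b (Or.inr hb))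

theorem Supp.mul_apply_left {S : Set ι} {M : Matrix ι ι R} (hM : Supp S M) (N : Matrix ι ι R)
    {a : ι} (ha : a ∉ S) (b : ι) : (M * N) a b = N a b := by
  rw [Matrix.mul_apply, ← one_mul N, Matrix.mul_apply]
  simp only [one_mul]
  exact Finset.sum_congr rfl fun x _ => by rw [hM.apply_left ha]

theorem Supp.mul_apply_right {S : Set ι} {M : Matrix ι ι R} (hM : Supp S M) (N : Matrix ι ι R)
    (a : ι) {b : ι} (hb : b ∉ S) : (N * M) a b = N a b := by
  conv_rhs => rw [← mul_one N]
  rw [Matrix.mul_apply, Matrix.mul_apply]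
  exact Finset.sum_congr rfl fun x _ => by rw [hM.apply_right x hb]

/-- Disjoint supports kill both products of the defects `M - 1` and `N - 1`, so `M * N` and `N * M`
both equal `M + N - 1`. -/
theorem Supp.commute {S T : Set ι} {M N : Matrix ι ι R} (hM : Supp S M) (hN : Supp T N)
    (hST : Disjoint S T) : Commute M N := by
  have key : ∀ {S T : Set ι} {M N : Matrix ι ι R}, Supp S M → Supp T N → Disjoint S T →
      (M - 1) * (N - 1) = 0 := by
    intro S T M N hM hN hST
    ext a b
    rw [Matrix.mul_apply, Matrix.zero_apply]
    refine Finset.sum_eq_zero fun x _ => ?_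
    by_cases hx : x ∈ S
    · rw [hN x b (Or.inl (Set.disjoint_left.1 hST hx)), mul_zero]
    · rw [hM a x (Or.inr hx), zero_mul]
  have h1 := key hM hN hST
  have h2 := key hN hM hST.symm
  have e1 : M * N = (M - 1) * (N - 1) + M + N - 1 := by noncomm_ring
  have e2 : N * M = (N - 1) * (M - 1) + M + N - 1 := by noncomm_ring
  rw [Commute, SemiconjBy, e1, e2, h1, h2]

theorem supp_fm (ℓ : ι → ℕ) (i : ℕ) (X : R) : Supp {c | ℓ c = i ∨ ℓ c + 1 = i} (fm ℓ i X) := by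
  intro a b hab
  simp only [Set.mem_ofPred_eq] at hab
  simp only [fm, Matrix.sub_apply, Matrix.of_apply, Matrix.one_apply]
  split_ifs <;> first | (simp; done) | (exfalso; omega)

theorem supp_nf (ℓ : ι → ℕ) (i : ℕ) (X : R) : Supp {c | ℓ c = i ∨ ℓ c + 1 = i} (nf ℓ i X) := by
  intro a b hab
  simp only [Set.mem_ofPred_eq] at hab
  simp only [nf, Matrix.sub_apply, Matrix.of_apply, Matrix.one_apply]
  split_ifs <;> first | (simp; done) | (exfalso; omega)

theorem supp_fm_lt (ℓ : ι → ℕ) {i k : ℕ} (h : i < k) (X : R) : Supp {c | ℓ c < k} (fm ℓ i X) :=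
  (supp_fm ℓ i X).mono fun c hc => by simp only [Set.mem_ofPred_eq] at *; omega

theorem fm_mul_nf {ℓ : ι → ℕ} (hℓ : Function.Injective ℓ) {i : ℕ} (hi : 0 < i)
    (hs : ∀ j ≤ i, ∃ a, ℓ a = j) (X : R) : fm ℓ i X * nf ℓ i (-X) = 1 := by
  obtain ⟨a, ha⟩ := hs i le_rfl
  obtain ⟨b, hb⟩ := hs (i - 1) (by omega)
  rw [fm_eq_swp hℓ (a := a) (b := b) ha (by omega), nf_eq_swp hℓ (a := b) (b := a) (by omega) ha]
  exact swp_mul_swp (by rintro rfl; omega) X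

theorem nf_mul_fm {ℓ : ι → ℕ} (hℓ : Function.Injective ℓ) {i : ℕ} (hi : 0 < i)
    (hs : ∀ j ≤ i, ∃ a, ℓ a = j) (X : R) : nf ℓ i (-X) * fm ℓ i X = 1 := by
  obtain ⟨a, ha⟩ := hs i le_rfl
  obtain ⟨b, hb⟩ := hs (i - 1) (by omega)
  rw [fm_eq_swp hℓ (a := a) (b := b) ha (by omega), nf_eq_swp hℓ (a := b) (b := a) (by omega) ha]
  have := swp_mul_swp (a := b) (b := a) (by rintro rfl; omega) (-X)
  rwa [neg_neg] at this

/-! ### Words in Fiedler matrices -/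

/-- The product of the Fiedler matrices with indices in the list `t`. -/
def wp (ℓ : ι → ℕ) (X : ℕ → R) (t : List ℕ) : Matrix ι ι R := (t.map fun i => fm ℓ i (X i)).prod

@[simp] theorem wp_nil (ℓ : ι → ℕ) (X : ℕ → R) : wp ℓ X [] = 1 := rfl

@[simp] theorem wp_cons (ℓ : ι → ℕ) (X : ℕ → R) (i : ℕ) (t : List ℕ) :
    wp ℓ X (i :: t) = fm ℓ i (X i) * wp ℓ X t := by simp [wp]

@[simp] theorem wp_append (ℓ : ι → ℕ) (X : ℕ → R) (s t : List ℕ) :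
    wp ℓ X (s ++ t) = wp ℓ X s * wp ℓ X t := by simp [wp]

theorem supp_wp (ℓ : ι → ℕ) (X : ℕ → R) {k : ℕ} (t : List ℕ) (h : ∀ i ∈ t, i < k) :
    Supp {c | ℓ c < k} (wp ℓ X t) := by
  induction t with
  | nil => exact Supp.one _
  | cons i t ih =>
    rw [wp_cons]
    exact (supp_fm_lt ℓ (h i (by simp)) _).mul (ih fun j hj => h j (by simp [hj]))

theorem commute_fm_wp (ℓ : ι → ℕ) (X : ℕ → R) {i : ℕ} (x : R) (t : List ℕ)
    (h : ∀ j ∈ t, j + 1 < i) : Commute (fm ℓ i x) (wp ℓ X t) := by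
  rcases Nat.eq_zero_or_pos i with rfl | hi
  -- For index `0` the condition `j + 1 < 0` leaves no letter; the support argument with `i - 1` is
  -- meant for `i > 0` only.
  · have : t = [] := by
      rw [List.eq_nil_iff_forall_not_mem]
      intro j hj
      have := h j hj
      omega
    simp [this]
  · refine (supp_fm ℓ i x).commute (supp_wp ℓ X (k := i - 1) t fun j hj => ?_) ?_
    · have := h j hj
      omega
    · rw [Set.disjoint_left]
      intro c hc hc'
      simp only [Set.mem_ofPred_eq] at hc hc'
      omega

theorem isUnit_fm {ℓ : ι → ℕ} (hℓ : Function.Injective ℓ) {i : ℕ}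
    (hs : ∀ j ≤ i, ∃ a, ℓ a = j) {x : R} (hx : i = 0 → IsUnit x) : IsUnit (fm ℓ i x) := by
  rcases Nat.eq_zero_or_pos i with rfl | hi
  · obtain ⟨a, ha⟩ := hs 0 le_rfl
    rw [fm_zero_eq_dgl hℓ ha]
    obtain ⟨u, rfl⟩ := hx rfl
    refine ⟨⟨dgl a ↑u, dgl a ↑u⁻¹, ?_, ?_⟩, rfl⟩ <;>
    · simp only [dgl, Matrix.diagonal_mul_diagonal]
      rw [← Matrix.diagonal_one]
      congr 1
      ext c
      split_ifs <;> simp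
  · exact ⟨⟨_, _, fm_mul_nf hℓ hi hs x, nf_mul_fm hℓ hi hs x⟩, rfl⟩

theorem isUnit_wp {ℓ : ι → ℕ} (hℓ : Function.Injective ℓ) {k : ℕ}
    (hs : ∀ j < k, ∃ a, ℓ a = j) {X : ℕ → R} (t : List ℕ) (ht : ∀ i ∈ t, i < k)
    (hx : 0 ∈ t → IsUnit (X 0)) : IsUnit (wp ℓ X t) := by
  induction t with
  | nil => simp
  | cons i t ih =>
    rw [wp_cons]
    refine IsUnit.mul (isUnit_fm hℓ (fun j hj => hs j ?_) ?_) (ih ?_ ?_)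
    · have := ht i (by simp)
      omega
    · rintro rfl
      exact hx (by simp)
    · exact fun j hj => ht j (by simp [hj])
    · exact fun h => hx (by simp [h])

theorem map_fm {R' : Type*} [Ring R'] (f : R →+* R') (ℓ : ι → ℕ) (i : ℕ) (x : R) :
    (fm ℓ i x).map f = fm ℓ i (f x) := by
  ext a b
  simp only [fm, Matrix.map_apply, Matrix.of_apply]
  split_ifs <;> simp

/-- Identities between words over constant blocks are moved along this to polynomial blocks and to
proper rational blocks. -/
theorem map_wp {R' : Type*} [Ring R'] (f : R →+* R') (ℓ : ι → ℕ) (X : ℕ → R) (t : List ℕ) :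
    (wp ℓ X t).map f = wp ℓ (fun i => f (X i)) t := by
  induction t with
  | nil => simp [Matrix.map_one]
  | cons i t ih => rw [wp_cons, wp_cons, Matrix.map_mul, ih, map_fm]

end Elementary

/-! ### Signs carried through words, and hopping particles -/

section Signs

variable {ι R : Type*} [Fintype ι] [DecidableEq ι] [Ring R]

/-- The diagonal matrix of signs. -/
def sgn (ε : ι → ℤˣ) : Matrix ι ι R := Matrix.diagonal fun c => (((ε c : ℤˣ) : ℤ) : R)

/-- Moving the signs `ε` through `M` turns `M'` into `M` and `ε` into `ε'`. -/
def Sg (ε ε' : ι → ℤˣ) (M' M : Matrix ι ι R) : Prop := M' * sgn ε = sgn ε' * M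

theorem sg_iff {ε ε' : ι → ℤˣ} {M' M : Matrix ι ι R} :
    Sg ε ε' M' M ↔ ∀ a b, M' a b * (((ε b : ℤˣ) : ℤ) : R) = (((ε' a : ℤˣ) : ℤ) : R) * M a b := by
  rw [Sg, ← Matrix.ext_iff]
  simp only [sgn, Matrix.mul_diagonal, Matrix.diagonal_mul]

theorem Sg.one (ε : ι → ℤˣ) : Sg ε ε (1 : Matrix ι ι R) 1 := by simp [Sg]

theorem Sg.mul {ε ε' ε'' : ι → ℤˣ} {M' M N' N : Matrix ι ι R} (h₁ : Sg ε ε' M' M)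
    (h₂ : Sg ε' ε'' N' N) : Sg ε ε'' (N' * M') (N * M) := by
  rw [Sg] at *
  rw [mul_assoc, h₁, ← mul_assoc, h₂, mul_assoc]

/-- The identity blocks need the signs at the two labels to be exchanged, and the change from `-X`
to `X` needs them to be opposite. At index `0` there is only the block `X`, so the sign at label `0`
flips. -/
theorem sg_fm {ℓ : ι → ℕ} {i : ℕ} {X : R} {ε ε' : ι → ℤˣ}
    (h0 : i = 0 → ∀ a, ℓ a = 0 → ε' a = -ε a)
    (h1 : ∀ a b, ℓ a = i → ℓ b + 1 = i → ε a = -ε b ∧ ε' a = ε b ∧ ε' b = ε a)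
    (h2 : ∀ c, ℓ c ≠ i → ℓ c + 1 ≠ i → ε' c = ε c) (hℓ : Function.Injective ℓ)
    (hs : i ≠ 0 → ∃ b, ℓ b + 1 = i) :
    Sg ε ε' (fm ℓ i (-X)) (fm ℓ i X) := by
  rw [sg_iff]
  intro a b
  simp only [fm, Matrix.of_apply]
  by_cases c1 : ℓ a = i ∧ ℓ b = i
  · obtain rfl : a = b := hℓ (c1.1.trans c1.2.symm)
    rw [if_pos c1, if_pos c1]
    have : ε' a = -ε a := by
      rcases Nat.eq_zero_or_pos i with hi | hi
      · exact h0 hi a (c1.1.trans hi)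
      · obtain ⟨b, hb⟩ := hs hi.ne'
        obtain ⟨e1, e2, e3⟩ := h1 a b c1.1 hb
        rw [e1, e2, neg_neg]
    rw [this]
    push_cast
    rw [neg_mul, neg_mul, (Int.cast_commute _ X).eq]
  · rw [if_neg c1, if_neg c1]
    by_cases c2 : (ℓ a + 1 = i ∧ ℓ b = i) ∨ (ℓ a = i ∧ ℓ b + 1 = i)
    · rw [if_pos c2]
      rcases c2 with c2 | c2
      · rw [(h1 b a c2.2 c2.1).2.2, one_mul, mul_one]
      · rw [(h1 a b c2.1 c2.2).2.1, one_mul, mul_one]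
    · rw [if_neg c2]
      split_ifs with c3 c4
      · simp
      · subst c4
        rw [h2 a (by tauto) (by tauto)]
        simp
      · simp

/-- The sign attached to a bit. -/
def bs (b : Bool) : ℤˣ := if b then 1 else -1

/-- The bits after moving the bit at `s` to `s - 1` (or deleting it if `s = 0`). -/
def hopMove (b : ℕ → Bool) (s : ℕ) : ℕ → Bool :=
  fun i => if i = s then false else if i + 1 = s then true else b i

/-- The indices in the list can be moved one after the other. -/
def Hop : (ℕ → Bool) → List ℕ → Prop
  | _, [] => True
  | b, s :: t => b s = true ∧ (∀ i, i + 1 = s → b i = false) ∧ Hop (hopMove b s) t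

/-- The bits after moving all indices of a list. -/
def hopRun : (ℕ → Bool) → List ℕ → (ℕ → Bool)
  | b, [] => b
  | b, s :: t => hopRun (hopMove b s) t

/-- Signs given by bits for the labels `< k`. -/
def bitSign (ℓ : ι → ℕ) (k : ℕ) (b : ℕ → Bool) (ε : ι → ℤˣ) : ι → ℤˣ :=
  fun c => if ℓ c < k then bs (b (ℓ c)) else ε c

/-- A hop exchanges an occupied site with an empty one, hence two opposite signs, which is what
`sg_fm` asks for; a particle that disappears at `0` accounts for the sign flip there. The word is
reversed because the first hop corresponds to the rightmost factor met by the signs. -/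
theorem sg_hop {ℓ : ι → ℕ} (hℓ : Function.Injective ℓ) {k : ℕ} (hs : ∀ j < k, ∃ a, ℓ a = j)
    (X : ℕ → R) (ε : ι → ℤˣ) (t : List ℕ) (ht : ∀ i ∈ t, i < k) (b : ℕ → Bool) (hb : Hop b t) :
    Sg (bitSign ℓ k b ε) (bitSign ℓ k (hopRun b t) ε) (wp ℓ (-X) t.reverse)
      (wp ℓ X t.reverse) := by
  induction t generalizing b with
  | nil => exact Sg.one _
  | cons s t ih =>
    obtain ⟨hb1, hb2, hb3⟩ := hb
    have hsk := ht s (by simp)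
    simp only [List.reverse_cons, wp_append, wp_cons, wp_nil, mul_one, hopRun]
    refine Sg.mul ?_ (ih (fun i hi => ht i (by simp [hi])) _ hb3)
    refine sg_fm ?_ ?_ ?_ hℓ ?_
    · rintro rfl a ha
      simp [bitSign, ha, hsk, hopMove, hb1, bs]
    · intro a c ha hc
      have hck : ℓ c < k := by omega
      have h3 := hb2 (ℓ c) hc
      have hne : ℓ c ≠ s := by omega
      simp [bitSign, ha, hsk, hck, hb1, h3, bs, hopMove, hc, hne]
    · intro c h1 h2
      simp [bitSign, hopMove, h1, h2]
    · intro h0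
      obtain ⟨a, ha⟩ := hs (s - 1) (by omega)
      exact ⟨a, by omega⟩

end Signs

/-! ### Admissible tuples and symmetric complements: palindromes and signs -/

section Words

/-- The admissible tuple of `{0 : p + 2q}` with index `p`. -/
def adm (p : ℕ) : ℕ → List ℕ
  | 0 => List.range (p + 1)
  | q + 1 => (p + 2 * q + 1) :: (p + 2 * q + 2) :: adm p q

/-- The tuple `(0 : p-1, 0 : p-2, …, 0 : 1, 0)`. -/
def tri : ℕ → List ℕ
  | 0 => []
  | p + 1 => List.range (p + 1) ++ tri p

/-- The symmetric complement of the admissible tuple of `{0 : p + 2q}` with index `p`. -/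
def cpl (p : ℕ) : ℕ → List ℕ
  | 0 => tri p
  | q + 1 => (p + 2 * q + 1) :: cpl p q

theorem tri_lt {p i : ℕ} (h : i ∈ tri p) : i < p := by
  induction p with
  | zero => simp [tri] at h
  | succ p ih =>
    simp only [tri, List.mem_append, List.mem_range] at h
    rcases h with h | h
    · exact h
    · exact (ih h).trans (Nat.lt_succ_self p)

theorem adm_le {p q i : ℕ} (h : i ∈ adm p q) : i ≤ p + 2 * q := by
  induction q with
  | zero =>
    simp only [adm, List.mem_range] at h
    omega
  | succ q ih =>
    simp only [adm, List.mem_cons] at h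
    rcases h with h | h | h
    · omega
    · omega
    · have := ih h
      omega

theorem cpl_lt {p q i : ℕ} (h : i ∈ cpl p q) : i < p + 2 * q := by
  induction q with
  | zero => exact tri_lt h
  | succ q ih =>
    simp only [cpl, List.mem_cons] at h
    rcases h with h | h
    · omega
    · have := ih h
      omega

variable {ι R : Type*} [Fintype ι] [DecidableEq ι] [Ring R]

theorem wp_range_succ (ℓ : ι → ℕ) (X : ℕ → R) (p : ℕ) :
    wp ℓ X (List.range (p + 1)) = wp ℓ X (List.range p) * fm ℓ p (X p) := by
  rw [List.range_succ]
  simp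

/-- In the induction step the letter `p + 1` stands before the triangle `tri p`, whose letters are
all `< p`, so it passes through. This shift identity is what makes the triangle equal to its
reversal. -/
theorem tri_shift (ℓ : ι → ℕ) (X : ℕ → R) (p : ℕ) :
    wp ℓ X (List.range (p + 1)) * wp ℓ X (tri p) =
      wp ℓ X (tri p) * wp ℓ X (List.range (p + 1)).reverse := by
  induction p with
  | zero => simp [tri]
  | succ p ih =>
    have h1 : wp ℓ X (tri (p + 1)) = wp ℓ X (tri p) * wp ℓ X (List.range (p + 1)).reverse := by
      rw [← ih]
      simp [tri]
    have h2 : Commute (fm ℓ (p + 1) (X (p + 1))) (wp ℓ X (tri p)) :=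
      commute_fm_wp ℓ X _ _ fun j hj => by
        have := tri_lt hj
        omega
    calc _ = wp ℓ X (List.range (p + 1)) * fm ℓ (p + 1) (X (p + 1)) *
          (wp ℓ X (tri p) * wp ℓ X (List.range (p + 1)).reverse) := by rw [wp_range_succ, h1]
      _ = wp ℓ X (List.range (p + 1)) * (fm ℓ (p + 1) (X (p + 1)) * wp ℓ X (tri p)) *
          wp ℓ X (List.range (p + 1)).reverse := by simp only [mul_assoc]
      _ = wp ℓ X (List.range (p + 1)) * wp ℓ X (tri p) * (fm ℓ (p + 1) (X (p + 1)) *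
          wp ℓ X (List.range (p + 1)).reverse) := by rw [h2.eq]; simp only [mul_assoc]
      _ = wp ℓ X (tri (p + 1)) * (fm ℓ (p + 1) (X (p + 1)) *
          wp ℓ X (List.range (p + 1)).reverse) := by rw [ih, h1]
      _ = _ := by
        congr 1
        rw [List.range_succ (n := p + 1)]
        simp

theorem tri_pal (ℓ : ι → ℕ) (X : ℕ → R) (p : ℕ) :
    wp ℓ X (tri p).reverse = wp ℓ X (tri p) := by
  induction p with
  | zero => rfl
  | succ p ih =>
    simp only [tri, List.reverse_append, wp_append]
    rw [ih, tri_shift]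

theorem cpl_pal (ℓ : ι → ℕ) (X : ℕ → R) (p q : ℕ) :
    wp ℓ X (cpl p q).reverse = wp ℓ X (cpl p q) := by
  induction q with
  | zero => exact tri_pal ℓ X p
  | succ q ih =>
    simp only [cpl, List.reverse_cons, wp_append, wp_cons, wp_nil, mul_one, ih]
    rcases Nat.eq_zero_or_pos (p + 2 * q) with h | h
    · obtain ⟨rfl, rfl⟩ : p = 0 ∧ q = 0 := by omega
      simp [cpl, tri]
    · refine ((supp_fm ℓ _ _).commute (supp_wp ℓ X (k := p + 2 * q) _ fun i => cpl_lt) ?_).eq.symm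
      rw [Set.disjoint_left]
      intro c hc hc'
      simp only [Set.mem_ofPred_eq] at hc hc'
      omega

/-- The matrix of the admissible tuple followed by its symmetric complement. -/
def core (ℓ : ι → ℕ) (X : ℕ → R) (p q : ℕ) : Matrix ι ι R :=
  wp ℓ X (adm p q) * wp ℓ X (cpl p q)

theorem supp_core (ℓ : ι → ℕ) (X : ℕ → R) (p q : ℕ) :
    Supp {c | ℓ c < p + 2 * q + 1} (core ℓ X p q) :=
  (supp_wp ℓ X _ fun _ hi => Nat.lt_succ_of_le (adm_le hi)).mul
    (supp_wp ℓ X _ fun _ hi => (cpl_lt hi).trans (Nat.lt_succ_self _))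

theorem commute_fm_cpl (ℓ : ι → ℕ) (X : ℕ → R) (x : R) (p q : ℕ) :
    Commute (fm ℓ (p + 2 * q + 1) x) (wp ℓ X (cpl p q)) := by
  refine (supp_fm ℓ _ _).commute (supp_wp ℓ X (k := p + 2 * q) _ fun i => cpl_lt) ?_
  rw [Set.disjoint_left]
  intro c hc hc'
  simp only [Set.mem_ofPred_eq] at hc hc'
  omega

theorem commute_fm_core (ℓ : ι → ℕ) (X : ℕ → R) (x : R) (p q : ℕ) :
    Commute (fm ℓ (p + 2 * q + 2) x) (core ℓ X p q) := by
  refine (supp_fm ℓ _ _).commute (supp_core ℓ X p q) ?_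
  rw [Set.disjoint_left]
  intro c hc hc'
  simp only [Set.mem_ofPred_eq] at hc hc'
  omega

theorem core_zero (ℓ : ι → ℕ) (X : ℕ → R) (p : ℕ) : core ℓ X p 0 = wp ℓ X (tri (p + 1)) := by
  simp [core, adm, cpl, tri]

/-- The letter `p + 2q + 1` of the complement commutes with the inner complement and moves to the
far right. The letter `p + 2q + 2` may then stand on either side of the inner core: this form serves
for signs, `core_succ` for reversal and for rows. -/
theorem core_succ' (ℓ : ι → ℕ) (X : ℕ → R) (p q : ℕ) :
    core ℓ X p (q + 1) = fm ℓ (p + 2 * q + 1) (X (p + 2 * q + 1)) *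
      (fm ℓ (p + 2 * q + 2) (X (p + 2 * q + 2)) *
        (core ℓ X p q * fm ℓ (p + 2 * q + 1) (X (p + 2 * q + 1)))) := by
  simp only [core, adm, cpl, wp_cons]
  rw [(commute_fm_cpl ℓ X _ p q).eq]
  simp only [mul_assoc]

theorem core_succ (ℓ : ι → ℕ) (X : ℕ → R) (p q : ℕ) :
    core ℓ X p (q + 1) = fm ℓ (p + 2 * q + 1) (X (p + 2 * q + 1)) *
      (core ℓ X p q * (fm ℓ (p + 2 * q + 2) (X (p + 2 * q + 2)) *
        fm ℓ (p + 2 * q + 1) (X (p + 2 * q + 1)))) := by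
  rw [core_succ', ← mul_assoc (fm ℓ (p + 2 * q + 2) _), (commute_fm_core ℓ X _ p q).eq, mul_assoc]

/-- Once the complement is replaced by its reversal, removing the top pair of letters from the
reversed word leaves the reversed inner word, and the removed letters surround it in the order of
`core_succ`. -/
theorem core_pal (ℓ : ι → ℕ) (X : ℕ → R) (p q : ℕ) :
    wp ℓ X (adm p q ++ cpl p q).reverse = core ℓ X p q := by
  induction q with
  | zero => simpa [core_zero, adm, cpl, tri] using tri_pal ℓ X (p + 1)
  | succ q ih =>
    have h : wp ℓ X (cpl p (q + 1)).reverse = fm ℓ (p + 2 * q + 1) (X (p + 2 * q + 1)) *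
        wp ℓ X (cpl p q).reverse := by
      rw [cpl_pal, cpl_pal]
      simp [cpl]
    rw [List.reverse_append, wp_append, h, core_succ, ← ih]
    simp [adm, mul_assoc]

/-- The bits of the admissible tuple of `{0 : p + 2q}` with index `p`. -/
def bit0 (p q : ℕ) : ℕ → Bool := fun j => decide (p ≤ j ∧ j < p + 2 * q ∧ (j - p) % 2 = 0)

/-- The sign of `ε` is changed for the labels `< k`. -/
def flipBelow (ℓ : ι → ℕ) (k : ℕ) (ε : ι → ℤˣ) : ι → ℤˣ := fun c => if ℓ c < k then -ε c else ε c

/-- From constant signs, the factor with index `0` creates one opposite sign at label `0`, and the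
factors `1, …, p` then push it up to label `p`. -/
theorem sg_range {ℓ : ι → ℕ} (hℓ : Function.Injective ℓ) (X : ℕ → R) (p : ℕ)
    (hs : ∀ j ≤ p, ∃ a, ℓ a = j) (σ : ℤˣ) (ε : ι → ℤˣ) (hε : ∀ c, ℓ c ≤ p → ε c = σ) :
    Sg ε (fun c => if ℓ c = p then -σ else ε c) (wp ℓ (-X) (List.range (p + 1)).reverse)
      (wp ℓ X (List.range (p + 1)).reverse) := by
  induction p with
  | zero =>
    simp only [zero_add, List.range_one, List.reverse_singleton, wp_cons, wp_nil, mul_one]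
    refine sg_fm ?_ ?_ ?_ hℓ ?_
    · intro _ a ha
      simp [ha, hε a (by omega)]
    · intro a b _ h
      omega
    · intro c h _
      simp [h]
    · simp
  | succ p ih =>
    have h := ih (fun j hj => hs j (by omega)) (fun c hc => hε c (by omega))
    rw [List.range_succ (n := p + 1)]
    simp only [List.reverse_append, List.reverse_singleton, List.singleton_append, wp_cons]
    refine h.mul (sg_fm ?_ ?_ ?_ hℓ ?_)
    · omega
    · intro a b ha hb
      have hbp : ℓ b = p := by omega
      have e1 := hε a ha.le
      have e2 := hε b (by omega)
      simp [ha, hbp, e1, e2]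
    · intro c h1 h2
      have : ℓ c ≠ p := by omega
      simp [h1, this]
    · intro _
      obtain ⟨b, hb⟩ := hs p (by omega)
      exact ⟨b, by omega⟩

/-- By `tri_shift` the triangle ends with the descending run `p, …, 0`, which flips only the sign at
label `p`. The signs below are constant again, so the smaller triangle flips the rest. -/
theorem sg_tri {ℓ : ι → ℕ} (hℓ : Function.Injective ℓ) (X : ℕ → R) (p : ℕ)
    (hs : ∀ j < p, ∃ a, ℓ a = j) (σ : ℤˣ) (ε : ι → ℤˣ) (hε : ∀ c, ℓ c < p → ε c = σ) :
    Sg ε (flipBelow ℓ p ε) (wp ℓ (-X) (tri p)) (wp ℓ X (tri p)) := by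
  induction p generalizing ε with
  | zero =>
    have : flipBelow ℓ 0 ε = ε := by
      funext c
      simp [flipBelow]
    rw [this]
    exact Sg.one ε
  | succ p ih =>
    have e : ∀ Y : ℕ → R, wp ℓ Y (tri (p + 1)) =
        wp ℓ Y (tri p) * wp ℓ Y (List.range (p + 1)).reverse := by
      intro Y
      rw [← tri_shift]
      simp [tri]
    rw [e, e]
    have h1 := sg_range hℓ X p (fun j hj => hs j (by omega)) σ ε (fun c hc => hε c (by omega))
    refine h1.mul ?_
    convert ih (fun j hj => hs j (by omega)) (fun c => if ℓ c = p then -σ else ε c)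
      (fun c hc => ?_) using 1
    · funext c
      simp only [flipBelow]
      by_cases hc : ℓ c = p
      · simp [hc, hε c (by omega)]
      · by_cases hc' : ℓ c < p
        · simp [hc, hc', hc'.trans (Nat.lt_succ_self p)]
        · have : ¬ ℓ c < p + 1 := by omega
          simp [hc, hc', this]
    · have : ℓ c ≠ p := by omega
      simp [this, hε c (by omega)]

/-- Above `p` the signs alternate, and exchanging two opposite signs amounts to negating both; below
`p` they are constant and the triangle negates them. -/
theorem sg_cpl {ℓ : ι → ℕ} (hℓ : Function.Injective ℓ) (X : ℕ → R) (p q : ℕ)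
    (hs : ∀ j < p + 2 * q, ∃ a, ℓ a = j) (ε : ι → ℤˣ)
    (hε : ∀ c, ℓ c < p + 2 * q → ε c = bs (bit0 p q (ℓ c))) :
    Sg ε (flipBelow ℓ (p + 2 * q) ε) (wp ℓ (-X) (cpl p q)) (wp ℓ X (cpl p q)) := by
  induction q generalizing ε with
  | zero =>
    refine sg_tri hℓ X p hs (-1) ε fun c hc => ?_
    rw [hε c hc]
    have : ¬ p ≤ ℓ c := by omega
    simp [bit0, bs, this]
  | succ q ih =>
    simp only [cpl, wp_cons]
    refine (ih (fun j hj => hs j (by omega)) ε fun c hc => ?_).mul (sg_fm ?_ ?_ ?_ hℓ ?_)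
    · rw [hε c (by omega)]
      have h1 : ℓ c < p + 2 * (q + 1) := by omega
      have h2 : ℓ c < p + 2 * q := by omega
      simp [bit0, h1, h2]
    · omega
    · intro a b ha hb
      have hb' : ℓ b = p + 2 * q := by omega
      have e1 := hε a (by omega)
      have e2 := hε b (by omega)
      have e3 : bit0 p (q + 1) (ℓ a) = false := by simp [bit0]; omega
      have e4 : bit0 p (q + 1) (ℓ b) = true := by simp [bit0]; omega
      rw [e3] at e1
      rw [e4] at e2
      have l1 : ¬ ℓ a < p + 2 * q := by omega
      have l2 : ¬ ℓ b < p + 2 * q := by omega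
      have l3 : ℓ a < p + 2 * (q + 1) := by omega
      have l4 : ℓ b < p + 2 * (q + 1) := by omega
      simp [flipBelow, l1, l2, l3, l4, e1, e2, bs]
    · intro c h1 h2
      have : ℓ c < p + 2 * (q + 1) ↔ ℓ c < p + 2 * q := by omega
      simp [flipBelow, this]
    · intro _
      obtain ⟨b, hb⟩ := hs (p + 2 * q) (by omega)
      exact ⟨b, by omega⟩

theorem sg_core {ℓ : ι → ℕ} (hℓ : Function.Injective ℓ) (X : ℕ → R) (p q : ℕ)
    (hs : ∀ j < p + 2 * q + 1, ∃ a, ℓ a = j) (ε : ι → ℤˣ)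
    (hε : ∀ c, ℓ c < p + 2 * q + 1 → ε c = bs (bit0 p q (ℓ c))) :
    Sg ε (flipBelow ℓ (p + 2 * q + 1) ε) (core ℓ (-X) p q) (core ℓ X p q) := by
  induction q generalizing ε with
  | zero =>
    rw [core_zero, core_zero]
    refine sg_tri hℓ X (p + 1) hs (-1) ε fun c hc => ?_
    rw [hε c hc]
    have : ¬ (p ≤ ℓ c ∧ ℓ c < p) := by omega
    simp [bit0, bs]
    omega
  | succ q ih =>
    obtain ⟨a0, ha0⟩ := hs (p + 2 * q) (by omega)
    obtain ⟨a1, ha1⟩ := hs (p + 2 * q + 1) (by omega)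
    obtain ⟨a2, ha2⟩ := hs (p + 2 * q + 2) (by omega)
    have n01 : a0 ≠ a1 := by rintro rfl; omega
    have n02 : a0 ≠ a2 := by rintro rfl; omega
    have n12 : a1 ≠ a2 := by rintro rfl; omega
    have u0 : ∀ c, ℓ c = p + 2 * q → c = a0 := fun c h => hℓ (h.trans ha0.symm)
    have u1 : ∀ c, ℓ c = p + 2 * q + 1 → c = a1 := fun c h => hℓ (h.trans ha1.symm)
    have u2 : ∀ c, ℓ c = p + 2 * q + 2 → c = a2 := fun c h => hℓ (h.trans ha2.symm)
    have e0 : ε a0 = 1 := by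
      rw [hε a0 (by omega)]
      have : bit0 p (q + 1) (ℓ a0) = true := by simp [bit0]; omega
      simp [this, bs]
    have e1 : ε a1 = -1 := by
      rw [hε a1 (by omega)]
      have : bit0 p (q + 1) (ℓ a1) = false := by simp [bit0]; omega
      simp [this, bs]
    have e2 : ε a2 = -1 := by
      rw [hε a2 (by omega)]
      have : bit0 p (q + 1) (ℓ a2) = false := by simp [bit0]; omega
      simp [this, bs]
    rw [core_succ', core_succ', Pi.neg_apply, Pi.neg_apply]
    -- On the three top labels `p + 2q, p + 2q + 1, p + 2q + 2` the signs run through `(+,-,-)`,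
    -- `(-,+,-)`, `(+,+,-)`, `(+,-,+)`, `(-,+,+)`; the second of the four changes is due to the
    -- inner core.
    have s1 : Sg ε (Function.update (Function.update ε a0 (-1)) a1 1)
        (fm ℓ (p + 2 * q + 1) (-X (p + 2 * q + 1))) (fm ℓ (p + 2 * q + 1) (X (p + 2 * q + 1))) := by
      refine sg_fm (by omega) ?_ ?_ hℓ fun _ => ⟨a0, by omega⟩
      · intro a b ha hb
        rw [u1 a ha, u0 b (by omega)]
        simp [e0, e1, n01]
      · intro c h1 h2
        have : c ≠ a0 := by rintro rfl; omega
        have : c ≠ a1 := by rintro rfl; omega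
        simp [*]
    have s2 := ih (fun j hj => hs j (by omega))
      (Function.update (Function.update ε a0 (-1)) a1 1) (fun c hc => by
        have h1 : c ≠ a1 := by rintro rfl; omega
        by_cases h0 : c = a0
        · subst h0
          have : bit0 p q (ℓ c) = false := by simp [bit0]; omega
          simp [this, n01, bs]
        · have h3 : ℓ c ≠ p + 2 * q := fun h => h0 (u0 c h)
          have h4 : ℓ c < p + 2 * (q + 1) := by omega
          have h5 : ℓ c < p + 2 * q := by omega
          simp [h1, h0, hε c (by omega), bit0, h4, h5])
    set ε₂ := flipBelow ℓ (p + 2 * q + 1) (Function.update (Function.update ε a0 (-1)) a1 1)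
      with hε₂
    have v0 : ε₂ a0 = 1 := by simp [hε₂, flipBelow, ha0, n01]
    have v1 : ε₂ a1 = 1 := by simp [hε₂, flipBelow, ha1]
    have v2 : ε₂ a2 = -1 := by simp [hε₂, flipBelow, ha2, e2, n12.symm, n02.symm]
    have s3 : Sg ε₂ (Function.update (Function.update ε₂ a1 (-1)) a2 1)
        (fm ℓ (p + 2 * q + 2) (-X (p + 2 * q + 2))) (fm ℓ (p + 2 * q + 2) (X (p + 2 * q + 2))) := by
      refine sg_fm (by omega) ?_ ?_ hℓ fun _ => ⟨a1, by omega⟩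
      · intro a b ha hb
        rw [u2 a ha, u1 b (by omega), v1, v2]
        simp [n12]
      · intro c h1 h2
        have h3 : c ≠ a1 := by rintro rfl; omega
        have h4 : c ≠ a2 := by rintro rfl; omega
        rw [Function.update_of_ne h4, Function.update_of_ne h3]
    have s4 : Sg (Function.update (Function.update ε₂ a1 (-1)) a2 1)
        (flipBelow ℓ (p + 2 * (q + 1) + 1) ε)
        (fm ℓ (p + 2 * q + 1) (-X (p + 2 * q + 1))) (fm ℓ (p + 2 * q + 1) (X (p + 2 * q + 1))) := by
      refine sg_fm (by omega) ?_ ?_ hℓ fun _ => ⟨a0, by omega⟩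
      · intro a b ha hb
        rw [u1 a ha, u0 b (by omega)]
        have l1 : p + 2 * q + 1 < p + 2 * (q + 1) + 1 := by omega
        have l0 : p + 2 * q < p + 2 * (q + 1) + 1 := by omega
        simp [flipBelow, ha1, ha0, e1, e0, v0, n01, n12, n02, l1, l0]
      · intro c h1 h2
        have hc0 : c ≠ a0 := by rintro rfl; omega
        have hc1 : c ≠ a1 := by rintro rfl; omega
        by_cases hc2 : c = a2
        · subst hc2
          have l1 : p + 2 * q + 2 < p + 2 * (q + 1) + 1 := by omega
          simp [flipBelow, ha2, e2, l1]
        · have h3 : ℓ c ≠ p + 2 * q + 2 := fun h => hc2 (u2 c h)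
          have h4 : ℓ c < p + 2 * (q + 1) + 1 ↔ ℓ c < p + 2 * q + 1 := by omega
          rw [Function.update_of_ne hc2, Function.update_of_ne hc1, hε₂]
          simp only [flipBelow, h4, Function.update_of_ne hc1, Function.update_of_ne hc0]
    exact ((s1.mul s2).mul s3).mul s4

end Words

/-! ### From integer index tuples to particle configurations -/

section Tuples

/-- A list of natural numbers, regarded as an index tuple. -/
def castL (t : List ℕ) : List ℤ := t.map (Nat.cast : ℕ → ℤ)

/-- Coercing a list of naturals to a list of integers inside `str`, `IsAdmissible` and `symmCompl`
elaborates to a monadic lift; this turns it into a map. -/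
theorem lift_eq_castL (t : List ℕ) : (do let a ← t; pure (a : ℤ)) = castL t := by
  exact (List.map_eq_flatMap (f := (Nat.cast : ℕ → ℤ)) (l := t)).symm

theorem castL_append (s t : List ℕ) : castL (s ++ t) = castL s ++ castL t := by simp [castL]

theorem castL_reverse (t : List ℕ) : (castL t).reverse = castL t.reverse := by simp [castL]

theorem castL_injective : Function.Injective castL :=
  List.map_injective_iff.2 Nat.cast_injective

theorem castL_sublist {s t : List ℕ} : List.Sublist (castL s) (castL t) ↔ List.Sublist s t := by
  constructor
  · intro h
    obtain ⟨u, hu, e⟩ := List.sublist_map_iff.1 h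
    rwa [castL_injective e]
  · exact fun h => h.map _

theorem str_eq (a b : ℤ) : str a b = (List.range (b + 1 - a).toNat).map fun i : ℕ => a + (i : ℤ) := by
  rw [str, lift_eq_castL, castL, List.map_map]
  rfl

theorem str_zero (p : ℕ) : str 0 p = castL (List.range (p + 1)) := by
  have : ((p : ℤ) + 1 - 0).toNat = p + 1 := by omega
  simp [str_eq, castL]

theorem mem_str {a b x : ℤ} : x ∈ str a b ↔ a ≤ x ∧ x ≤ b := by
  simp only [str_eq, List.mem_map, List.mem_range]
  constructor
  · rintro ⟨i, hi, rfl⟩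
    omega
  · rintro ⟨h1, h2⟩
    exact ⟨(x - a).toNat, by omega, by omega⟩

theorem str_pair (a : ℤ) : str (a - 1) a = [a - 1, a] := by
  have : (a + 1 - (a - 1)).toNat = 2 := by omega
  simp [str_eq, List.range_succ]

theorem adm_eq {h p : ℕ} {w : List ℤ} (hw : IsAdmissible h p w) :
    ∃ q, h = p + 2 * q ∧ w = castL (adm p q) := by
  obtain ⟨hph, hev, rfl⟩ := hw
  obtain ⟨q, hq⟩ := hev
  refine ⟨q, by omega, ?_⟩
  have e : (h - p) / 2 = q := by omega
  rw [e, lift_eq_castL, castL, List.map_map]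
  clear e
  change flat ((List.range q).map (fun j : ℕ => ((h : ℤ) - 2 * j - 1, (h : ℤ) - 2 * j)) ++
    [(0, (p : ℤ))]) = _
  induction q generalizing h with
  | zero =>
    have := str_zero p
    simp [flat, adm, this]
  | succ q ih =>
    have := ih (h := h - 2) (by omega) (by omega)
    rw [List.range_succ_eq_map]
    simp only [List.map_cons, List.map_map, List.cons_append]
    have e2 : flat (((h : ℤ) - 2 * ((0 : ℕ) : ℤ) - 1, (h : ℤ) - 2 * ((0 : ℕ) : ℤ)) ::
        (List.map ((fun j : ℕ => ((h : ℤ) - 2 * j - 1, (h : ℤ) - 2 * j)) ∘ Nat.succ) (List.range q)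
          ++ [(0, (p : ℤ))])) = str ((h : ℤ) - 1) h ++ flat ((List.range q).map
      (fun j : ℕ => (((h - 2 : ℕ) : ℤ) - 2 * j - 1, ((h - 2 : ℕ) : ℤ) - 2 * j)) ++
        [(0, (p : ℤ))]) := by
      have : ((h - 2 : ℕ) : ℤ) = h - 2 := by omega
      simp only [flat, List.flatMap_cons, this]
      have e1 : List.map ((fun j : ℕ => ((h : ℤ) - 2 * j - 1, (h : ℤ) - 2 * j)) ∘ Nat.succ)
          (List.range q) =
          List.map (fun j : ℕ => ((h : ℤ) - 2 - 2 * j - 1, (h : ℤ) - 2 - 2 * j)) (List.range q) := by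
        refine List.map_congr_left fun j _ => ?_
        simp only [Function.comp, Nat.cast_succ, Prod.mk.injEq]
        constructor <;> ring
      rw [e1]
      simp
    rw [e2, this, str_pair]
    have h1 : (h : ℤ) - 1 = ((p + 2 * q + 1 : ℕ) : ℤ) := by omega
    have h2 : (h : ℤ) = ((p + 2 * q + 2 : ℕ) : ℤ) := by omega
    rw [h1]
    simp only [h2, adm, castL, List.map_cons, List.cons_append, List.nil_append]

theorem tri_eq (p : ℕ) :
    (List.range p).flatMap (fun j : ℕ => str 0 ((p : ℤ) - 1 - j)) = castL (tri p) := by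
  induction p with
  | zero => rfl
  | succ p ih =>
    rw [List.range_succ_eq_map, List.flatMap_cons, List.flatMap_map]
    have e : (fun j : ℕ => str 0 (((p + 1 : ℕ) : ℤ) - 1 - ((j.succ : ℕ) : ℤ))) =
        fun j : ℕ => str 0 ((p : ℤ) - 1 - j) := by
      funext j
      congr 1
      push_cast
      ring
    rw [e, ih]
    have e2 : ((p + 1 : ℕ) : ℤ) - 1 - ((0 : ℕ) : ℤ) = (p : ℤ) := by push_cast; ring
    rw [e2, str_zero, tri, castL_append]

theorem cpl_eq (p q : ℕ) : symmCompl (p + 2 * q) p = castL (cpl p q) := by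
  have e : (p + 2 * q - p) / 2 = q := by omega
  rw [symmCompl, e, lift_eq_castL, lift_eq_castL, castL, castL, List.map_map, List.flatMap_map]
  clear e
  change (List.range q).map (fun j : ℕ => ((p + 2 * q : ℕ) : ℤ) - 2 * j - 1) ++
    (List.range p).flatMap (fun j : ℕ => str 0 ((p : ℤ) - 1 - j)) = _
  rw [tri_eq]
  induction q with
  | zero => simp [cpl]
  | succ q ih =>
    rw [List.range_succ_eq_map, List.map_cons, List.map_map, List.cons_append, cpl]
    have e1 : (fun j : ℕ => ((p + 2 * (q + 1) : ℕ) : ℤ) - 2 * j - 1) ∘ Nat.succ =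
        fun j : ℕ => ((p + 2 * q : ℕ) : ℤ) - 2 * j - 1 := by
      funext j
      simp only [Function.comp]
      push_cast
      ring
    rw [e1, ih]
    have e2 : ((p + 2 * (q + 1) : ℕ) : ℤ) - 2 * ((0 : ℕ) : ℤ) - 1 = ((p + 2 * q + 1 : ℕ) : ℤ) := by
      push_cast
      ring
    rw [e2]
    simp [castL]

theorem mem_adm {p q i : ℕ} : i ∈ adm p q ↔ i ≤ p + 2 * q := by
  refine ⟨adm_le, ?_⟩
  induction q with
  | zero =>
    simp only [adm, List.mem_range]
    omega
  | succ q ih =>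
    intro h
    simp only [adm, List.mem_cons]
    by_cases h1 : i ≤ p + 2 * q
    · exact Or.inr (Or.inr (ih h1))
    · omega

theorem adm_nodup (p q : ℕ) : (adm p q).Nodup := by
  induction q with
  | zero => exact List.nodup_range
  | succ q ih =>
    simp only [adm, List.nodup_cons, List.mem_cons, mem_adm]
    refine ⟨by omega, by omega, ih⟩

/-- The letter `i + 1` precedes `i` exactly when `i + 1` opens one of the ascending pairs, that is,
for `i = p, p + 2, …`. After reversal of the tuple these are the ascents, hence the links inside
strings. -/
theorem pair_sublist_adm {p q i : ℕ} :
    List.Sublist [i + 1, i] (adm p q) ↔ bit0 p q i = true := by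
  have hc : ∀ (x : ℕ) (l : List ℕ), List.Sublist [i + 1, i] (x :: l) ↔
      List.Sublist [i + 1, i] l ∨ (i + 1 = x ∧ i ∈ l) := by
    intro x l
    rw [List.sublist_cons_iff]
    refine or_congr_right ⟨?_, ?_⟩
    · rintro ⟨r, h1, h2⟩
      simp only [List.cons.injEq] at h1
      obtain ⟨h1, rfl⟩ := h1
      exact ⟨h1, List.singleton_sublist.1 h2⟩
    · rintro ⟨rfl, h⟩
      exact ⟨[i], rfl, List.singleton_sublist.2 h⟩
  induction q with
  | zero =>
    have h1 : ¬ List.Sublist [i + 1, i] (adm p 0) := by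
      intro h
      have := (List.pairwise_lt_range (n := p + 1)).sublist h
      simp at this
    have h2 : bit0 p 0 i = false := by
      simp [bit0]
      omega
    simp [h1, h2]
  | succ q ih =>
    rw [adm, hc, hc]
    simp only [ih, List.mem_cons, mem_adm, bit0, decide_eq_true_eq]
    omega

/-! ### Column standard forms -/

theorem CommStep.perm {α β : List ℤ} (h : CommStep α β) : α.Perm β := by
  obtain ⟨l₁, l₂, i, j, _⟩ := h
  exact (List.Perm.swap j i l₂).append_left l₁

theorem eqvGen_perm {α β : List ℤ} (h : Relation.EqvGen CommStep α β) : α.Perm β := by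
  induction h with
  | rel _ _ h => exact h.perm
  | refl _ => exact List.Perm.refl _
  | symm _ _ _ ih => exact ih.symm
  | trans _ _ _ _ _ ih₁ ih₂ => exact ih₁.trans ih₂

/-- An allowed exchange never involves both `i` and `i + 1`, so the relative order of these two
letters is an invariant. -/
theorem eqvGen_filter {α β : List ℤ} (i : ℤ) (h : Relation.EqvGen CommStep α β) :
    α.filter (fun x => decide (x = i ∨ x = i + 1)) =
      β.filter (fun x => decide (x = i ∨ x = i + 1)) := by
  induction h with
  | rel _ _ h =>
    obtain ⟨l₁, l₂, a, b, hab⟩ := h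
    simp only [List.filter_append, List.filter_cons, decide_eq_true_eq]
    congr 1
    have : ¬ ((a = i ∨ a = i + 1) ∧ (b = i ∨ b = i + 1)) := by
      rintro ⟨h1, h2⟩
      rw [lt_abs] at hab
      omega
    split_ifs <;> first | rfl | (exfalso; tauto)
  | refl _ => rfl
  | symm _ _ _ ih => exact ih.symm
  | trans _ _ _ _ _ ih₁ ih₂ => exact ih₁.trans ih₂

theorem eqvGen_pair {α β : List ℤ} (i : ℤ) (h : Relation.EqvGen CommStep α β)
    (hα : List.Sublist [i, i + 1] α) : List.Sublist [i, i + 1] β := by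
  have h1 := hα.filter (fun x => decide (x = i ∨ x = i + 1))
  rw [eqvGen_filter i h] at h1
  simp only [true_or, or_true, decide_true, List.filter_cons_of_pos, List.filter_nil] at h1
  exact h1.trans List.filter_sublist

/-- The strings are separated and in decreasing order. -/
def GoodStr (bl : List (ℤ × ℤ)) : Prop :=
  bl.Pairwise (fun s t => t.2 < s.1) ∧ ∀ s ∈ bl, 0 ≤ s.1 ∧ s.1 ≤ s.2

/-- The bit at `i` tells whether `i` and `i + 1` belong to the same string. -/
def bitOf (bl : List (ℤ × ℤ)) : ℕ → Bool := fun i => decide (∃ s ∈ bl, s.1 ≤ i ∧ (i : ℤ) < s.2)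

theorem goodStr_of_csf {α : List ℤ} {bl : List (ℤ × ℤ)} (hα : α.Nodup) (h : HasCSF α bl) :
    GoodStr bl := by
  obtain ⟨h1, h2, h3⟩ := h
  have hn : (flat bl).Nodup := (eqvGen_perm h3).nodup_iff.1 hα
  refine ⟨?_, h2⟩
  clear h3
  induction bl with
  | nil => exact List.Pairwise.nil
  | cons s bl ih =>
    rw [List.pairwise_cons] at h1 ⊢
    simp only [flat, List.flatMap_cons] at hn
    rw [List.nodup_append] at hn
    refine ⟨fun t ht => ?_, ih h1.2 (fun s hs => h2 s (by simp [hs])) hn.2.1⟩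
    -- If the strings overlapped, the end of the lower one would belong to both, while a tuple
    -- equivalent to a repetition-free one has no repeated letter.
    by_contra hlt
    have ha := h1.1 t ht
    have hb := h2 t (by simp [ht])
    refine hn.2.2 t.2 (mem_str.2 ⟨by omega, ha.le⟩) t.2 ?_ rfl
    exact List.mem_flatMap.2 ⟨t, ht, mem_str.2 ⟨hb.2, le_rfl⟩⟩

/-- The strings occur in decreasing order, so `i` can precede `i + 1` only when both lie in one
string. -/
theorem pair_sublist_flat {bl : List (ℤ × ℤ)} (h : GoodStr bl) (i : ℕ) :
    List.Sublist [(i : ℤ), i + 1] (flat bl) ↔ bitOf bl i = true := by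
  simp only [bitOf, decide_eq_true_eq]
  constructor
  · intro hs
    induction bl with
    | nil => simp [flat] at hs
    | cons s bl ih =>
      obtain ⟨h1, h2⟩ := h
      rw [List.pairwise_cons] at h1
      simp only [flat, List.flatMap_cons] at hs
      obtain ⟨u, v, huv, hu, hv⟩ := List.sublist_append_iff.1 hs
      match u, huv, hu with
      | [], huv, _ =>
        obtain rfl : v = [(i : ℤ), i + 1] := by simpa using huv.symm
        obtain ⟨t, ht, ht'⟩ := ih ⟨h1.2, fun t ht => h2 t (by simp [ht])⟩ hv
        exact ⟨t, by simp [ht], ht'⟩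
      | [x], huv, hu =>
        simp only [List.cons_append, List.nil_append, List.cons.injEq] at huv
        obtain ⟨rfl, rfl⟩ := huv
        have hx := mem_str.1 (List.singleton_sublist.1 hu)
        obtain ⟨t, ht, ht'⟩ := List.mem_flatMap.1 (List.singleton_sublist.1 hv)
        have := mem_str.1 ht'
        have := h1.1 t ht
        omega
      | [x, y], huv, hu =>
        simp only [List.cons_append, List.nil_append, List.cons.injEq] at huv
        obtain ⟨rfl, rfl, _⟩ := huv
        have hx := mem_str.1 (hu.subset (List.mem_cons_self))
        have hy := mem_str.1 (hu.subset (List.mem_cons_of_mem _ List.mem_cons_self))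
        exact ⟨s, by simp, hx.1, by omega⟩
      | x :: y :: z :: l, huv, _ =>
        have := congrArg List.length huv
        simp at this
  · rintro ⟨s, hs, h1, h2⟩
    have e : List.Sublist (str s.1 s.2) (flat bl) := by
      obtain ⟨l₁, l₂, rfl⟩ := List.append_of_mem hs
      simp only [flat, List.flatMap_append, List.flatMap_cons]
      exact (List.sublist_append_left _ _).trans (List.sublist_append_right _ _)
    refine List.Sublist.trans ?_ e
    have hp : List.Pairwise (fun a b : ℤ => a < b) (str s.1 s.2) := by
      rw [str_eq, List.pairwise_map]
      exact List.pairwise_lt_range.imp fun hab => by omega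
    have hi : (i : ℤ) ∈ str s.1 s.2 := mem_str.2 ⟨h1, h2.le⟩
    obtain ⟨l₁, l₂, hl⟩ := List.append_of_mem hi
    have hi' : (i : ℤ) + 1 ∈ str s.1 s.2 := mem_str.2 ⟨by omega, by omega⟩
    rw [hl] at hi' hp ⊢
    rw [List.pairwise_append] at hp
    have h3 : (i : ℤ) + 1 ∈ l₂ := by
      rcases List.mem_append.1 hi' with h | h
      · have := hp.2.2 _ h i (by simp)
        omega
      · simpa using h
    exact ((List.singleton_sublist.2 h3).cons_cons _).trans (List.sublist_append_right _ _)

/-- The column standard form need not be computed: its particles record the relative order of `i`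
and `i + 1`, and that order is already visible in the reversed admissible tuple. -/
theorem bitOf_adm {p q : ℕ} {bl : List (ℤ × ℤ)} (h : HasCSF (castL (adm p q)).reverse bl) :
    GoodStr bl ∧ bitOf bl = bit0 p q := by
  have hn : (castL (adm p q)).reverse.Nodup := by
    rw [List.nodup_reverse]
    exact (adm_nodup p q).map Nat.cast_injective
  have hg := goodStr_of_csf hn h
  refine ⟨hg, funext fun i => ?_⟩
  rw [Bool.eq_iff_iff, ← pair_sublist_flat hg, ← pair_sublist_adm]
  have e : List.Sublist [(i : ℤ), i + 1] (castL (adm p q)).reverse ↔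
      List.Sublist [i + 1, i] (adm p q) := by
    rw [← List.reverse_sublist, List.reverse_reverse, ← castL_sublist]
    simp [castL]
  rw [← e]
  exact ⟨eqvGen_pair i (h.2.2.symm), eqvGen_pair i h.2.2⟩

/-- Moving `s` from the front of `(s:t)` to the end of `(a:s-1)` cuts the link between `s` and `s +
1` and creates the one between `s - 1` and `s`. That these are two different strings says that the
site `s - 1` was empty. For `s = 0` the link is only cut. -/
theorem assocSimple_hop {bl bl' : List (ℤ × ℤ)} {s : ℤ} (hg : GoodStr bl)
    (h : AssocSimple bl s bl') :
    ∃ n : ℕ, s = n ∧ GoodStr bl' ∧ bitOf bl n = true ∧ (∀ i, i + 1 = n → bitOf bl i = false) ∧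
      bitOf bl' = hopMove (bitOf bl) n := by
  obtain ⟨g1, g2⟩ := hg
  cases h with
  | pos l₁ l₂ s t a hs hst =>
    rw [List.pairwise_append, List.pairwise_cons, List.pairwise_cons] at g1
    obtain ⟨p1, ⟨p2, p3, p4⟩, p5⟩ := g1
    have q1 := g2 (s, t) (by simp)
    have q2 := g2 (a, s - 1) (by simp)
    simp only at q1 q2
    have r1 : ∀ u ∈ l₁, t < u.1 ∧ u.1 ≤ u.2 := fun u hu =>
      ⟨p5 u hu (s, t) (by simp), (g2 u (by simp [hu])).2⟩
    have r2 : ∀ u ∈ l₂, u.2 < a ∧ u.1 ≤ u.2 := fun u hu => ⟨p3 u hu, (g2 u (by simp [hu])).2⟩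
    refine ⟨s.toNat, by omega, ⟨?_, ?_⟩, ?_, ?_, ?_⟩
    · rw [List.pairwise_append, List.pairwise_cons, List.pairwise_cons]
      refine ⟨p1, ⟨?_, ?_, p4⟩, ?_⟩
      · intro u hu
        rcases List.mem_cons.1 hu with rfl | hu
        · simp
        · have := r2 u hu
          simp only
          omega
      · exact fun u hu => (r2 u hu).1
      · intro u hu v hv
        have := r1 u hu
        rcases List.mem_cons.1 hv with rfl | hv
        · simp only
          omega
        rcases List.mem_cons.1 hv with rfl | hv
        · simp only
          omega
        · have := r2 v hv
          omega
    · intro u hu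
      rcases List.mem_append.1 hu with hu | hu
      · exact g2 u (by simp [hu])
      rcases List.mem_cons.1 hu with rfl | hu
      · simp only
        omega
      rcases List.mem_cons.1 hu with rfl | hu
      · simp only
        omega
      · exact g2 u (by simp [hu])
    · simp only [bitOf, decide_eq_true_eq]
      exact ⟨(s, t), by simp, by simp only; omega, by simp only; omega⟩
    · intro i hi
      simp only [bitOf, decide_eq_false_iff_not]
      rintro ⟨u, hu, h1, h2⟩
      rcases List.mem_append.1 hu with hu | hu
      · have := r1 u hu
        omega
      rcases List.mem_cons.1 hu with rfl | hu
      · simp only at h1 h2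
        omega
      rcases List.mem_cons.1 hu with rfl | hu
      · simp only at h1 h2
        omega
      · have := r2 u hu
        omega
    · funext i
      -- Isolates the two strings that change; by `e2` all others lie above `t` or below `a` and do
      -- not influence the sites near `s`.
      have e1 : ∀ c d e f : ℤ × ℤ, ((∃ u ∈ l₁ ++ c :: d :: l₂, u.1 ≤ (i : ℤ) ∧ (i : ℤ) < u.2) ↔
          (∃ u ∈ l₁ ++ l₂, u.1 ≤ (i : ℤ) ∧ (i : ℤ) < u.2) ∨ (c.1 ≤ (i : ℤ) ∧ (i : ℤ) < c.2) ∨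
            (d.1 ≤ (i : ℤ) ∧ (i : ℤ) < d.2)) := by
        intro c d _ _
        simp only [List.mem_append, List.mem_cons]
        constructor
        · rintro ⟨u, hu | rfl | rfl | hu, h⟩
          · exact Or.inl ⟨u, Or.inl hu, h⟩
          · exact Or.inr (Or.inl h)
          · exact Or.inr (Or.inr h)
          · exact Or.inl ⟨u, Or.inr hu, h⟩
        · rintro (⟨u, hu | hu, h⟩ | h | h)
          · exact ⟨u, Or.inl hu, h⟩
          · exact ⟨u, Or.inr (Or.inr (Or.inr hu)), h⟩
          · exact ⟨c, Or.inr (Or.inl rfl), h⟩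
          · exact ⟨d, Or.inr (Or.inr (Or.inl rfl)), h⟩
      have e2 : (∃ u ∈ l₁ ++ l₂, u.1 ≤ (i : ℤ) ∧ (i : ℤ) < u.2) →
          t < (i : ℤ) ∨ (i : ℤ) < a := by
        rintro ⟨u, hu, h1, h2⟩
        rcases List.mem_append.1 hu with hu | hu
        · have := r1 u hu
          omega
        · have := r2 u hu
          omega
      simp only [bitOf, hopMove]
      by_cases c1 : i = s.toNat
      · rw [if_pos c1, decide_eq_false_iff_not, e1 _ _ (0, 0) (0, 0)]
        rintro (h | h | h)
        · have := e2 h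
          omega
        · simp only at h
          omega
        · simp only at h
          omega
      · rw [if_neg c1]
        by_cases c2 : i + 1 = s.toNat
        · rw [if_pos c2, decide_eq_true_eq, e1 _ _ (0, 0) (0, 0)]
          refine Or.inr (Or.inr ?_)
          simp only
          omega
        · rw [if_neg c2, decide_eq_decide, e1 _ _ (0, 0) (0, 0), e1 _ _ (0, 0) (0, 0)]
          refine or_congr_right ?_
          simp only
          omega
  | zero l₁ t ht =>
    rw [List.pairwise_append] at g1
    have r1 : ∀ u ∈ l₁, t < u.1 ∧ u.1 ≤ u.2 := fun u hu =>
      ⟨g1.2.2 u hu (0, t) (by simp), (g2 u (by simp [hu])).2⟩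
    refine ⟨0, rfl, ⟨?_, ?_⟩, ?_, by simp, ?_⟩
    · rw [List.pairwise_append]
      refine ⟨g1.1, by simp, fun u hu v hv => ?_⟩
      have := r1 u hu
      rcases List.mem_cons.1 hv with rfl | hv
      · simp only
        omega
      · rw [List.mem_singleton] at hv
        subst hv
        simp only
        omega
    · intro u hu
      rcases List.mem_append.1 hu with hu | hu
      · exact g2 u (by simp [hu])
      rcases List.mem_cons.1 hu with rfl | hu
      · simp only
        omega
      · rw [List.mem_singleton] at hu
        subst hu
        simp
    · simp only [bitOf, decide_eq_true_eq]
      exact ⟨(0, t), by simp, by simp, by simpa using ht⟩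
    · funext i
      simp only [bitOf, hopMove]
      by_cases c1 : i = 0
      · rw [if_pos c1, decide_eq_false_iff_not]
        rintro ⟨u, hu, h1, h2⟩
        rcases List.mem_append.1 hu with hu | hu
        · have := r1 u hu
          omega
        rcases List.mem_cons.1 hu with rfl | hu
        · simp only at h1
          omega
        · rw [List.mem_singleton] at hu
          subst hu
          simp only at h2
          omega
      · rw [if_neg c1, if_neg (by omega), decide_eq_decide]
        constructor
        · rintro ⟨u, hu, h1, h2⟩
          rcases List.mem_append.1 hu with hu | hu
          · exact ⟨u, by simp [hu], h1, h2⟩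
          rcases List.mem_cons.1 hu with rfl | hu
          · exact ⟨(0, t), by simp, by simp, h2⟩
          · rw [List.mem_singleton] at hu
            subst hu
            simp only at h2
            omega
        · rintro ⟨u, hu, h1, h2⟩
          rcases List.mem_append.1 hu with hu | hu
          · exact ⟨u, by simp [hu], h1, h2⟩
          · rw [List.mem_singleton] at hu
            subst hu
            exact ⟨(1, t), by simp, by simp only; omega, h2⟩

theorem typeOne_hop {bl : List (ℤ × ℤ)} {β : List ℤ} (hg : GoodStr bl) (h : TypeOneFrom bl β) :
    ∃ t : List ℕ, β = castL t ∧ Hop (bitOf bl) t := by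
  induction h with
  | nil bl => exact ⟨[], rfl, trivial⟩
  | cons bl bl' s β h _ ih =>
    obtain ⟨n, rfl, g, h1, h2, h3⟩ := assocSimple_hop hg h
    obtain ⟨t, rfl, ht⟩ := ih g
    exact ⟨n :: t, rfl, h1, h2, h3 ▸ ht⟩

theorem rightTypeOne_hop {p q : ℕ} {β : List ℤ}
    (h : IsRightTypeOne (p + 2 * q) (castL (adm p q)).reverse β) :
    ∃ t : List ℕ, β = castL t ∧ (∀ i ∈ t, i < p + 2 * q) ∧ Hop (bit0 p q) t := by
  obtain ⟨h1, bl, h2, h3⟩ := h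
  obtain ⟨g, e⟩ := bitOf_adm h2
  obtain ⟨t, rfl, ht⟩ := typeOne_hop g h3
  refine ⟨t, rfl, fun i hi => ?_, e ▸ ht⟩
  have := h1 i (List.mem_map.2 ⟨i, hi, rfl⟩)
  omega

/-! ### Greedy search for consecutive indices -/

/-- The first index of `j, j + 1, …` which is not reached when reading the list from the left. -/
def grd : ℕ → List ℕ → ℕ
  | j, [] => j
  | j, x :: l => if x = j then grd (j + 1) l else grd j l

theorem grd_append (j : ℕ) (s t : List ℕ) : grd j (s ++ t) = grd (grd j s) t := by
  induction s generalizing j with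
  | nil => rfl
  | cons x s ih =>
    simp only [List.cons_append, grd]
    split_ifs <;> exact ih _

theorem le_grd (j : ℕ) (t : List ℕ) : j ≤ grd j t := by
  induction t generalizing j with
  | nil => exact le_rfl
  | cons x s ih =>
    simp only [grd]
    split_ifs
    · exact (Nat.le_succ j).trans (ih _)
    · exact ih _

theorem grd_le (j : ℕ) (t : List ℕ) : grd j t ≤ j + t.length := by
  induction t generalizing j with
  | nil => simp [grd]
  | cons x s ih =>
    simp only [grd, List.length_cons]
    split_ifs
    · have := ih (j + 1)
      omega
    · have := ih j
      omega

/-- Taking each required index at its first occurrence is optimal, so the longest run `j, j + 1, …`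
inside a list is found by greedy reading. -/
theorem range'_sublist (j n : ℕ) (t : List ℕ) :
    List.Sublist (List.range' j n) t ↔ j + n ≤ grd j t := by
  induction t generalizing j n with
  | nil => cases n <;> simp [grd, List.range'_succ]
  | cons x s ih =>
    cases n with
    | zero => simp [le_grd]
    | succ n =>
      rw [List.range'_succ]
      simp only [grd]
      split_ifs with h
      · subst h
        rw [List.cons_sublist_cons, ih]
        omega
      · rw [← ih, List.range'_succ, List.sublist_cons_iff]
        constructor
        · rintro (h' | ⟨r, h1, _⟩)
          · exact h'
          · simp only [List.cons.injEq] at h1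
            exact absurd h1.1.symm h
        · exact Or.inl

theorem consec_eq (t : List ℕ) (h : 0 ∈ t) : consec 0 (castL t) = (grd 0 t : ℤ) - 1 := by
  have h0 : (0 : ℤ) ∈ castL t := List.mem_map.2 ⟨0, h, rfl⟩
  have h1 : 1 ≤ grd 0 t := by
    have := (range'_sublist 0 1 t).1 (by simpa [List.range'] using h)
    omega
  have hP : ∀ p : ℕ, List.Sublist (str 0 (0 + p)) (castL t) ↔ p + 1 ≤ grd 0 t := by
    intro p
    rw [zero_add, str_zero, castL_sublist, List.range_eq_range', range'_sublist, zero_add]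
  rw [consec, if_pos h0]
  -- The bound `length` in the definition of `consec` is harmless, because a greedy run is never
  -- longer than the list. Since `grd` returns the first index not reached, the last one reached is
  -- `grd - 1`.
  have e : Nat.findGreatest (fun p : ℕ => List.Sublist (str 0 (0 + p)) (castL t))
      (castL t).length = grd 0 t - 1 := by
    rw [Nat.findGreatest_eq_iff]
    have hl := grd_le 0 t
    refine ⟨?_, ?_, ?_⟩
    · simp only [castL, List.length_map]
      omega
    · intro _
      rw [hP]
      omega
    · intro n hn _
      rw [hP]
      omega
  rw [e]
  omega

theorem grd_adm (q : ℕ) : grd 0 (adm 0 q) = 1 := by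
  induction q with
  | zero => rfl
  | succ q ih => simp [adm, grd, ih]

/-- For index `0` the complement ends with the letter `1` as soon as it is nonempty, and no `2`
follows it. -/
theorem grd_cpl (q : ℕ) : grd 1 (cpl 0 q) = if q = 0 then 1 else 2 := by
  induction q with
  | zero => rfl
  | succ q ih =>
    rcases Nat.eq_zero_or_pos q with rfl | hq
    · rfl
    · have h1 : 0 + 2 * q + 1 ≠ 1 := by omega
      rw [cpl, grd, if_neg h1, ih]
      simp [hq.ne']

end Tuples

/-! ### Following a single row or column through a word -/

section Track

variable {ι R : Type*} [Fintype ι] [DecidableEq ι] [Ring R]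

/-- Row of a Fiedler matrix next below the index. -/
theorem fm_row_succ {ℓ : ι → ℕ} (X : R) {a c : ι} {j : ℕ} (ha : ℓ a = j) :
    fm ℓ (j + 1) X a c = if ℓ c = j + 1 then 1 else 0 := by
  simp only [fm, Matrix.of_apply, ha]
  split_ifs <;> grind

theorem fm_col_succ {ℓ : ι → ℕ} (X : R) {a c : ι} {j : ℕ} (ha : ℓ a = j) :
    fm ℓ (j + 1) X c a = if ℓ c = j + 1 then 1 else 0 := by
  simp only [fm, Matrix.of_apply, ha]
  split_ifs <;> grind

theorem row_mul {M N : Matrix ι ι R} {a b : ι} (h : ∀ c, M a c = if c = b then 1 else 0) (c : ι) :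
    (M * N) a c = N b c := by
  rw [Matrix.mul_apply, Finset.sum_eq_single b]
  · simp [h]
  · intro x _ hx
    simp [h, hx]
  · simp

theorem mul_col {M N : Matrix ι ι R} {a b : ι} (h : ∀ c, N c a = if c = b then 1 else 0) (c : ι) :
    (M * N) c a = M c b := by
  rw [Matrix.mul_apply, Finset.sum_eq_single b]
  · simp [h]
  · intro x _ hx
    simp [h, hx]
  · simp

/-- Only row `s` of the Fiedler matrix with index `s` contains `X`. Of the others, row `s - 1`
points to `s` and the rest point to themselves. -/
theorem fm_row_step {ℓ : ι → ℕ} (hℓ : Function.Injective ℓ) {a : ι} {j s : ℕ} (X : R)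
    (Z : Matrix ι ι R) (ha : ℓ a = j) (hsj : s ≠ j) {b : ι}
    (hb : ℓ b = if s = j + 1 then j + 1 else j) (c : ι) :
    (fm ℓ s X * Z) a c = Z b c := by
  split_ifs at hb with h
  · subst h
    refine row_mul (fun c => ?_) c
    rw [fm_row_succ X ha, ← hb]
    simp only [hℓ.eq_iff]
  · obtain rfl : b = a := hℓ (hb.trans ha.symm)
    refine (supp_fm ℓ s X).mul_apply_left Z ?_ c
    simp only [Set.mem_ofPred_eq]
    omega

theorem fm_col_step {ℓ : ι → ℕ} (hℓ : Function.Injective ℓ) {a : ι} {j s : ℕ} (X : R)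
    (Z : Matrix ι ι R) (ha : ℓ a = j) (hsj : s ≠ j) {b : ι}
    (hb : ℓ b = if s = j + 1 then j + 1 else j) (c : ι) :
    (Z * fm ℓ s X) c a = Z c b := by
  split_ifs at hb with h
  · subst h
    refine mul_col (fun c => ?_) c
    rw [fm_col_succ X ha, ← hb]
    simp only [hℓ.eq_iff]
  · obtain rfl : b = a := hℓ (hb.trans ha.symm)
    refine (supp_fm ℓ s X).mul_apply_right Z c ?_
    simp only [Set.mem_ofPred_eq]
    omega

/-- An empty site is never the next one to hop, so the row there stays a unit vector. If the next
hop starts at `j + 1`, the row moves to `j + 1`, which that hop has just emptied. Hence the label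
performs the greedy search that defines `grd`. -/
theorem track_hop {ℓ : ι → ℕ} (hℓ : Function.Injective ℓ) {k : ℕ} (hs : ∀ j < k, ∃ a, ℓ a = j)
    (X : ℕ → R) (t : List ℕ) (ht : ∀ i ∈ t, i < k) (b : ℕ → Bool) (hb : Hop b t) (j : ℕ)
    (hbj : b j = false) (a : ι) (ha : ℓ a = j) :
    ∃ a', (a' = a ∨ ℓ a' < k) ∧ ℓ a' + 1 = grd (j + 1) t ∧
      (∀ c, wp ℓ X t a c = if c = a' then 1 else 0) ∧
      (∀ c, wp ℓ X t.reverse c a = if c = a' then 1 else 0) := by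
  induction t generalizing b j a with
  | nil =>
    refine ⟨a, Or.inl rfl, by simp [grd, ha], fun c => ?_, fun c => ?_⟩
    · simp [Matrix.one_apply, eq_comm]
    · simp [Matrix.one_apply]
  | cons s t ih =>
    obtain ⟨hb1, hb2, hb3⟩ := hb
    have hsk := ht s (by simp)
    have hsj : s ≠ j := by
      rintro rfl
      rw [hb1] at hbj
      exact absurd hbj (by simp)
    have hex : ∃ d, ℓ d = if s = j + 1 then j + 1 else j := by
      split_ifs with h
      · exact hs _ (h ▸ hsk)
      · exact ⟨a, ha⟩
    obtain ⟨d, hd⟩ := hex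
    obtain ⟨a', h0, h1, h2, h3⟩ := ih (fun i hi => ht i (by simp [hi])) _ hb3
      (if s = j + 1 then j + 1 else j) (by
        split_ifs with h
        · simp [hopMove, h]
        · simp [hopMove, hsj.symm, Ne.symm h, hbj]) d hd
    refine ⟨a', ?_, ?_, fun c => ?_, fun c => ?_⟩
    · rcases h0 with rfl | h0
      · split_ifs at hd with h
        · exact Or.inr (by omega)
        · exact Or.inl (hℓ (hd.trans ha.symm))
      · exact Or.inr h0
    · rw [h1, grd]
      split_ifs <;> rfl
    · rw [wp_cons, fm_row_step hℓ _ _ ha hsj hd, h2]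
    · rw [List.reverse_cons, wp_append, wp_cons, wp_nil, mul_one, fm_col_step hℓ _ _ ha hsj hd, h3]

end Track

/-! ### Known blocks of the cores, and their transport along type-1 words -/

section Pattern

variable {ι R : Type*} [Fintype ι] [DecidableEq ι] [Ring R]

/-! ### Blocks of the core matrices -/

theorem fm_transpose_op (ℓ : ι → ℕ) (i : ℕ) (x : R) :
    (fm ℓ i x).transpose.map MulOpposite.op = fm ℓ i (MulOpposite.op x) := by
  ext a b
  simp only [fm, Matrix.map_apply, Matrix.transpose_apply, Matrix.of_apply]
  split_ifs <;> first | rfl | (exfalso; grind)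

/-- Over a noncommutative ring transposition reverses products only after passing to the opposite
ring. Since complements and cores equal their reversals, row statements about them yield column
statements. -/
theorem wp_transpose_op (ℓ : ι → ℕ) (X : ℕ → R) (t : List ℕ) :
    (wp ℓ X t).transpose.map MulOpposite.op =
      wp ℓ (fun i => MulOpposite.op (X i)) t.reverse := by
  induction t with
  | nil =>
    ext a b
    simp only [wp_nil, List.reverse_nil, Matrix.transpose_one, Matrix.map_apply, Matrix.one_apply]
    split_ifs <;> rfl
  | cons s t ih =>
    rw [List.reverse_cons, wp_append, wp_cons, wp_cons, wp_nil, mul_one, ← ih, ← fm_transpose_op]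
    ext a b
    simp only [Matrix.map_apply, Matrix.transpose_apply, Matrix.mul_apply, Finset.op_sum,
      MulOpposite.op_mul]

theorem cpl_transpose_op (ℓ : ι → ℕ) (X : ℕ → R) (p q : ℕ) (a b : ι) :
    MulOpposite.op (wp ℓ X (cpl p q) a b) =
      wp ℓ (fun i => MulOpposite.op (X i)) (cpl p q) b a := by
  have := congrFun (congrFun (wp_transpose_op ℓ X (cpl p q)) b) a
  rwa [cpl_pal] at this

theorem core_transpose_op (ℓ : ι → ℕ) (X : ℕ → R) (p q : ℕ) (a b : ι) :
    MulOpposite.op (core ℓ X p q a b) = core ℓ (fun i => MulOpposite.op (X i)) p q b a := by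
  have := congrFun (congrFun (wp_transpose_op ℓ X (adm p q ++ cpl p q)) b) a
  rwa [core_pal, wp_append] at this

theorem bit0_succ {p q j : ℕ} (h : bit0 p (q + 1) j = true) : j = p + 2 * q ∨ bit0 p q j = true := by
  simp only [bit0, decide_eq_true_eq] at *
  omega

theorem cpl_row {ℓ : ι → ℕ} (hℓ : Function.Injective ℓ) (X : ℕ → R) {p q : ℕ} {a d : ι}
    (ha : bit0 p q (ℓ a) = true) (hd : ℓ d = ℓ a + 1) (c : ι) :
    wp ℓ X (cpl p q) a c = if c = d then 1 else 0 := by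
  induction q with
  | zero =>
    simp only [bit0, decide_eq_true_eq] at ha
    omega
  | succ q ih =>
    rw [cpl, wp_cons]
    rcases bit0_succ ha with h | h
    · rw [fm_row_step hℓ (b := d) _ _ h (by omega) (by rw [if_pos rfl]; omega),
        (supp_wp ℓ X (k := p + 2 * q) _ fun _ => cpl_lt).apply_left (by
          simp only [Set.mem_ofPred_eq]
          omega), Matrix.one_apply]
      simp only [eq_comm]
    · have h' := h
      simp only [bit0, decide_eq_true_eq] at h'
      rw [fm_row_step hℓ (b := a) _ _ rfl (by omega) (by rw [if_neg (by omega)]), ih h]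

theorem cpl_col {ℓ : ι → ℕ} (hℓ : Function.Injective ℓ) (X : ℕ → R) {p q : ℕ} {a d : ι}
    (ha : bit0 p q (ℓ a) = true) (hd : ℓ d = ℓ a + 1) (c : ι) :
    wp ℓ X (cpl p q) c a = if c = d then 1 else 0 := by
  apply MulOpposite.op_injective
  rw [cpl_transpose_op, cpl_row hℓ _ ha hd]
  split_ifs <;> rfl

/-- Label of the partner in the core matrix. -/
def coreLabel (k j : ℕ) : ℕ := if j + 2 = k then k else j + 3

/-- The top particle row `p + 2q` is sent up by the left letter `p + 2q + 1`, skips the inner core,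
and is sent on to `p + 2q + 2`. For the next lower particle, the inner core leads to its own top
label `p + 2q`, which the last letter moves up by one; this is the `+ 3` in `coreLabel`. Lower rows
are not affected by the new letters. -/
theorem core_row {ℓ : ι → ℕ} (hℓ : Function.Injective ℓ) (X : ℕ → R) {p q : ℕ}
    (hs : ∀ j ≤ p + 2 * q, ∃ a, ℓ a = j) {a d : ι}
    (ha : bit0 p q (ℓ a) = true) (hd : ℓ d = coreLabel (p + 2 * q) (ℓ a)) (c : ι) :
    core ℓ X p q a c = if c = d then 1 else 0 := by
  induction q generalizing d c with
  | zero =>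
    simp only [bit0, decide_eq_true_eq] at ha
    omega
  | succ q ih =>
    obtain ⟨a0, ha0⟩ := hs (p + 2 * q) (by omega)
    obtain ⟨a1, ha1⟩ := hs (p + 2 * q + 1) (by omega)
    rw [core_succ]
    rcases bit0_succ ha with h | h
    · have hd' : ℓ d = p + 2 * q + 2 := by
        rw [hd, coreLabel, if_pos (by omega)]
        omega
      rw [fm_row_step hℓ (b := a1) _ _ h (by omega) (by rw [if_pos rfl]; omega),
        (supp_core ℓ X p q).mul_apply_left _ (by
          simp only [Set.mem_ofPred_eq]
          omega),
        fm_row_step hℓ (b := d) _ _ ha1 (by omega) (by rw [if_pos rfl]; omega),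
        (supp_fm ℓ _ _).apply_left (by
          simp only [Set.mem_ofPred_eq]
          omega), Matrix.one_apply]
      simp only [eq_comm]
    · have h' := h
      simp only [bit0, decide_eq_true_eq] at h'
      rw [fm_row_step hℓ (b := a) _ _ rfl (by omega) (by rw [if_neg (by omega)])]
      rw [coreLabel, if_neg (by omega)] at hd
      by_cases h2 : ℓ a + 2 = p + 2 * q
      · have e := ih (fun j hj => hs j (by omega)) h (d := a0) (by
          rw [coreLabel, if_pos h2, ha0])
        rw [row_mul e, fm_row_step hℓ (b := a0) _ _ ha0 (by omega) (by
            rw [if_neg (by omega), ha0]),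
          fm_row_succ _ ha0]
        have : ∀ c, ℓ c = p + 2 * q + 1 ↔ c = d := fun c =>
          ⟨fun h => hℓ (by omega), fun h => by subst h; omega⟩
        simp only [this]
      · have e := ih (fun j hj => hs j (by omega)) h (d := d) (by
          rw [coreLabel, if_neg h2, hd])
        rw [row_mul e, fm_row_step hℓ (b := d) _ _ rfl (by omega) (by rw [if_neg (by omega)]),
          (supp_fm ℓ _ _).apply_left (by
            simp only [Set.mem_ofPred_eq]
            omega), Matrix.one_apply]
        simp only [eq_comm]

theorem core_col {ℓ : ι → ℕ} (hℓ : Function.Injective ℓ) (X : ℕ → R) {p q : ℕ}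
    (hs : ∀ j ≤ p + 2 * q, ∃ a, ℓ a = j) {a d : ι}
    (ha : bit0 p q (ℓ a) = true) (hd : ℓ d = coreLabel (p + 2 * q) (ℓ a)) (c : ι) :
    core ℓ X p q c a = if c = d then 1 else 0 := by
  apply MulOpposite.op_injective
  rw [core_transpose_op, core_row hℓ _ hs ha hd]
  split_ifs <;> rfl

theorem range_row {ℓ : ι → ℕ} (hℓ : Function.Injective ℓ) (X : ℕ → R) (p : ℕ)
    (hs : ∀ j ≤ p, ∃ a, ℓ a = j) (a c : ι) (ha : ℓ a ≤ p) :
    wp ℓ X (List.range (p + 1)) a c =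
      (if ℓ c = p then X (ℓ a) else 0) + if ℓ c + 1 = ℓ a then 1 else 0 := by
  induction p generalizing a c with
  | zero =>
    have : ℓ a = 0 := by omega
    simp only [zero_add, List.range_one, wp_cons, wp_nil, mul_one, fm, Matrix.of_apply, this]
    split_ifs <;> grind
  | succ p ih =>
    obtain ⟨a0, ha0⟩ := hs p (by omega)
    obtain ⟨a1, ha1⟩ := hs (p + 1) (by omega)
    have n01 : a1 ≠ a0 := by rintro rfl; omega
    rw [wp_range_succ, fm_eq_swp hℓ (a := a1) (b := a0) ha1 (by omega), mul_swp_apply n01]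
    have e1 : ∀ x, ℓ x = p + 1 ↔ x = a1 := fun x =>
      ⟨fun h => hℓ (by omega), fun h => by subst h; omega⟩
    have e0 : ∀ x, ℓ x = p ↔ x = a0 := fun x =>
      ⟨fun h => hℓ (by omega), fun h => by subst h; omega⟩
    have hs' : ∀ j ≤ p, ∃ a, ℓ a = j := fun j hj => hs j (by omega)
    by_cases hap : ℓ a ≤ p
    · rw [ih hs' a a1 hap, ih hs' a a0 hap, ih hs' a c hap]
      by_cases c1 : c = a1
      · subst c1
        have h3 : ¬ p + 1 + 1 = ℓ a := by omega
        have h4 : ¬ p + 1 = ℓ a := by omega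
        simp [ha1, ha0, h3, h4]
      · by_cases c0 : c = a0
        · subst c0
          have h3 : ¬ p + 1 + 1 = ℓ a := by omega
          have h4 : ¬ p + 1 = ℓ a := by omega
          simp [ha1, ha0, h3, h4, c1]
        · have h1 := (e1 c).not.2 c1
          have h0 := (e0 c).not.2 c0
          simp [c1, c0, h1, h0]
    · have haa : a = a1 := (e1 a).1 (by omega)
      subst haa
      have hsup : ∀ x, wp ℓ X (List.range (p + 1)) a x = (1 : Matrix ι ι R) a x := fun x =>
        (supp_wp ℓ X (k := p + 1) _ fun i hi => List.mem_range.1 hi).apply_left (by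
          simp only [Set.mem_ofPred_eq]
          omega) x
      rw [hsup, hsup, hsup]
      by_cases c1 : c = a
      · subst c1
        simp [n01, ha1]
      · by_cases c0 : c = a0
        · subst c0
          simp [c1, ha1, ha0]
        · have h1 := (e1 c).not.2 c1
          have h0 := (e0 c).not.2 c0
          simp [c1, c0, ha1, h1, h0, Ne.symm c1]

/-- By `range_row` the run `0:p` acts like a companion matrix: it leads row `a` to the row one label
lower in the smaller triangle, so the antidiagonal is preserved, and row `0` contributes `X 0` in
column `p`. -/
theorem tri_entry {ℓ : ι → ℕ} (hℓ : Function.Injective ℓ) (X : ℕ → R) (p : ℕ)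
    (hs : ∀ j < p, ∃ a, ℓ a = j) (a b : ι) (hab : ℓ a + ℓ b + 1 = p) :
    wp ℓ X (tri p) a b = X 0 := by
  induction p generalizing a b with
  | zero => omega
  | succ p ih =>
    obtain ⟨a0, ha0⟩ := hs p (by omega)
    have hsup : ∀ x, wp ℓ X (tri p) a0 x = (1 : Matrix ι ι R) a0 x := fun x =>
      (supp_wp ℓ X (k := p) _ fun _ => tri_lt).apply_left (by
        simp only [Set.mem_ofPred_eq]
        omega) x
    have e0 : ∀ x, ℓ x = p ↔ x = a0 := fun x =>
      ⟨fun h => hℓ (by omega), fun h => by subst h; omega⟩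
    rw [tri, wp_append, Matrix.mul_apply]
    simp only [range_row hℓ X p (fun j hj => hs j (by omega)) a _ (by omega : ℓ a ≤ p), add_mul,
      Finset.sum_add_distrib, e0, ite_mul, zero_mul, Finset.sum_ite_eq', Finset.mem_univ, if_true,
      hsup, one_mul]
    by_cases h : ℓ a = 0
    · obtain rfl : b = a0 := (e0 b).1 (by omega)
      simp [h]
    · obtain ⟨a', ha'⟩ := hs (ℓ a - 1) (by omega)
      have e1 : ∀ x, ℓ x + 1 = ℓ a ↔ x = a' := fun x =>
        ⟨fun h => hℓ (by omega), fun h => by subst h; omega⟩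
      have hb : a0 ≠ b := fun h' => by
        subst h'
        omega
      simp only [e1, Finset.sum_ite_eq', Finset.mem_univ, if_true]
      rw [ih (fun j hj => hs j (by omega)) a' b (by omega)]
      simp [hb]

theorem cpl_entry {ℓ : ι → ℕ} (hℓ : Function.Injective ℓ) (X : ℕ → R) (p q : ℕ)
    (hs : ∀ j < p, ∃ a, ℓ a = j) (a b : ι) (hab : ℓ a + ℓ b + 1 = p) :
    wp ℓ X (cpl p q) a b = X 0 := by
  induction q with
  | zero => exact tri_entry hℓ X p hs a b hab
  | succ q ih =>
    rw [cpl, wp_cons, (supp_fm ℓ _ _).mul_apply_left _ (by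
      simp only [Set.mem_ofPred_eq]
      omega), ih]

theorem core_entry {ℓ : ι → ℕ} (hℓ : Function.Injective ℓ) (X : ℕ → R) (p q : ℕ)
    (hs : ∀ j ≤ p, ∃ a, ℓ a = j) (a b : ι) (ha : 1 ≤ ℓ a) (hb : 1 ≤ ℓ b) (hab : ℓ a + ℓ b = p) :
    core ℓ X p q a b = X 0 := by
  induction q with
  | zero =>
    rw [core_zero]
    exact tri_entry hℓ X (p + 1) (fun j hj => hs j (by omega)) a b (by omega)
  | succ q ih =>
    rw [core_succ, (supp_fm ℓ _ _).mul_apply_left _ (by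
      simp only [Set.mem_ofPred_eq]
      omega), ← mul_assoc, (supp_fm ℓ _ _).mul_apply_right _ _ (by
      simp only [Set.mem_ofPred_eq]
      omega), (supp_fm ℓ _ _).mul_apply_right _ _ (by
      simp only [Set.mem_ofPred_eq]
      omega), ih]

/-- For `q = 0` this is the corner of the antidiagonal. For `q > 0` the first added letter `p + 1`
moves that column from label `p` to `p + 1`, and later letters leave it in place. -/
theorem core_entry_zero {ℓ : ι → ℕ} (hℓ : Function.Injective ℓ) (X : ℕ → R) (p q : ℕ)
    (hs : ∀ j ≤ p + 2 * q, ∃ a, ℓ a = j) (a b : ι) (hp : 1 ≤ p) (ha : ℓ a = 0)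
    (hb : ℓ b = if q = 0 then p else p + 1) : core ℓ X p q a b = X 0 := by
  induction q generalizing b with
  | zero =>
    rw [core_zero]
    exact tri_entry hℓ X (p + 1) (fun j hj => hs j (by omega)) a b (by
      rw [if_pos rfl] at hb
      omega)
  | succ q ih =>
    rw [if_neg (by omega)] at hb
    rw [core_succ, (supp_fm ℓ _ _).mul_apply_left _ (by
      simp only [Set.mem_ofPred_eq]
      omega), ← mul_assoc]
    rcases Nat.eq_zero_or_pos q with rfl | hq
    · obtain ⟨a0, ha0⟩ := hs p (by omega)
      obtain ⟨a2, ha2⟩ := hs (p + 2) (by omega)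
      have n01 : b ≠ a0 := by rintro rfl; omega
      have n2 : a ≠ a2 := by rintro rfl; omega
      rw [fm_eq_swp hℓ (i := p + 2 * 0 + 1) (a := b) (b := a0) hb (by omega), mul_swp_apply n01, if_pos rfl,
        fm_col_step hℓ (b := a2) _ _ hb (by omega) (by rw [if_pos (by omega)]; omega),
        (supp_core ℓ X p 0).apply_right _ (by
          simp only [Set.mem_ofPred_eq]
          omega),
        (supp_fm ℓ _ _).mul_apply_right _ _ (by
          simp only [Set.mem_ofPred_eq]
          omega), ih (fun j hj => hs j (by omega)) a0 (by rw [if_pos rfl, ha0])]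
      simp [n2]
    · rw [(supp_fm ℓ _ _).mul_apply_right _ _ (by
        simp only [Set.mem_ofPred_eq]
        omega), (supp_fm ℓ _ _).mul_apply_right _ _ (by
        simp only [Set.mem_ofPred_eq]
        omega), ih (fun j hj => hs j (by omega)) b (by rw [if_neg hq.ne', hb])]

/-! ### Transport of blocks along type-1 tuples -/

/-- `M` and `M'` are, up to terms in the columns (rows) in `Pt`, the permutation matrix of `π` with
weights in `W`; rows of `M` in `live` are unit vectors. -/
structure Transport (Pt live : ι → Prop) (W : Set R) (π : Equiv.Perm ι) (M M' : Matrix ι ι R) :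
    Prop where
  live_pt : ∀ a, live a → Pt (π a)
  row_live : ∀ a, live a → ∀ c, M a c = if c = π a then 1 else 0
  hole : ∀ a c, ¬ Pt c → M a c = if c = π a then 1 else 0
  weight : ∀ a, M a (π a) ∈ W
  hole' : ∀ d b, ¬ Pt d → M' d b = if d = π b then 1 else 0

theorem Transport.init (Pt : ι → Prop) {W : Set R} (hW : 1 ∈ W) :
    Transport Pt Pt W 1 1 1 where
  live_pt _ h := h
  row_live a _ c := by simp [Matrix.one_apply, eq_comm]
  hole a c _ := by simp [Matrix.one_apply, eq_comm]
  weight a := by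
    rw [Equiv.Perm.one_apply, Matrix.one_apply_eq]
    exact hW
  hole' d b _ := by rw [Equiv.Perm.one_apply, Matrix.one_apply]

/-- A hop multiplies the live row `a` by `X`. As this row is a unit vector with its entry in a
particle column, the new term also lies in a particle column, and outside these columns only the
permutation changes. -/
theorem Transport.swp {Pt live : ι → Prop} {W : Set R} {π : Equiv.Perm ι} {M M' : Matrix ι ι R}
    (h : Transport Pt live W π M M') {a b : ι} (hab : a ≠ b) (ha : live a) (X : R) :
    Transport Pt (fun c => (c ≠ a ∧ live c) ∨ c = b) W ((Equiv.swap a b).trans π)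
      (GFPR.swp a b X * M) (M' * GFPR.swp a b X) := by
  have hπ : π a ≠ π b := fun e => hab (π.injective e)
  refine ⟨?_, ?_, ?_, ?_, ?_⟩
  · rintro c (⟨h1, h2⟩ | rfl)
    · by_cases hc : c = b
      · subst hc
        simpa using h.live_pt a ha
      · simpa [Equiv.swap_apply_of_ne_of_ne h1 hc] using h.live_pt c h2
    · simpa using h.live_pt a ha
  · rintro c hc d
    rw [swp_mul_apply hab]
    by_cases hcb : c = b
    · subst hcb
      simp [hab.symm, h.row_live a ha]
    · obtain ⟨h1, h2⟩ : c ≠ a ∧ live c := by tauto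
      simp [h1, hcb, h.row_live c h2, Equiv.swap_apply_of_ne_of_ne h1 hcb]
  · intro c d hd
    have hda : d ≠ π a := by
      rintro rfl
      exact hd (h.live_pt a ha)
    rw [swp_mul_apply hab]
    by_cases hca : c = a
    · subst hca
      simp [h.row_live c ha, hda, h.hole b d hd]
    · by_cases hcb : c = b
      · subst hcb
        simp [hca, h.row_live a ha]
      · simp [hca, hcb, h.hole c d hd, Equiv.swap_apply_of_ne_of_ne hca hcb]
  · intro c
    rw [swp_mul_apply hab]
    by_cases hca : c = a
    · subst hca
      simpa [h.row_live c ha, hπ.symm] using h.weight b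
    · by_cases hcb : c = b
      · subst hcb
        simpa [hca] using h.weight a
      · simpa [hca, hcb, Equiv.swap_apply_of_ne_of_ne hca hcb] using h.weight c
  · intro d c hd
    have hda : d ≠ π a := by
      rintro rfl
      exact hd (h.live_pt a ha)
    rw [mul_swp_apply hab]
    by_cases hca : c = a
    · subst hca
      simp [h.hole' d c hd, h.hole' d b hd, hda]
    · by_cases hcb : c = b
      · subst hcb
        simp [hca, h.hole' d a hd]
      · simp [hca, hcb, h.hole' d c hd, Equiv.swap_apply_of_ne_of_ne hca hcb]

/-- A particle disappearing at label `0` scales its unit row, so `X` itself becomes the weight of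
that row, and the row is no longer live. -/
theorem Transport.dgl {Pt live : ι → Prop} {W : Set R} {π : Equiv.Perm ι} {M M' : Matrix ι ι R}
    (h : Transport Pt live W π M M') {a : ι} (ha : live a) {X : R} (hX : X ∈ W) :
    Transport Pt (fun c => c ≠ a ∧ live c) W π (GFPR.dgl a X * M) (M' * GFPR.dgl a X) := by
  refine ⟨fun c hc => h.live_pt c hc.2, ?_, ?_, ?_, ?_⟩
  · rintro c ⟨h1, h2⟩ d
    rw [dgl_mul_apply, if_neg h1, h.row_live c h2]
  · intro c d hd
    rw [dgl_mul_apply]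
    by_cases hca : c = a
    · subst hca
      have hda : d ≠ π c := by
        rintro rfl
        exact hd (h.live_pt c ha)
      simp [h.hole c d hd, hda]
    · rw [if_neg hca, h.hole c d hd]
  · intro c
    rw [dgl_mul_apply]
    by_cases hca : c = a
    · subst hca
      simpa [h.row_live c ha] using hX
    · simpa [hca] using h.weight c
  · intro d c hd
    rw [mul_dgl_apply]
    by_cases hca : c = a
    · subst hca
      have hda : d ≠ π c := by
        rintro rfl
        exact hd (h.live_pt c ha)
      simp [h.hole' d c hd, hda]
    · rw [if_neg hca, h.hole' d c hd]

theorem Transport.hop {ℓ : ι → ℕ} (hℓ : Function.Injective ℓ) {k : ℕ}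
    (hs : ∀ j < k, ∃ a, ℓ a = j) (X : ℕ → R) {Pt : ι → Prop} {W : Set R} (t : List ℕ)
    (ht : ∀ i ∈ t, i < k) (hW : 0 ∈ t → X 0 ∈ W) (b : ℕ → Bool) (hb : Hop b t)
    {live : ι → Prop} {π : Equiv.Perm ι} {M M' : Matrix ι ι R}
    (h : Transport Pt live W π M M') (hlive : ∀ c, ℓ c < k → (live c ↔ b (ℓ c) = true)) :
    ∃ live' π', Transport Pt live' W π' (wp ℓ X t.reverse * M) (M' * wp ℓ X t) ∧
      ∀ c, k ≤ ℓ c → (live' c ↔ live c) := by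
  induction t generalizing b live π M M' with
  | nil => exact ⟨live, π, by simpa using h, fun _ _ => Iff.rfl⟩
  | cons s t ih =>
    obtain ⟨hb1, hb2, hb3⟩ := hb
    have hsk := ht s (by simp)
    obtain ⟨a, ha⟩ := hs s hsk
    have hla : live a := (hlive a (by omega)).2 (by rw [ha, hb1])
    have e1 : wp ℓ X (s :: t).reverse * M = wp ℓ X t.reverse * (fm ℓ s (X s) * M) := by
      simp [mul_assoc]
    have e2 : M' * wp ℓ X (s :: t) = M' * fm ℓ s (X s) * wp ℓ X t := by simp [mul_assoc]
    rw [e1, e2]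
    have ih' := fun live π M M' => ih (fun i hi => ht i (by simp [hi]))
      (fun h => hW (by simp [h])) _ hb3 (live := live) (π := π) (M := M) (M' := M')
    rcases Nat.eq_zero_or_pos s with rfl | hs0
    · have h1 := h.dgl hla (hW (by simp))
      rw [← fm_zero_eq_dgl hℓ ha] at h1
      obtain ⟨live', π', h2, h3⟩ := ih' _ _ _ _ h1 (fun c hc => by
        rw [hlive c hc, hopMove]
        by_cases hca : c = a
        · subst hca
          simp [ha]
        · have : ℓ c ≠ 0 := fun e => hca (hℓ (e.trans ha.symm))
          simp [hca, this])
      refine ⟨live', π', h2, fun c hc => ?_⟩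
      rw [h3 c hc]
      have : c ≠ a := by rintro rfl; omega
      simp [this]
    · obtain ⟨d, hd⟩ := hs (s - 1) (by omega)
      have had : a ≠ d := by rintro rfl; omega
      have h1 := h.swp had hla (X s)
      rw [← fm_eq_swp hℓ ha (by omega)] at h1
      obtain ⟨live', π', h2, h3⟩ := ih' _ _ _ _ h1 (fun c hc => by
        rw [hlive c hc, hopMove]
        by_cases hca : c = a
        · subst hca
          simp [ha, had]
        · have : ℓ c ≠ s := fun e => hca (hℓ (e.trans ha.symm))
          by_cases hcd : c = d
          · subst hcd
            have : ℓ c + 1 = s := by omega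
            have h6 : ℓ c ≠ s := by omega
            simp [this, h6]
          · have h5 : ℓ c + 1 ≠ s := fun e => hcd (hℓ (by omega))
            simp [hca, hcd, this, h5])
      refine ⟨live', π', h2, fun c hc => ?_⟩
      rw [h3 c hc]
      have : c ≠ a := by rintro rfl; omega
      have : c ≠ d := by rintro rfl; omega
      simp [*]

/-- For `E c d`, row and column `c` of `C` are unit vectors at `d`. -/
def UnitRel (E : ι → ι → Prop) (C : Matrix ι ι R) : Prop :=
  ∀ c d, E c d → ∀ x, (C c x = if x = d then 1 else 0) ∧ (C x c = if x = d then 1 else 0)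

theorem UnitRel.mul {S T : Set ι} {E F : ι → ι → Prop} {A B : Matrix ι ι R} (hA : UnitRel E A)
    (hB : UnitRel F B) (sA : Supp S A) (sB : Supp T B) (hST : Disjoint S T)
    (hE : ∀ c d, E c d → c ∉ T ∧ d ∉ T) (hF : ∀ c d, F c d → c ∉ S ∧ d ∉ S) :
    UnitRel (fun c d => E c d ∨ F c d) (A * B) := by
  have key : ∀ {S T : Set ι} {E : ι → ι → Prop} {A B : Matrix ι ι R}, UnitRel E A → Supp S A →
      Supp T B → (∀ c d, E c d → c ∉ T ∧ d ∉ T) → UnitRel E (A * B) := by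
    intro S T E A B hA sA sB hE c d hcd x
    constructor
    · rw [row_mul (fun y => (hA c d hcd y).1), sB.apply_left (hE c d hcd).2, Matrix.one_apply]
      simp only [eq_comm]
    · rw [sB.mul_apply_right _ _ (hE c d hcd).1, (hA c d hcd x).2]
  rintro c d (h | h)
  · exact key hA sA sB hE c d h
  · rw [(sA.commute sB hST).eq]
    exact key hB sB sA hF c d h

/-- The unwanted terms of `M` sit in particle columns, and `C` sends different particles to
different holes, where `M'` acts as the permutation. So just one summand survives and the block
equals a single weight; nothing can cancel. -/
theorem Transport.edge {Pt live : ι → Prop} {W : Set R} {π : Equiv.Perm ι} {M M' C : Matrix ι ι R}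
    (h : Transport Pt live W π M M') {E : ι → ι → Prop} (hC : UnitRel E C)
    (hE : ∀ c, Pt c → ∃ d, E c d) (hE' : ∀ c d, E c d → ¬ Pt d)
    (hinj : ∀ c c' d, E c d → E c' d → c = c') {c d : ι} (hcd : E c d) :
    (M * C * M') (π.symm c) (π.symm d) ∈ W := by
  have e : (M * C * M') (π.symm c) (π.symm d) = M (π.symm c) c := by
    rw [mul_assoc, Matrix.mul_apply, Finset.sum_eq_single c]
    · rw [row_mul (fun y => (hC c d hcd y).1), h.hole' d _ (hE' c d hcd)]
      simp
    · intro x _ hx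
      by_cases hp : Pt x
      · obtain ⟨d', hd'⟩ := hE x hp
        rw [row_mul (fun y => (hC x d' hd' y).1), h.hole' d' _ (hE' x d' hd')]
        have : d' ≠ d := by
          rintro rfl
          exact hx (hinj _ _ _ hd' hcd)
        simp [this]
      · rw [h.hole _ x hp]
        simp [hx]
    · simp
  rw [e]
  simpa using h.weight (π.symm c)

/-- For two holes that are not partners of any particle, all unwanted terms of `M` and `M'` miss the
entry, and the block of `C` appears unchanged. -/
theorem Transport.hole_entry {Pt live : ι → Prop} {W : Set R} {π : Equiv.Perm ι}
    {M M' C : Matrix ι ι R}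
    (h : Transport Pt live W π M M') {E : ι → ι → Prop} (hC : UnitRel E C)
    (hE : ∀ c, Pt c → ∃ d, E c d) (hE' : ∀ c d, E c d → ¬ Pt d)
    {c d : ι} (hc : ¬ Pt c) (hd : ¬ Pt d) (hc' : ∀ x, ¬ E x c) (hd' : ∀ x, ¬ E x d) :
    (M * C * M') (π.symm c) (π.symm d) = C c d := by
  rw [mul_assoc, Matrix.mul_apply, Finset.sum_eq_single c]
  · rw [h.hole _ c hc, Matrix.mul_apply, Finset.sum_eq_single d]
    · rw [h.hole' d _ hd]
      simp
    · intro y _ hy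
      by_cases hp : Pt y
      · obtain ⟨e, he⟩ := hE y hp
        rw [(hC y e he c).2, if_neg, zero_mul]
        rintro rfl
        exact hc' y he
      · rw [h.hole' y _ hp]
        simp [hy]
    · simp
  · intro x _ hx
    by_cases hp : Pt x
    · obtain ⟨e, he⟩ := hE x hp
      rw [row_mul (fun y => (hC x e he y).1), h.hole' e _ (hE' x e he)]
      have : e ≠ d := by
        rintro rfl
        exact hd' x he
      simp [this]
    · rw [h.hole _ x hp]
      simp [hx]
  · simp

/-- Connectedness of the graph of the core matrices. -/
theorem side_connected {T : Type*} (p q : ℕ) (r : ℕ → T)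
    (g1 : ∀ j, bit0 p q j = true → r j = r (j + 1))
    (g2 : ∀ j, bit0 p q j = true → r j = r (coreLabel (p + 2 * q) j))
    (g3 : ∀ i j, i + j + 1 = p → r i = r j)
    (g4 : ∀ i j, 1 ≤ i → 1 ≤ j → i + j = p → r i = r j)
    (g5 : 1 ≤ p → r 0 = r (if q = 0 then p else p + 1)) :
    ∀ j ≤ p + 2 * q, r j = r (p + 2 * q) := by
  -- Descending induction along the particles: `d = q - 1 - i` counts those above `p + 2i`. Each
  -- pair `p + 2i, p + 2i + 1` is linked to the next pair or, for the last one, to the top label.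
  have hA : ∀ d i, i + d + 1 = q → r (p + 2 * i) = r (p + 2 * q) ∧
      r (p + 2 * i + 1) = r (p + 2 * q) := by
    intro d
    induction d with
    | zero =>
      intro i hi
      have hb : bit0 p q (p + 2 * i) = true := by simp [bit0]; omega
      have e1 := g1 _ hb
      have e2 := g2 _ hb
      rw [coreLabel, if_pos (by omega)] at e2
      exact ⟨e2, e1.symm.trans e2⟩
    | succ d ih =>
      intro i hi
      have hb : bit0 p q (p + 2 * i) = true := by simp [bit0]; omega
      have e1 := g1 _ hb
      have e2 := g2 _ hb
      rw [coreLabel, if_neg (by omega)] at e2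
      have e3 := (ih (i + 1) (by omega)).2
      have e4 : p + 2 * (i + 1) + 1 = p + 2 * i + 3 := by ring
      rw [e4] at e3
      exact ⟨e2.trans e3, e1.symm.trans (e2.trans e3)⟩
  have hB : 1 ≤ p → r 0 = r (p + 2 * q) := by
    intro hp
    rw [g5 hp]
    split_ifs with h
    · rw [h, mul_zero, add_zero]
    · exact (hA (q - 1) 0 (by omega)).2
  -- The reflections `j ↦ p - 1 - j` and `i ↦ p - i`, coming from the two antidiagonals, compose to
  -- `j ↦ j + 1`.
  have hC : ∀ j, j < p → r j = r 0 := by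
    intro j
    induction j with
    | zero => exact fun _ => rfl
    | succ j ih =>
      intro hj
      rw [← ih (by omega), g3 j (p - 1 - j) (by omega), g4 (p - 1 - j) (j + 1) (by omega) (by omega)
        (by omega)]
  intro j hj
  by_cases h1 : j < p
  · rw [hC j h1, hB (by omega)]
  · by_cases h2 : j = p + 2 * q
    · rw [h2]
    · have h3 := hA (q - 1 - (j - p) / 2) ((j - p) / 2) (by omega)
      rcases Nat.mod_two_eq_zero_or_one (j - p) with h | h
      · have : j = p + 2 * ((j - p) / 2) := by omega
        rw [this]
        exact h3.1
      · have : j = p + 2 * ((j - p) / 2) + 1 := by omega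
        rw [this]
        exact h3.2

end Pattern

/-! ### The two sides of the pencil, common signs, and connectedness of the blocks -/

section TwoSides

/-- Labels of the blocks counted from below. -/
def lw (m : ℕ) (a : Fin m) : ℕ := m - 1 - a

/-- Labels of the blocks counted from above. -/
def lz (m : ℕ) (a : Fin m) : ℕ := a

theorem lw_inj (m : ℕ) : Function.Injective (lw m) := fun a b h => by
  simp only [lw] at h
  have := a.2
  have := b.2
  exact Fin.ext (by omega)

theorem lz_inj (m : ℕ) : Function.Injective (lz m) := fun _ _ h => Fin.ext h

theorem lw_surj {m j : ℕ} (h : j < m) : ∃ a, lw m a = j :=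
  ⟨⟨m - 1 - j, by omega⟩, by simp only [lw]; omega⟩

theorem lz_surj {m j : ℕ} (h : j < m) : ∃ a, lz m a = j := ⟨⟨j, h⟩, rfl⟩

theorem lw_add_lz (m : ℕ) (a : Fin m) : lw m a + lz m a + 1 = m := by
  simp only [lw, lz]
  have := a.2
  omega

variable {R : Type*} [Ring R] {m : ℕ}

theorem commute_sides {k h : ℕ} (hkh : k + h ≤ m) {A B : Matrix (Fin m) (Fin m) R}
    (hA : Supp {c | lz m c < k} A) (hB : Supp {c | lw m c < h} B) : Commute A B := by
  refine hA.commute hB ?_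
  rw [Set.disjoint_left]
  intro c hc hc'
  have := lw_add_lz m c
  simp only [Set.mem_ofPred_eq] at hc hc'
  omega

/-- The product of the factors to the left of the core. -/
def leftW (X Z : ℕ → R) (tw tz : List ℕ) : Matrix (Fin m) (Fin m) R :=
  wp (lz m) Z tz.reverse * wp (lw m) X tw.reverse

/-- The product of the factors of type `t` to the right of the core. -/
def rightW (X Z : ℕ → R) (tw tz : List ℕ) : Matrix (Fin m) (Fin m) R :=
  wp (lw m) X tw * wp (lz m) Z tz

/-- The core of the leading coefficient. -/
def coreZ (X Z : ℕ → R) (pz qz qw : ℕ) : Matrix (Fin m) (Fin m) R :=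
  core (lz m) Z pz qz * wp (lw m) X (cpl 0 qw)

/-- The core of the trailing coefficient. -/
def coreW (X Z : ℕ → R) (pz qz qw : ℕ) : Matrix (Fin m) (Fin m) R :=
  core (lw m) X 0 qw * wp (lz m) Z (cpl pz qz)

variable {pz qz qw : ℕ}

/-- The complement of the `z`-side acts on labels below the middle block seen from the top, the
factors of the `w`-side on labels below it seen from the bottom; so they commute and can be
regrouped around the core. -/
theorem coefZ_eq (X Z : ℕ → R) (hm : pz + 2 * qz + 2 * qw + 1 = m) (tw tz : List ℕ)
    (htw : ∀ i ∈ tw, i < 2 * qw) :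
    wp (lz m) Z (adm pz qz) * (wp (lw m) X (cpl 0 qw) * wp (lw m) X tw *
      wp (lz m) Z (cpl pz qz) * wp (lz m) Z tz) = coreZ X Z pz qz qw * rightW X Z tw tz := by
  have h1 : Commute (wp (lz m) Z (cpl pz qz)) (wp (lw m) X (cpl 0 qw) * wp (lw m) X tw) :=
    commute_sides (k := pz + 2 * qz) (h := 2 * qw) (by omega)
      (supp_wp _ _ _ fun _ => cpl_lt)
      ((supp_wp _ _ _ fun i hi => by have := cpl_lt hi; omega).mul (supp_wp _ _ _ htw))
  rw [← h1.eq]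
  simp only [coreZ, rightW, core, mul_assoc]

theorem coefW_eq (X Z : ℕ → R) (hm : pz + 2 * qz + 2 * qw + 1 = m) (tw tz : List ℕ)
    (htw : ∀ i ∈ tw, i < 2 * qw) :
    wp (lw m) X (adm 0 qw) * (wp (lw m) X (cpl 0 qw) * wp (lw m) X tw *
      wp (lz m) Z (cpl pz qz) * wp (lz m) Z tz) = coreW X Z pz qz qw * rightW X Z tw tz := by
  have h1 : Commute (wp (lz m) Z (cpl pz qz)) (wp (lw m) X tw) :=
    commute_sides (k := pz + 2 * qz) (h := 2 * qw) (by omega)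
      (supp_wp _ _ _ fun _ => cpl_lt) (supp_wp _ _ _ htw)
  calc _ = wp (lw m) X (adm 0 qw) * wp (lw m) X (cpl 0 qw) *
        (wp (lw m) X tw * wp (lz m) Z (cpl pz qz)) * wp (lz m) Z tz := by simp only [mul_assoc]
    _ = _ := by
      rw [← h1.eq]
      simp only [coreW, rightW, core, mul_assoc]

theorem exists_signs (X Z : ℕ → R) (hm : pz + 2 * qz + 2 * qw + 1 = m) (tw tz : List ℕ)
    (htw : ∀ i ∈ tw, i < 2 * qw) (htz : ∀ i ∈ tz, i < pz + 2 * qz) (hhw : Hop (bit0 0 qw) tw)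
    (hhz : Hop (bit0 pz qz) tz) :
    ∃ ε D : Fin m → ℤˣ, Sg D ε (leftW (m := m) (-X) (-Z) tw tz) (leftW X Z tw tz) ∧
      Sg D (-D) (coreZ (m := m) (-X) (-Z) pz qz qw) (coreZ X Z pz qz qw) ∧
      Sg D (-D) (coreW (m := m) (-X) (-Z) pz qz qw) (coreW X Z pz qz qw) := by
  set k := pz + 2 * qz with hk
  set h := 2 * qw with hh
  have hl := lw_add_lz m
  have swz : ∀ b b' ε, bitSign (lz m) k b (bitSign (lw m) h b' ε) =
      bitSign (lw m) h b' (bitSign (lz m) k b ε) := by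
    intro b b' ε
    funext c
    have := hl c
    simp only [bitSign]
    split_ifs <;> first | rfl | (exfalso; omega)
  -- The middle block gets the sign `-1`. Both `bit0` patterns are empty at their top label, so from
  -- either end `D` is the sign vector of the initial particles, as `sg_core` and `sg_cpl` require.
  set D := bitSign (lz m) k (bit0 pz qz) (bitSign (lw m) h (bit0 0 qw) fun _ => -1) with hD
  have hDz : ∀ c, lz m c < k + 1 → D c = bs (bit0 pz qz (lz m c)) := by
    intro c hc
    have := hl c
    simp only [hD, bitSign]
    split_ifs with h1 h2
    · rfl
    · omega
    · have : bit0 pz qz (lz m c) = false := by simp [bit0]; omega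
      simp [this, bs]
  have hDw : ∀ c, lw m c < h + 1 → D c = bs (bit0 0 qw (lw m c)) := by
    intro c hc
    have := hl c
    simp only [hD, bitSign]
    split_ifs with h1 h2
    · omega
    · rfl
    · have : bit0 0 qw (lw m c) = false := by simp [bit0]; omega
      simp [this, bs]
  refine ⟨bitSign (lz m) k (hopRun (bit0 pz qz) tz)
    (bitSign (lw m) h (hopRun (bit0 0 qw) tw) fun _ => -1), D, ?_, ?_, ?_⟩
  · have s1 := sg_hop (lw_inj m) (k := h) (fun j hj => lw_surj (by omega)) X
      (bitSign (lz m) k (bit0 pz qz) fun _ => -1) tw htw _ hhw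
    have s2 := sg_hop (lz_inj m) (k := k) (fun j hj => lz_surj (by omega)) Z
      (bitSign (lw m) h (hopRun (bit0 0 qw) tw) fun _ => -1) tz htz _ hhz
    rw [← swz] at s1
    rw [← swz] at s1
    exact s1.mul s2
  · have s1 := sg_cpl (lw_inj m) X 0 qw (fun j hj => lw_surj (by omega)) D
      (fun c hc => hDw c (by omega))
    have s2 := sg_core (lz_inj m) Z pz qz (fun j hj => lz_surj (by omega))
      (flipBelow (lw m) (0 + 2 * qw) D) (fun c hc => by
        have := hl c
        rw [flipBelow, if_neg (by omega), hDz c (by omega)])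
    have e : flipBelow (lz m) (pz + 2 * qz + 1) (flipBelow (lw m) (0 + 2 * qw) D) = -D := by
      funext c
      have := hl c
      simp only [flipBelow, Pi.neg_apply]
      split_ifs <;> first | rfl | (exfalso; omega)
    have := s1.mul s2
    rwa [e] at this
  · have s1 := sg_cpl (lz_inj m) Z pz qz (fun j hj => lz_surj (by omega)) D
      (fun c hc => hDz c (by omega))
    have s2 := sg_core (lw_inj m) X 0 qw (fun j hj => lw_surj (by omega))
      (flipBelow (lz m) (pz + 2 * qz) D) (fun c hc => by
        have := hl c
        rw [flipBelow, if_neg (by omega), hDw c (by omega)])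
    have e : flipBelow (lw m) (0 + 2 * qw + 1) (flipBelow (lz m) (pz + 2 * qz) D) = -D := by
      funext c
      have := hl c
      simp only [flipBelow, Pi.neg_apply]
      split_ifs <;> first | rfl | (exfalso; omega)
    have := s1.mul s2
    rwa [e] at this

/-- Partners of the particles of one side in the complement. -/
def relC (ℓ : Fin m → ℕ) (p q : ℕ) (c d : Fin m) : Prop := bit0 p q (ℓ c) = true ∧ ℓ d = ℓ c + 1

/-- Partners of the particles of one side in the core. -/
def relK (ℓ : Fin m → ℕ) (p q : ℕ) (c d : Fin m) : Prop :=
  bit0 p q (ℓ c) = true ∧ ℓ d = coreLabel (p + 2 * q) (ℓ c)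

theorem bit0_bounds {p q j : ℕ} (h : bit0 p q j = true) :
    p ≤ j ∧ j + 2 ≤ p + 2 * q ∧ (j - p) % 2 = 0 := by
  simp only [bit0, decide_eq_true_eq] at h
  omega

theorem coreLabel_spec {p q j : ℕ} (h : bit0 p q j = true) :
    (j + 2 = p + 2 * q ∧ coreLabel (p + 2 * q) j = p + 2 * q) ∨
      (j + 4 ≤ p + 2 * q ∧ coreLabel (p + 2 * q) j = j + 3) := by
  have := bit0_bounds h
  simp only [coreLabel]
  split_ifs with h1
  · exact Or.inl ⟨h1, rfl⟩
  · exact Or.inr ⟨by omega, rfl⟩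

theorem unitRel_coreZ (X Z : ℕ → R) (hm : pz + 2 * qz + 2 * qw + 1 = m) :
    UnitRel (fun c d => relK (lz m) pz qz c d ∨ relC (lw m) 0 qw c d)
      (coreZ (m := m) X Z pz qz qw) := by
  have hl := lw_add_lz m
  refine UnitRel.mul (S := {c | lz m c < pz + 2 * qz + 1}) (T := {c | lw m c < 2 * qw})
    ?_ ?_ (supp_core _ _ _ _) (supp_wp _ _ _ fun i hi => by have := cpl_lt hi; omega) ?_ ?_ ?_
  · exact fun c d h x => ⟨core_row (lz_inj m) Z (fun j hj => lz_surj (by omega)) h.1 h.2 x,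
      core_col (lz_inj m) Z (fun j hj => lz_surj (by omega)) h.1 h.2 x⟩
  · exact fun c d h x => ⟨cpl_row (lw_inj m) X h.1 h.2 x, cpl_col (lw_inj m) X h.1 h.2 x⟩
  · rw [Set.disjoint_left]
    intro c hc hc'
    have := hl c
    simp only [Set.mem_ofPred_eq] at hc hc'
    omega
  · rintro c d ⟨h1, h2⟩
    have := hl c
    have := hl d
    have := bit0_bounds h1
    simp only [Set.mem_ofPred_eq]
    rcases coreLabel_spec h1 with h3 | h3 <;> omega
  · rintro c d ⟨h1, h2⟩
    have := hl c
    have := hl d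
    have := bit0_bounds h1
    simp only [Set.mem_ofPred_eq]
    omega

theorem unitRel_coreW (X Z : ℕ → R) (hm : pz + 2 * qz + 2 * qw + 1 = m) :
    UnitRel (fun c d => relK (lw m) 0 qw c d ∨ relC (lz m) pz qz c d)
      (coreW (m := m) X Z pz qz qw) := by
  have hl := lw_add_lz m
  refine UnitRel.mul (S := {c | lw m c < 0 + 2 * qw + 1}) (T := {c | lz m c < pz + 2 * qz})
    ?_ ?_ (supp_core _ _ _ _) (supp_wp _ _ _ fun i hi => cpl_lt hi) ?_ ?_ ?_
  · exact fun c d h x => ⟨core_row (lw_inj m) X (fun j hj => lw_surj (by omega)) h.1 h.2 x,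
      core_col (lw_inj m) X (fun j hj => lw_surj (by omega)) h.1 h.2 x⟩
  · exact fun c d h x => ⟨cpl_row (lz_inj m) Z h.1 h.2 x, cpl_col (lz_inj m) Z h.1 h.2 x⟩
  · rw [Set.disjoint_left]
    intro c hc hc'
    have := hl c
    simp only [Set.mem_ofPred_eq] at hc hc'
    omega
  · rintro c d ⟨h1, h2⟩
    have := hl c
    have := hl d
    have := bit0_bounds h1
    simp only [Set.mem_ofPred_eq]
    rcases coreLabel_spec h1 with h3 | h3 <;> omega
  · rintro c d ⟨h1, h2⟩
    have := hl c
    have := hl d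
    have := bit0_bounds h1
    simp only [Set.mem_ofPred_eq]
    omega

/-- The type-1 words on both sides only permute the links of the cores, up to terms that do not meet
them. The cores link each particle with its partners, and below `pz` the antidiagonals filled with
`Z 0` supply the missing links; both sides meet in the middle block. -/
theorem blocks_connected [Nontrivial R] {T : Type*} (X Z : ℕ → R)
    (hm : pz + 2 * qz + 2 * qw + 1 = m) (tw tz : List ℕ)
    (htw : ∀ i ∈ tw, i < 2 * qw) (htz : ∀ i ∈ tz, i < pz + 2 * qz) (hhw : Hop (bit0 0 qw) tw)
    (hhz : Hop (bit0 pz qz) tz) (hX : 0 ∈ tw → X 0 ≠ 0) (hZ : Z 0 ≠ 0) (ρ : Fin m → T)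
    (h1 : ∀ a b, (leftW X Z tw tz * coreZ X Z pz qz qw * rightW X Z tw tz : Matrix (Fin m) (Fin m) R) a b ≠ 0 →
      ρ a = ρ b)
    (h0 : ∀ a b, (leftW X Z tw tz * coreW X Z pz qz qw * rightW X Z tw tz : Matrix (Fin m) (Fin m) R) a b ≠ 0 →
      ρ a = ρ b) (a b : Fin m) : ρ a = ρ b := by
  have hl := lw_add_lz m
  set Pt : Fin m → Prop := fun c => bit0 pz qz (lz m c) = true ∨ bit0 0 qw (lw m c) = true with hPt
  have hbz : ∀ c, pz + 2 * qz ≤ lz m c → bit0 pz qz (lz m c) = false := fun c hc => by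
    by_contra h
    have := bit0_bounds (Bool.eq_true_of_not_eq_false h)
    omega
  have hbw : ∀ c, 2 * qw ≤ lw m c → bit0 0 qw (lw m c) = false := fun c hc => by
    by_contra h
    have := bit0_bounds (Bool.eq_true_of_not_eq_false h)
    omega
  -- Weights only have to be nonzero, since no products of them occur; invertible `X 0` and `Z 0`
  -- are not needed.
  obtain ⟨live₁, π₁, t1, hl1⟩ := (Transport.init Pt (W := {x : R | x ≠ 0}) one_ne_zero).hop
    (lw_inj m) (k := 2 * qw) (fun j hj => lw_surj (by omega)) X tw htw hX _ hhw (fun c hc => by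
      have := hl c
      simp [hPt, hbz c (by omega)])
  obtain ⟨live₂, π, t2, _⟩ := t1.hop (lz_inj m) (k := pz + 2 * qz)
    (fun j hj => lz_surj (by omega)) Z tz htz (fun _ => hZ) _ hhz (fun c hc => by
      have := hl c
      rw [hl1 c (by omega)]
      simp [hPt, hbw c (by omega)])
  rw [mul_one, one_mul] at t2
  change Transport Pt live₂ _ π (leftW X Z tw tz) (rightW X Z tw tz) at t2
  have uz := unitRel_coreZ X Z hm
  have uw := unitRel_coreW X Z hm
  have exZ : ∀ c, Pt c → ∃ d, relK (lz m) pz qz c d ∨ relC (lw m) 0 qw c d := by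
    rintro c (h | h)
    · have := bit0_bounds h
      obtain ⟨d, hd⟩ := lz_surj (m := m) (j := coreLabel (pz + 2 * qz) (lz m c)) (by
        rcases coreLabel_spec h with h3 | h3 <;> omega)
      exact ⟨d, Or.inl ⟨h, hd⟩⟩
    · have := bit0_bounds h
      obtain ⟨d, hd⟩ := lw_surj (m := m) (j := lw m c + 1) (by omega)
      exact ⟨d, Or.inr ⟨h, hd⟩⟩
  have exW : ∀ c, Pt c → ∃ d, relK (lw m) 0 qw c d ∨ relC (lz m) pz qz c d := by
    rintro c (h | h)
    · have := bit0_bounds h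
      obtain ⟨d, hd⟩ := lz_surj (m := m) (j := lz m c + 1) (by omega)
      exact ⟨d, Or.inr ⟨h, hd⟩⟩
    · have := bit0_bounds h
      obtain ⟨d, hd⟩ := lw_surj (m := m) (j := coreLabel (0 + 2 * qw) (lw m c)) (by
        rcases coreLabel_spec h with h3 | h3 <;> omega)
      exact ⟨d, Or.inl ⟨h, hd⟩⟩
  have holeZ : ∀ c d, relK (lz m) pz qz c d ∨ relC (lw m) 0 qw c d → ¬ Pt d := by
    rintro c d (⟨e1, e2⟩ | ⟨e1, e2⟩) (h | h)
    all_goals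
      have := hl d
      have b1 := bit0_bounds e1
      have b2 := bit0_bounds h
      try rcases coreLabel_spec e1 with h3 | h3
      all_goals omega
  have holeW : ∀ c d, relK (lw m) 0 qw c d ∨ relC (lz m) pz qz c d → ¬ Pt d := by
    rintro c d (⟨e1, e2⟩ | ⟨e1, e2⟩) (h | h)
    all_goals
      have := hl d
      have b1 := bit0_bounds e1
      have b2 := bit0_bounds h
      try rcases coreLabel_spec e1 with h3 | h3
      all_goals omega
  have injZ : ∀ c c' d, relK (lz m) pz qz c d ∨ relC (lw m) 0 qw c d →
      relK (lz m) pz qz c' d ∨ relC (lw m) 0 qw c' d → c = c' := by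
    rintro c c' d (⟨e1, e2⟩ | ⟨e1, e2⟩) (⟨f1, f2⟩ | ⟨f1, f2⟩)
    all_goals
      have := hl d
      have b1 := bit0_bounds e1
      have b2 := bit0_bounds f1
      apply lz_inj m
      have := hl c
      have := hl c'
      try rcases coreLabel_spec e1 with h3 | h3
      all_goals
        try rcases coreLabel_spec f1 with h4 | h4
        all_goals omega
  have injW : ∀ c c' d, relK (lw m) 0 qw c d ∨ relC (lz m) pz qz c d →
      relK (lw m) 0 qw c' d ∨ relC (lz m) pz qz c' d → c = c' := by
    rintro c c' d (⟨e1, e2⟩ | ⟨e1, e2⟩) (⟨f1, f2⟩ | ⟨f1, f2⟩)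
    all_goals
      have := hl d
      have b1 := bit0_bounds e1
      have b2 := bit0_bounds f1
      apply lz_inj m
      have := hl c
      have := hl c'
      try rcases coreLabel_spec e1 with h3 | h3
      all_goals
        try rcases coreLabel_spec f1 with h4 | h4
        all_goals omega
  -- Label `c` of a core is found at block `π⁻¹ c` of the full coefficient, so `ρ` is pulled back to
  -- the labels of the core.
  set σ : Fin m → T := fun c => ρ (π.symm c) with hσ
  have edgeZ : ∀ c d, (relK (lz m) pz qz c d ∨ relC (lw m) 0 qw c d) → σ c = σ d :=
    fun c d hcd => h1 _ _ (t2.edge uz exZ holeZ injZ hcd)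
  have edgeW : ∀ c d, (relK (lw m) 0 qw c d ∨ relC (lz m) pz qz c d) → σ c = σ d :=
    fun c d hcd => h0 _ _ (t2.edge uw exW holeW injW hcd)
  have lowZ : ∀ c, lz m c < pz → ¬ Pt c := by
    rintro c hc (h | h)
    all_goals
      have := hl c
      have := bit0_bounds h
      omega
  have holeC : ∀ c d, lz m c + lz m d + 1 = pz → σ c = σ d := by
    intro c d hcd
    refine h0 _ _ ?_
    rw [t2.hole_entry uw exW holeW (lowZ c (by omega)) (lowZ d (by omega))]
    · rw [coreW, (supp_core _ _ _ _).mul_apply_left _ (by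
        have := hl c
        simp only [Set.mem_ofPred_eq]
        omega), cpl_entry (lz_inj m) Z pz qz (fun j hj => lz_surj (by omega)) c d hcd]
      exact hZ
    all_goals
      rintro x (⟨e1, e2⟩ | ⟨e1, e2⟩)
      all_goals
        have := hl c
        have := hl d
        have := bit0_bounds e1
        try rcases coreLabel_spec e1 with h3 | h3
        all_goals omega
  have holeK : ∀ c d, ((1 ≤ lz m c ∧ 1 ≤ lz m d ∧ lz m c + lz m d = pz) ∨
      (1 ≤ pz ∧ lz m c = 0 ∧ lz m d = if qz = 0 then pz else pz + 1)) → σ c = σ d := by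
    intro c d hcd
    have hpt : ∀ x, (lz m x < pz ∨ lz m x = if qz = 0 then pz else pz + 1) → ¬ Pt x := by
      rintro x hx (h | h)
      all_goals
        have := hl x
        have := bit0_bounds h
        split_ifs at hx <;> omega
    have hval : coreZ (m := m) X Z pz qz qw c d = Z 0 := by
      rw [coreZ, (supp_wp (lw m) X (k := 2 * qw) (cpl 0 qw) fun i hi => by
        have := cpl_lt hi
        omega).mul_apply_right _ _ (by
        have := hl d
        simp only [Set.mem_ofPred_eq]
        split_ifs at hcd <;> omega)]
      rcases hcd with h | h
      · exact core_entry (lz_inj m) Z pz qz (fun j hj => lz_surj (by omega)) c d h.1 h.2.1 h.2.2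
      · exact core_entry_zero (lz_inj m) Z pz qz (fun j hj => lz_surj (by omega)) c d h.1 h.2.1
          h.2.2
    refine h1 _ _ ?_
    rw [t2.hole_entry uz exZ holeZ (hpt c ?_) (hpt d ?_), hval]
    · exact hZ
    · rintro x (⟨e1, e2⟩ | ⟨e1, e2⟩)
      all_goals
        have := hl c
        have := bit0_bounds e1
        try rcases coreLabel_spec e1 with h3 | h3
        all_goals split_ifs at hcd <;> omega
    · rintro x (⟨e1, e2⟩ | ⟨e1, e2⟩)
      all_goals
        have := hl d
        have := bit0_bounds e1
        try rcases coreLabel_spec e1 with h3 | h3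
        all_goals split_ifs at hcd <;> omega
    · rcases hcd with h | h
      · exact Or.inl (by omega)
      · exact Or.inl (by omega)
    · rcases hcd with h | h
      · exact Or.inl (by omega)
      · exact Or.inr h.2.2
  -- The middle block is the top label counted from either end, and `side_connected` ties every
  -- label of a side to it.
  obtain ⟨mid, hmid⟩ := lz_surj (m := m) (j := pz + 2 * qz) (by omega)
  have hmz : ∀ c, lz m c ≤ pz + 2 * qz → σ c = σ mid := by
    set r : ℕ → T := fun j => if hj : j < m then σ ⟨j, hj⟩ else σ mid with hr
    have hrc : ∀ c, r (lz m c) = σ c := fun c => by simp [hr, lz]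
    have hget : ∀ j, j < m → ∃ c, lz m c = j := fun j hj => lz_surj hj
    have := side_connected pz qz r ?_ ?_ ?_ ?_ ?_
    · intro c hc
      have h := this _ hc
      rwa [hrc, ← hmid, hrc] at h
    · intro j hj
      have := bit0_bounds hj
      obtain ⟨c, rfl⟩ := hget j (by omega)
      obtain ⟨d, hd⟩ := hget (lz m c + 1) (by omega)
      rw [← hd, hrc, hrc]
      exact edgeW c d (Or.inr ⟨hj, hd⟩)
    · intro j hj
      have := bit0_bounds hj
      obtain ⟨c, rfl⟩ := hget j (by omega)
      obtain ⟨d, hd⟩ := hget (coreLabel (pz + 2 * qz) (lz m c)) (by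
        rcases coreLabel_spec hj with h3 | h3 <;> omega)
      rw [← hd, hrc, hrc]
      exact edgeZ c d (Or.inl ⟨hj, hd⟩)
    · intro i j hij
      obtain ⟨c, rfl⟩ := hget i (by omega)
      obtain ⟨d, rfl⟩ := hget j (by omega)
      rw [hrc, hrc]
      exact holeC c d hij
    · intro i j hi hj hij
      obtain ⟨c, rfl⟩ := hget i (by omega)
      obtain ⟨d, rfl⟩ := hget j (by omega)
      rw [hrc, hrc]
      exact holeK c d (Or.inl ⟨hi, hj, hij⟩)
    · intro hp
      obtain ⟨c, hc⟩ := hget 0 (by omega)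
      obtain ⟨d, hd⟩ := hget (if qz = 0 then pz else pz + 1) (by split_ifs <;> omega)
      rw [← hd, ← hc, hrc, hrc]
      exact holeK c d (Or.inr ⟨hp, hc, hd⟩)
  have hmw : ∀ c, lw m c ≤ 2 * qw → σ c = σ mid := by
    have hmid' : lw m mid = 0 + 2 * qw := by
      have := hl mid
      omega
    set r : ℕ → T := fun j => if hj : j < m then σ ⟨m - 1 - j, by omega⟩ else σ mid with hr
    have hrc : ∀ c, r (lw m c) = σ c := fun c => by
      have h1 : lw m c < m := by
        have := hl c
        omega
      simp only [hr, dif_pos h1]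
      congr 1
      apply Fin.ext
      have := c.2
      simp only [lw]
      omega
    have hget : ∀ j, j < m → ∃ c, lw m c = j := fun j hj => lw_surj hj
    have := side_connected 0 qw r ?_ ?_ (by omega) (by omega) (by omega)
    · intro c hc
      have h := this (lw m c) (by omega)
      rwa [hrc, ← hmid', hrc] at h
    · intro j hj
      have := bit0_bounds hj
      obtain ⟨c, rfl⟩ := hget j (by omega)
      obtain ⟨d, hd⟩ := hget (lw m c + 1) (by omega)
      rw [← hd, hrc, hrc]
      exact edgeZ c d (Or.inr ⟨hj, hd⟩)
    · intro j hj
      have := bit0_bounds hj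
      obtain ⟨c, rfl⟩ := hget j (by omega)
      obtain ⟨d, hd⟩ := hget (coreLabel (0 + 2 * qw) (lw m c)) (by
        rcases coreLabel_spec hj with h3 | h3 <;> omega)
      rw [← hd, hrc, hrc]
      exact edgeW c d (Or.inl ⟨hj, hd⟩)
  have hall : ∀ c, σ c = σ mid := fun c => by
    have := hl c
    by_cases hc : lz m c ≤ pz + 2 * qz
    · exact hmz c hc
    · exact hmw c (by omega)
  have := (hall (π a)).trans (hall (π b)).symm
  simpa [hσ] using this

/-- The pairs in the admissible tuple. -/
def prs (p : ℕ) : ℕ → List ℕ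
  | 0 => []
  | q + 1 => (p + 2 * q + 1) :: (p + 2 * q + 2) :: prs p q

theorem adm_eq_prs (p q : ℕ) : adm p q = prs p q ++ List.range (p + 1) := by
  induction q with
  | zero => rfl
  | succ q ih => rw [adm, prs, ih]; rfl

/-- Only the letter `1` of the lowest pair `1:2` can move label `0`; it sends it to `1`, and the
letters of the higher pairs do not touch that label. -/
theorem prs_col {ℓ : Fin m → ℕ} (hℓ : Function.Injective ℓ) (X : ℕ → R) (q : ℕ) {a d : Fin m}
    (ha : ℓ a = 0) (hd : ℓ d = if q = 0 then 0 else 1) (c : Fin m) :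
    wp ℓ X (prs 0 q) c a = if c = d then 1 else 0 := by
  induction q generalizing c with
  | zero =>
    obtain rfl : d = a := hℓ (hd.trans ha.symm)
    simp [prs, Matrix.one_apply]
  | succ q ih =>
    rw [if_neg (by omega)] at hd
    rw [prs, wp_cons, wp_cons]
    rcases Nat.eq_zero_or_pos q with rfl | hq
    · simp only [prs, wp_nil, mul_one]
      have e := (supp_fm ℓ (0 + 2 * 0 + 2) (X (0 + 2 * 0 + 2))).mul_apply_right
        (fm ℓ (0 + 2 * 0 + 1) (X (0 + 2 * 0 + 1))) c (b := a) (by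
        simp only [Set.mem_ofPred_eq]
        omega)
      rw [e, fm_col_succ _ ha]
      have : ∀ c, ℓ c = 0 + 1 ↔ c = d := fun c =>
        ⟨fun h => hℓ (by omega), fun h => by subst h; omega⟩
      simp only [Nat.mul_zero, this, zero_add] at *
    · have h1 := ih (by rw [if_neg hq.ne', hd])
      rw [← mul_assoc, mul_col h1, (supp_fm ℓ _ _).mul_apply_right _ _ (by
        simp only [Set.mem_ofPred_eq]
        omega), (supp_fm ℓ _ _).apply_right _ (by
        simp only [Set.mem_ofPred_eq]
        omega), Matrix.one_apply]

/-- The last block has label `0` from below. On the left the pairs of the admissible tuple, on the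
right the complement, move it to the same label (`0` if `qw = 0`, else `1`). There is no particle
there, so `track_hop` follows it through `tw`; it never enters the labels on which the `z`-factors
act. The greedy search in `(w, c_w, t_w)` makes the same moves. -/
theorem track (X Z : ℕ → R) (hm : pz + 2 * qz + 2 * qw + 1 = m) (tw tz : List ℕ)
    (htw : ∀ i ∈ tw, i < 2 * qw) (htz : ∀ i ∈ tz, i < pz + 2 * qz) (hhw : Hop (bit0 0 qw) tw)
    {a : Fin m} (ha : lw m a = 0) :
    ∃ k : Fin m, (k : ℤ) + 1 = m - consec 0 (castL (adm 0 qw ++ cpl 0 qw ++ tw)) ∧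
      (∀ c, (leftW X Z tw tz * wp (lw m) X (prs 0 qw) : Matrix (Fin m) (Fin m) R) c a = if c = k then 1 else 0) ∧
      ∀ c, (wp (lw m) X (cpl 0 qw) * wp (lw m) X tw * wp (lz m) Z (cpl pz qz) *
        wp (lz m) Z tz) a c = if c = k then 1 else 0 := by
  have hl := lw_add_lz m
  obtain ⟨d, hd⟩ := lw_surj (m := m) (j := if qw = 0 then 0 else 1) (by split_ifs <;> omega)
  obtain ⟨k, h0, h1, h2, h3⟩ := track_hop (lw_inj m) (k := 2 * qw) (fun j hj => lw_surj (by omega))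
    X tw htw _ hhw (if qw = 0 then 0 else 1) (by
      split_ifs with h
      · simp [bit0, h]
      · simp [bit0]) d hd
  have hk : lw m k ≤ 2 * qw := by
    rcases h0 with rfl | h0
    · rw [hd]
      split_ifs <;> omega
    · omega
  have hkz : pz + 2 * qz ≤ lz m k := by
    have := hl k
    omega
  refine ⟨k, ?_, fun c => ?_, fun c => ?_⟩
  · rw [consec_eq _ (by simp [mem_adm]), grd_append, grd_append, grd_adm, grd_cpl]
    have e : grd (if qw = 0 then 1 else 2) tw = lw m k + 1 := by
      rw [h1]
      split_ifs <;> rfl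
    rw [e]
    have := hl k
    simp only [lz] at this
    push_cast
    omega
  · rw [mul_col (prs_col (lw_inj m) X qw ha hd), leftW, mul_col h3,
      (supp_wp (lz m) Z (k := pz + 2 * qz) tz.reverse
        (fun i hi => htz i (by simpa using hi))).apply_right _ (by
        simp only [Set.mem_ofPred_eq]
        omega), Matrix.one_apply]
  · have hcp : ∀ c, wp (lw m) X (cpl 0 qw) a c = if c = d then 1 else 0 := by
      intro c
      rcases Nat.eq_zero_or_pos qw with h | h
      · subst h
        obtain rfl : d = a := lw_inj m (by rw [hd, ha, if_pos rfl])
        simp [cpl, tri, Matrix.one_apply, eq_comm]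
      · exact cpl_row (lw_inj m) X (by simp [bit0, ha, h]) (by rw [hd, ha, if_neg h.ne']) c
    rw [mul_assoc, mul_assoc, row_mul hcp, row_mul h2,
      (supp_wp (lz m) Z (k := pz + 2 * qz) _ fun _ => cpl_lt).mul_apply_left _ (by
        simp only [Set.mem_ofPred_eq]
        omega),
      (supp_wp (lz m) Z (k := pz + 2 * qz) tz htz).apply_left (by
        simp only [Set.mem_ofPred_eq]
        omega), Matrix.one_apply]
    simp only [eq_comm]

end TwoSides

/-! ### Horner's scheme for Fiedler pencils by block elimination -/

section Elimination

variable {ι S R : Type*} [Fintype ι] [DecidableEq ι] [CommRing S] [Ring R] [Algebra S R]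

/-- Equivalence of matrices by invertible matrices which fix the block column (row) `c₀`. -/
def Req (c₀ : ι) (T T' : Matrix ι ι R) : Prop :=
  ∃ U V : Matrix ι ι R, IsUnit U ∧ IsUnit V ∧ U * T * V = T' ∧
    (∀ a, U a c₀ = (1 : Matrix ι ι R) a c₀) ∧ ∀ b, V c₀ b = (1 : Matrix ι ι R) c₀ b

theorem Req.refl (c₀ : ι) (T : Matrix ι ι R) : Req c₀ T T :=
  ⟨1, 1, isUnit_one, isUnit_one, by simp, fun _ => rfl, fun _ => rfl⟩

theorem Req.trans {c₀ : ι} {T T' T'' : Matrix ι ι R} (h₁ : Req c₀ T T') (h₂ : Req c₀ T' T'') :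
    Req c₀ T T'' := by
  obtain ⟨U, V, hU, hV, e, hu, hv⟩ := h₁
  obtain ⟨U', V', hU', hV', e', hu', hv'⟩ := h₂
  refine ⟨U' * U, V * V', hU'.mul hU, hV.mul hV', ?_, fun a => ?_, fun b => ?_⟩
  · rw [← e', ← e]
    simp only [mul_assoc]
  · rw [mul_col (b := c₀) (fun c => by rw [hu, Matrix.one_apply]), hu']
  · rw [row_mul (b := c₀) (fun c => by rw [hv, Matrix.one_apply]; simp only [eq_comm]), hv']

/-- At block `b` the matrix has the pivot `-1`, because `G`, `H`, `M` act there as the identity and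
`J` vanishes. Clearing row and column `b` with this pivot adds `λ² y₁ y₂` at `a`. The outer factors
are respected by using `1 + λ G s₁` and `1 + λ s₂ H`, which are unipotent since these perturbations
square to zero; `b ≠ c₀` leaves column and row `c₀` alone. -/
theorem elim_block {c₀ a b : ι} (hab : a ≠ b) (hb : b ≠ c₀) (lam : S) {G H J M : Matrix ι ι R}
    (hG : G * single b b 1 = single b b 1) (hG' : single b b 1 * G = single b b 1)
    (hH : H * single b b 1 = single b b 1) (hH' : single b b 1 * H = single b b 1)
    (hM : M * single b b 1 = single b b 1) (hM' : single b b 1 * M = single b b 1)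
    (hJ : J * single b b 1 = 0) (hJ' : single b b 1 * J = 0) (A y₁ y₂ : R) :
    Req c₀ (lam • (G * (J + single a a A + single a b y₁ + single b a y₂) * H) - M)
      (lam • (G * (J + single a a (A + lam • (y₁ * y₂))) * H) - M) := by
  set e : Matrix ι ι R := single b b 1 with he
  set s₁ : Matrix ι ι R := single a b y₁ with hs₁
  set s₂ : Matrix ι ι R := single b a y₂ with hs₂
  set α : Matrix ι ι R := single a a A with hα
  have e1 : s₁ * e = s₁ := by simp [hs₁, he]
  have e2 : e * s₁ = 0 := by simp [hs₁, he, single_mul_single_of_ne, hab.symm]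
  have e3 : s₂ * e = 0 := by simp [hs₂, he, single_mul_single_of_ne, hab]
  have e4 : e * s₂ = s₂ := by simp [hs₂, he]
  have e5 : α * e = 0 := by simp [hα, he, single_mul_single_of_ne, hab]
  have e6 : e * α = 0 := by simp [hα, he, single_mul_single_of_ne, hab.symm]
  have e7 : single a a (A + lam • (y₁ * y₂)) = α + lam • (s₁ * s₂) := by
    rw [hα, hs₁, hs₂, single_mul_single_same, smul_single, ← single_add]
  have eG : s₁ * G = s₁ := by rw [← e1, mul_assoc, hG']
  have eS : s₁ * s₁ = 0 := by rw [← e1, mul_assoc, e1, e2, mul_zero]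
  have eH : H * s₂ = s₂ := by rw [← e4, ← mul_assoc, hH]
  have eS' : s₂ * s₂ = 0 := by
    nth_rewrite 2 [← e4]
    rw [← mul_assoc, e3, zero_mul]
  have f1 : s₁ * H = s₁ := by rw [← e1, mul_assoc, hH']
  have f2 : G * s₂ = s₂ := by rw [← e4, ← mul_assoc, hG]
  have f3 : s₁ * M = s₁ := by rw [← e1, mul_assoc, hM']
  have f4 : s₁ * J = 0 := by rw [← e1, mul_assoc, hJ', mul_zero]
  have f5 : s₁ * α = 0 := by rw [← e1, mul_assoc, e6, mul_zero]
  have f6 : M * s₂ = s₂ := by rw [← e4, ← mul_assoc, hM]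
  have f7 : J * s₂ = 0 := by rw [← e4, ← mul_assoc, hJ, zero_mul]
  have f8 : α * s₂ = 0 := by rw [← e4, ← mul_assoc, e5, zero_mul]
  have f9 : s₁ * s₂ * s₂ = 0 := by rw [mul_assoc, eS', mul_zero]
  refine ⟨1 + lam • (G * s₁), 1 + lam • (s₂ * H), ?_, ?_, ?_, fun x => ?_, fun x => ?_⟩
  · refine IsNilpotent.isUnit_one_add ⟨2, ?_⟩
    rw [pow_two, smul_mul_smul_comm, mul_assoc, ← mul_assoc s₁ G, eG, eS, mul_zero, smul_zero]
  · refine IsNilpotent.isUnit_one_add ⟨2, ?_⟩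
    rw [pow_two, smul_mul_smul_comm, mul_assoc, ← mul_assoc H, eH, ← mul_assoc, eS', zero_mul,
      smul_zero]
  · rw [e7]
    set T := lam • (G * (J + α + s₁ + s₂) * H) - M with hT
    have hT' : T = lam • (G * (J + α) * H) + lam • (G * s₁) + lam • (s₂ * H) - M := by
      rw [hT]
      have : G * (J + α + s₁ + s₂) * H = G * (J + α) * H + G * (s₁ * H) + G * s₂ * H := by
        noncomm_ring
      rw [this, f1, f2, smul_add, smul_add]
    have h1 : s₁ * T = lam • (s₁ * s₂ * H) - s₁ := by
      have : s₁ * (G * (J + α + s₁ + s₂) * H) =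
          (s₁ * G) * J * H + (s₁ * G) * α * H + (s₁ * G) * s₁ * H + (s₁ * G) * s₂ * H := by
        noncomm_ring
      rw [hT, mul_sub, f3, mul_smul_comm, this, eG, f4, f5, eS]
      simp
    have h2 : (1 + lam • (G * s₁)) * T = lam • (G * (J + α) * H) + lam • (s₂ * H) - M +
        lam • lam • (G * (s₁ * s₂) * H) := by
      rw [add_mul, one_mul, smul_mul_assoc, mul_assoc G s₁ T, h1, mul_sub, mul_smul_comm, hT',
        smul_sub]
      have : G * (s₁ * s₂ * H) = G * (s₁ * s₂) * H := by simp only [mul_assoc]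
      rw [this]
      abel
    have h3 : (lam • (G * (J + α) * H) + lam • (s₂ * H) - M +
        lam • lam • (G * (s₁ * s₂) * H)) * s₂ = - s₂ := by
      have i1 : G * (J + α) * H * s₂ = 0 := by
        rw [mul_assoc, eH, mul_assoc, add_mul, f7, f8, add_zero, mul_zero]
      have i2 : s₂ * H * s₂ = 0 := by rw [mul_assoc, eH, eS']
      have i3 : G * (s₁ * s₂) * H * s₂ = 0 := by rw [mul_assoc, eH, mul_assoc, f9, mul_zero]
      rw [add_mul, sub_mul, add_mul, smul_mul_assoc, smul_mul_assoc, smul_mul_assoc,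
        smul_mul_assoc, i1, i2, i3, f6]
      simp
    rw [h2]
    have h4 := congrArg (· * H) h3
    simp only [mul_assoc _ s₂ H, neg_mul] at h4
    rw [mul_add, mul_one, mul_smul_comm, h4]
    have : G * (J + (α + lam • (s₁ * s₂))) * H =
        G * (J + α) * H + lam • (G * (s₁ * s₂) * H) := by
      rw [← add_assoc, mul_add, add_mul, mul_smul_comm, smul_mul_assoc]
    rw [this, smul_add, smul_neg]
    abel
  · rw [Matrix.add_apply, Matrix.smul_apply, hs₁, mul_single_apply_of_ne _ _ _ _ _ hb.symm,
      smul_zero, add_zero]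
  · rw [Matrix.add_apply, Matrix.smul_apply, hs₂, single_mul_apply_of_ne _ _ _ _ _ hb.symm,
      smul_zero, add_zero]

/-- The diagonal matrix with `1` at labels `< j - 1`, `Y` at label `j - 1` and `0` above. -/
def tp (ℓ : ι → ℕ) (j : ℕ) (Y : R) : Matrix ι ι R :=
  Matrix.diagonal fun c => if ℓ c + 1 < j then 1 else if ℓ c + 1 = j then Y else 0

/-- The matrix with `Z` at label `0` and `-1` at the other labels. -/
def endMat (ℓ : ι → ℕ) (Z : R) : Matrix ι ι R := Matrix.diagonal fun c => if ℓ c = 0 then Z else -1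

/-- The Fiedler pencil with outer factors `G, H` can be reduced to a matrix polynomial. -/
def Reduces (ℓ : ι → ℕ) (c₀ : ι) (lam : S) (A : ℕ → R) (j : ℕ) (G H : Matrix ι ι R) : Prop :=
  ∀ Y, Req c₀ (lam • (G * tp ℓ j Y * H) - fm ℓ 0 (-A 0))
    (endMat ℓ (∑ i ∈ Finset.range j, lam ^ i • A i + lam ^ j • Y))

variable {ℓ : ι → ℕ} {c₀ : ι} {lam : S} {A : ℕ → R}

theorem Reduces.base (hℓ : Function.Injective ℓ) : Reduces ℓ c₀ lam A 1 1 1 := by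
  intro Y
  convert Req.refl c₀ _ using 1
  ext c d
  simp only [one_mul, mul_one, tp, endMat, Matrix.sub_apply, Matrix.smul_apply,
    Matrix.diagonal_apply, fm, Matrix.of_apply, Finset.sum_range_one, pow_zero, one_smul, pow_one]
  by_cases h : c = d
  · subst h
    by_cases h0 : ℓ c = 0
    · simp [h0, add_comm]
    · simp [h0]
  · simp only [if_neg h, smul_zero]
    by_cases h0 : ℓ c = 0 ∧ ℓ d = 0
    · exact absurd (hℓ (h0.1.trans h0.2.symm)) h
    · simp [h0]

theorem supp_mul_single {M : Matrix ι ι R} {T : Set ι} (hM : Supp T M) {b : ι} (hb : b ∉ T) :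
    M * single b b 1 = single b b 1 := by
  ext c d
  by_cases h : d = b
  · subst h
    rw [mul_single_apply_same, mul_one, hM.apply_right c hb, Matrix.single_apply, Matrix.one_apply]
    simp [eq_comm]
  · rw [mul_single_apply_of_ne _ _ _ _ _ h, Matrix.single_apply, if_neg]
    rintro ⟨-, rfl⟩
    exact h rfl

theorem single_mul_supp {M : Matrix ι ι R} {T : Set ι} (hM : Supp T M) {b : ι} (hb : b ∉ T) :
    single b b 1 * M = single b b 1 := by
  ext c d
  by_cases h : c = b
  · subst h
    rw [single_mul_apply_same, one_mul, hM.apply_left hb, Matrix.single_apply, Matrix.one_apply]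
    simp
  · rw [single_mul_apply_of_ne _ _ _ _ _ h, Matrix.single_apply, if_neg]
    rintro ⟨rfl, -⟩
    exact h rfl

theorem nf_mul_tp (hℓ : Function.Injective ℓ) {a b : ι} {j : ℕ} (ha : ℓ a + 1 = j) (hb : ℓ b = j)
    (x Y : R) : nf ℓ j x * tp ℓ (j + 1) Y =
      Matrix.diagonal (fun c => if ℓ c + 1 < j then 1 else 0) + single a a x + single a b Y +
        single b a 1 := by
  have hab : a ≠ b := by rintro rfl; omega
  rw [nf_eq_swp hℓ ha hb]
  ext c d
  rw [swp_mul_apply hab]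
  simp only [Matrix.add_apply, Matrix.diagonal_apply, tp, Matrix.single_apply]
  by_cases ca : c = a
  · subst ca
    by_cases da : d = c
    · subst da
      have : ¬ ℓ d + 1 < j := by omega
      simp [hab.symm, ha]
    · by_cases db : d = b
      · subst db
        simp [hab, Ne.symm hab, hb]
      · simp [Ne.symm da, Ne.symm db]
  · by_cases cb : c = b
    · subst cb
      by_cases da : d = a
      · subst da
        simp [hab, hab.symm, ha]
      · by_cases db : d = c
        · subst db
          simp [hab, hab.symm, hb]
        · simp [ca, Ne.symm da, Ne.symm db, hab]
    · by_cases cd : c = d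
      · subst cd
        have h1 : ℓ c + 1 ≠ j := fun h => ca (hℓ (by omega))
        have h2 : ℓ c + 1 ≠ j + 1 := fun h => cb (hℓ (by omega))
        have h3 : ℓ c + 1 < j + 1 ↔ ℓ c + 1 < j := by omega
        simp only [if_neg ca, if_neg cb, if_true, h3, if_neg h2]
        simp [Ne.symm ca, Ne.symm cb]
      · simp [ca, cb, cd, Ne.symm ca, Ne.symm cb]

theorem tp_mul_nf (hℓ : Function.Injective ℓ) {a b : ι} {j : ℕ} (ha : ℓ a + 1 = j) (hb : ℓ b = j)
    (x Y : R) : tp ℓ (j + 1) Y * nf ℓ j x =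
      Matrix.diagonal (fun c => if ℓ c + 1 < j then 1 else 0) + single a a x + single a b 1 +
        single b a Y := by
  have hab : a ≠ b := by rintro rfl; omega
  rw [nf_eq_swp hℓ ha hb]
  ext c d
  rw [mul_swp_apply hab]
  simp only [Matrix.add_apply, Matrix.diagonal_apply, tp, Matrix.single_apply]
  by_cases ca : d = a
  · subst ca
    by_cases da : c = d
    · subst da
      simp [hab, hab.symm, ha]
    · by_cases db : c = b
      · subst db
        simp [hab, Ne.symm hab, hb]
      · simp [da, db, Ne.symm da, Ne.symm db]
  · by_cases cb : d = b
    · subst cb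
      by_cases da : c = a
      · subst da
        simp [hab, hab.symm, ha]
      · by_cases db : c = d
        · subst db
          simp [hab, hab.symm, hb]
        · simp [ca, da, Ne.symm da, db, Ne.symm db, hab]
    · by_cases cd : c = d
      · subst cd
        have h1 : ℓ c + 1 ≠ j := fun h => ca (hℓ (by omega))
        have h2 : ℓ c + 1 ≠ j + 1 := fun h => cb (hℓ (by omega))
        have h3 : ℓ c + 1 < j + 1 ↔ ℓ c + 1 < j := by omega
        simp only [if_neg ca, if_neg cb, if_true, h3, if_neg h2]
        simp [Ne.symm ca, Ne.symm cb]
      · simp [ca, cb, cd, Ne.symm ca, Ne.symm cb]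

theorem tp_eq (hℓ : Function.Injective ℓ) {a : ι} {j : ℕ} (ha : ℓ a + 1 = j) (Y : R) :
    tp ℓ j Y = Matrix.diagonal (fun c => if ℓ c + 1 < j then 1 else 0) + single a a Y := by
  ext c d
  simp only [Matrix.add_apply, Matrix.diagonal_apply, tp, Matrix.single_apply]
  by_cases cd : c = d
  · subst cd
    by_cases ca : c = a
    · subst ca
      simp [ha]
    · have h1 : ℓ c + 1 ≠ j := fun h => ca (hℓ (by omega))
      simp [h1, Ne.symm ca]
  · have : ¬ (a = c ∧ a = d) := by
      rintro ⟨rfl, rfl⟩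
      exact cd rfl
    simp [cd, this]

theorem reduces_sum (lam : S) (A : ℕ → R) (j : ℕ) (Y : R) :
    ∑ i ∈ Finset.range j, lam ^ i • A i + lam ^ j • (A j + lam • Y) =
      ∑ i ∈ Finset.range (j + 1), lam ^ i • A i + lam ^ (j + 1) • Y := by
  rw [Finset.sum_range_succ, smul_add, smul_smul, ← pow_succ, add_assoc]

/-- Multiplying the truncated diagonal by `N_j` couples the block with label `j` to its neighbour
only through `Y` and `1`. Eliminating it replaces `Y` by `A_j + λ Y` at label `j - 1`, one Horner
step, whether `N_j` stands to the left or to the right. -/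
theorem Reduces.step (hℓ : Function.Injective ℓ) {a b : ι} {j : ℕ} (ha : ℓ a + 1 = j)
    (hb : ℓ b = j) (hc₀ : ℓ c₀ = 0) {G H : Matrix ι ι R} (hG : Supp {c | ℓ c < j} G)
    (hH : Supp {c | ℓ c < j} H) (h : Reduces ℓ c₀ lam A j G H) :
    Reduces ℓ c₀ lam A (j + 1) (G * nf ℓ j (A j)) H ∧
      Reduces ℓ c₀ lam A (j + 1) G (nf ℓ j (A j) * H) := by
  have hab : a ≠ b := by rintro rfl; omega
  have hbc : b ≠ c₀ := by rintro rfl; omega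
  have hbn : b ∉ {c | ℓ c < j} := by
    simp only [Set.mem_ofPred_eq]
    omega
  have hM : Supp {c | ℓ c < 1} (fm ℓ 0 (-A 0)) := supp_fm_lt ℓ Nat.zero_lt_one _
  have hbm : b ∉ {c | ℓ c < 1} := by
    simp only [Set.mem_ofPred_eq]
    omega
  have hJ : Matrix.diagonal (fun c => if ℓ c + 1 < j then (1 : R) else 0) * single b b 1 = 0 := by
    ext c d
    rw [Matrix.diagonal_mul, Matrix.single_apply]
    by_cases hc : c = b
    · subst hc
      have : ¬ ℓ c + 1 < j := by omega
      simp [this]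
    · simp [Ne.symm hc]
  have hJ' : single b b 1 * Matrix.diagonal (fun c => if ℓ c + 1 < j then (1 : R) else 0) = 0 := by
    ext c d
    rw [Matrix.mul_diagonal, Matrix.single_apply]
    by_cases hc : d = b
    · subst hc
      have : ¬ ℓ d + 1 < j := by omega
      simp [this]
    · simp [Ne.symm hc]
  constructor
  · intro Y
    have h1 := elim_block hab hbc lam (supp_mul_single hG hbn) (single_mul_supp hG hbn)
      (supp_mul_single hH hbn) (single_mul_supp hH hbn) (supp_mul_single hM hbm)
      (single_mul_supp hM hbm) hJ hJ' (A j) Y 1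
    rw [← nf_mul_tp hℓ ha hb, ← tp_eq hℓ ha, mul_one, ← mul_assoc G] at h1
    have h2 := h1.trans (h (A j + lam • Y))
    rwa [reduces_sum] at h2
  · intro Y
    have h1 := elim_block hab hbc lam (supp_mul_single hG hbn) (single_mul_supp hG hbn)
      (supp_mul_single hH hbn) (single_mul_supp hH hbn) (supp_mul_single hM hbm)
      (single_mul_supp hM hbm) hJ hJ' (A j) 1 Y
    rw [← tp_mul_nf hℓ ha hb, ← tp_eq hℓ ha, one_mul, ← mul_assoc G, mul_assoc (G * _)] at h1
    have h2 := h1.trans (h (A j + lam • Y))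
    rwa [reduces_sum] at h2

theorem supp_tp (j : ℕ) (Y : R) : Supp {c | j < ℓ c + 1 ∨ j = ℓ c + 1} (tp ℓ j Y) := by
  intro c d hcd
  rw [Matrix.sub_apply, tp, Matrix.diagonal_apply, Matrix.one_apply]
  simp only [Set.mem_ofPred_eq] at hcd
  by_cases h : c = d
  · subst h
    have : ℓ c + 1 < j := by omega
    simp [this]
  · simp [h]

/-- `N_j` is absorbed on the right first and `N_{j+1}` on the left afterwards. Then `N_j` may cross
to the left, since the truncated diagonal of stage `j + 2` is the identity on the labels `j - 1, j`.
-/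
theorem Reduces.pair (hℓ : Function.Injective ℓ) {a b b' : ι} {j : ℕ} (ha : ℓ a + 1 = j)
    (hb : ℓ b = j) (hb' : ℓ b' = j + 1) (hc₀ : ℓ c₀ = 0) {G H : Matrix ι ι R}
    (hG : Supp {c | ℓ c < j} G) (hH : Supp {c | ℓ c < j} H) (h : Reduces ℓ c₀ lam A j G H) :
    Reduces ℓ c₀ lam A (j + 2) (G * (nf ℓ (j + 1) (A (j + 1)) * nf ℓ j (A j))) H := by
  have hle : {c | ℓ c < j} ⊆ {c | ℓ c < j + 1} := fun c hc => by
    simp only [Set.mem_ofPred_eq] at *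
    omega
  have hn : Supp {c | ℓ c < j + 1} (nf ℓ j (A j)) := (supp_nf ℓ j (A j)).mono fun c hc => by
    simp only [Set.mem_ofPred_eq] at *
    omega
  have h1 := (h.step hℓ ha hb hc₀ hG hH).2
  have h2 := (h1.step hℓ (a := b) (by omega) hb' hc₀ (hG.mono hle) (hn.mul (hH.mono hle))).1
  intro Y
  have hcomm : Commute (nf ℓ j (A j)) (tp ℓ (j + 2) Y) := (supp_nf ℓ j (A j)).commute
    (supp_tp (j + 2) Y) (by
      rw [Set.disjoint_left]
      intro c hc hc'
      simp only [Set.mem_ofPred_eq] at hc hc'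
      omega)
  have h3 := h2 Y
  have e : G * nf ℓ (j + 1) (A (j + 1)) * tp ℓ (j + 1 + 1) Y * (nf ℓ j (A j) * H) =
      G * (nf ℓ (j + 1) (A (j + 1)) * nf ℓ j (A j)) * tp ℓ (j + 2) Y * H := by
    calc _ = G * nf ℓ (j + 1) (A (j + 1)) * (tp ℓ (j + 2) Y * nf ℓ j (A j)) * H := by
          simp only [mul_assoc]
      _ = _ := by
          rw [← hcomm.eq]
          simp only [mul_assoc]
  rwa [e] at h3

/-- The product `N_{a+2} N_{a+1} N_{a+4} N_{a+3} ⋯` with `q` pairs. -/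
def apm (ℓ : ι → ℕ) (A : ℕ → R) (a : ℕ) : ℕ → Matrix ι ι R
  | 0 => 1
  | q + 1 => apm ℓ A a q *
      (nf ℓ (a + 2 * q + 2) (A (a + 2 * q + 2)) * nf ℓ (a + 2 * q + 1) (A (a + 2 * q + 1)))

/-- The product `N_{e+n} ⋯ N_{e+1}`. -/
def dsc (ℓ : ι → ℕ) (A : ℕ → R) (e : ℕ) : ℕ → Matrix ι ι R
  | 0 => 1
  | n + 1 => nf ℓ (e + n + 1) (A (e + n + 1)) * dsc ℓ A e n

theorem supp_nf_lt (ℓ : ι → ℕ) {i k : ℕ} (h : i < k) (x : R) : Supp {c | ℓ c < k} (nf ℓ i x) :=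
  (supp_nf ℓ i x).mono fun c hc => by
    simp only [Set.mem_ofPred_eq] at *
    omega

theorem supp_mono_lt {k k' : ℕ} (h : k ≤ k') {M : Matrix ι ι R} (hM : Supp {c | ℓ c < k} M) :
    Supp {c | ℓ c < k'} M := hM.mono fun c hc => by
  simp only [Set.mem_ofPred_eq] at *
  omega

theorem supp_apm (ℓ : ι → ℕ) (A : ℕ → R) (a q : ℕ) :
    Supp {c | ℓ c < a + 2 * q + 1} (apm ℓ A a q) := by
  induction q with
  | zero => exact Supp.one _
  | succ q ih =>
    exact (supp_mono_lt (by omega) ih).mul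
      ((supp_nf_lt ℓ (by omega) _).mul (supp_nf_lt ℓ (by omega) _))

theorem supp_dsc (ℓ : ι → ℕ) (A : ℕ → R) (e n : ℕ) :
    Supp {c | ℓ c < e + n + 1} (dsc ℓ A e n) := by
  induction n with
  | zero => exact Supp.one _
  | succ n ih => exact (supp_nf_lt ℓ (by omega) _).mul (supp_mono_lt (by omega) ih)

theorem Reduces.apm (hℓ : Function.Injective ℓ) (hc₀ : ℓ c₀ = 0) {a q : ℕ}
    (hs : ∀ i < a + 1 + 2 * q, ∃ c, ℓ c = i) {H : Matrix ι ι R} (hH : Supp {c | ℓ c < a + 1} H)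
    (h : Reduces ℓ c₀ lam A (a + 1) 1 H) :
    Reduces ℓ c₀ lam A (a + 1 + 2 * q) (GFPR.apm ℓ A a q) H := by
  induction q with
  | zero => exact h
  | succ q ih =>
    obtain ⟨x, hx⟩ := hs (a + 2 * q) (by omega)
    obtain ⟨y, hy⟩ := hs (a + 2 * q + 1) (by omega)
    obtain ⟨z, hz⟩ := hs (a + 2 * q + 2) (by omega)
    have h1 := (ih fun i hi => hs i (by omega))
    have e : a + 1 + 2 * q = a + 2 * q + 1 := by ring
    rw [e] at h1
    have h2 := h1.pair hℓ (a := x) (by omega) hy hz hc₀ (supp_apm ℓ A a q) (supp_mono_lt (by omega) hH)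
    have e2 : a + 1 + 2 * (q + 1) = a + 2 * q + 1 + 2 := by ring
    rw [e2]
    exact h2

theorem Reduces.dsc (hℓ : Function.Injective ℓ) (hc₀ : ℓ c₀ = 0) {e n : ℕ}
    (hs : ∀ i < e + 1 + n, ∃ c, ℓ c = i) {G H : Matrix ι ι R} (hG : Supp {c | ℓ c < e + 1} G)
    (hH : Supp {c | ℓ c < e + 1} H) (h : Reduces ℓ c₀ lam A (e + 1) G H) :
    Reduces ℓ c₀ lam A (e + 1 + n) G (GFPR.dsc ℓ A e n * H) := by
  induction n with
  | zero => simpa [GFPR.dsc] using h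
  | succ n ih =>
    obtain ⟨x, hx⟩ := hs (e + n) (by omega)
    obtain ⟨y, hy⟩ := hs (e + n + 1) (by omega)
    have h1 := (ih fun i hi => hs i (by omega))
    have e1 : e + 1 + n = e + n + 1 := by ring
    rw [e1] at h1
    have h2 := (h1.step hℓ (a := x) (by omega) hy hc₀ (supp_mono_lt (by omega) hG)
      ((supp_dsc ℓ A e n).mul (supp_mono_lt (by omega) hH))).2
    have e2 : e + 1 + (n + 1) = e + n + 1 + 1 := by ring
    rw [e2, GFPR.dsc, mul_assoc]
    exact h2

theorem apm_add (ℓ : ι → ℕ) (A : ℕ → R) (a q₁ q₂ : ℕ) :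
    apm ℓ A a (q₁ + q₂) = apm ℓ A a q₁ * apm ℓ A (a + 2 * q₁) q₂ := by
  induction q₂ with
  | zero => simp [apm]
  | succ q ih =>
    have e : a + 2 * (q₁ + q) = a + 2 * q₁ + 2 * q := by ring
    rw [← add_assoc, apm, apm, ih, mul_assoc, e]

theorem dsc_succ' (ℓ : ι → ℕ) (A : ℕ → R) (e n : ℕ) :
    dsc ℓ A e (n + 1) = dsc ℓ A (e + 1) n * nf ℓ (e + 1) (A (e + 1)) := by
  induction n with
  | zero => simp [dsc]
  | succ n ih =>
    have h : e + (n + 1) + 1 = e + 1 + n + 1 := by ring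
    rw [dsc, ih, dsc, mul_assoc, h]

theorem prs_mul_apm (hℓ : Function.Injective ℓ) {X : ℕ → R} {a q : ℕ}
    (hs : ∀ i ≤ a + 2 * q, ∃ c, ℓ c = i) (hX : ∀ i, 0 < i → i ≤ a + 2 * q → X i = -A i) :
    wp ℓ X (prs a q) * apm ℓ A a q = 1 := by
  induction q with
  | zero => simp [prs, apm]
  | succ q ih =>
    have h1 : fm ℓ (a + 2 * q + 1) (X (a + 2 * q + 1)) *
        nf ℓ (a + 2 * q + 1) (A (a + 2 * q + 1)) = 1 := by
      have := fm_mul_nf hℓ (Nat.succ_pos (a + 2 * q)) (fun j hj => hs j (by omega))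
        (X (a + 2 * q + 1))
      rw [hX _ (by omega) (by omega), neg_neg] at this
      rw [hX _ (by omega) (by omega)]
      exact this
    have h2 : fm ℓ (a + 2 * q + 2) (X (a + 2 * q + 2)) *
        nf ℓ (a + 2 * q + 2) (A (a + 2 * q + 2)) = 1 := by
      have := fm_mul_nf hℓ (Nat.succ_pos (a + 2 * q + 1)) (fun j hj => hs j (by omega))
        (X (a + 2 * q + 2))
      rw [hX _ (by omega) (by omega), neg_neg] at this
      rw [hX _ (by omega) (by omega)]
      exact this
    rw [prs, wp_cons, wp_cons, apm]
    calc _ = fm ℓ (a + 2 * q + 1) (X (a + 2 * q + 1)) * (fm ℓ (a + 2 * q + 2) (X (a + 2 * q + 2)) *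
          (wp ℓ X (prs a q) * apm ℓ A a q) * nf ℓ (a + 2 * q + 2) (A (a + 2 * q + 2))) *
          nf ℓ (a + 2 * q + 1) (A (a + 2 * q + 1)) := by simp only [mul_assoc]
      _ = 1 := by
        rw [ih (fun i hi => hs i (by omega)) (fun i hi hi' => hX i hi (by omega)), mul_one, h2,
          mul_one, h1]

theorem dsc_mul_range' (hℓ : Function.Injective ℓ) {X : ℕ → R} {p : ℕ}
    (hs : ∀ i ≤ p, ∃ c, ℓ c = i) (hX : ∀ i, 0 < i → i ≤ p → X i = -A i) :
    dsc ℓ A 0 p * wp ℓ X (List.range' 1 p) = 1 := by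
  induction p with
  | zero => simp [dsc]
  | succ p ih =>
    have h1 : nf ℓ (p + 1) (A (p + 1)) * fm ℓ (p + 1) (X (p + 1)) = 1 := by
      have := nf_mul_fm hℓ (Nat.succ_pos p) (fun j hj => hs j (by omega)) (X (p + 1))
      rw [hX _ (by omega) (by omega), neg_neg] at this
      rw [hX _ (by omega) (by omega)]
      exact this
    rw [dsc, List.range'_1_concat, wp_append, wp_cons, wp_nil, mul_one]
    have e : 0 + p + 1 = p + 1 := by ring
    have e' : 1 + p = p + 1 := by ring
    rw [e, e']
    calc _ = nf ℓ (p + 1) (A (p + 1)) * (dsc ℓ A 0 p * wp ℓ X (List.range' 1 p)) *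
          fm ℓ (p + 1) (X (p + 1)) := by simp only [mul_assoc]
      _ = 1 := by
        rw [ih (fun i hi => hs i (by omega)) (fun i hi hi' => hX i hi (by omega)), mul_one, h1]

/-- Through `fm_flip` the pairs of the `z`-side become pairs of inverse-type factors whose indices,
read from the bottom, increase from pair to pair; they continue the pairs coming from the inverse of
the `w`-side. -/
theorem prs_flip {m : ℕ} {ℓ' : ι → ℕ} (hl : ∀ a, ℓ a + ℓ' a + 1 = m) {X : ℕ → R} {p : ℕ}
    (hX : ∀ i, 0 < i → i < m → X i = A (m - i)) (q a : ℕ) (ha : a + 1 + p + 2 * q = m) :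
    wp ℓ X (prs p q) = apm ℓ' A a q := by
  induction q generalizing a with
  | zero => rfl
  | succ q ih =>
    rw [prs, wp_cons, wp_cons, ih (a + 2) (by omega), add_comm q 1, apm_add,
      fm_flip hl (by omega), fm_flip hl (by omega), hX _ (by omega) (by omega),
      hX _ (by omega) (by omega)]
    have e1 : m - (p + 2 * q + 1) = a + 2 := by omega
    have e2 : m - (p + 2 * q + 2) = a + 1 := by omega
    rw [e1, e2]
    simp [apm, mul_assoc]

theorem range_flip {m : ℕ} {ℓ' : ι → ℕ} (hl : ∀ a, ℓ a + ℓ' a + 1 = m) {X : ℕ → R}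
    (hX : ∀ i, i < m → X i = A (m - i)) (p e : ℕ) (he : e + p + 1 = m) :
    wp ℓ X (List.range (p + 1)) = nf ℓ' m (A m) * dsc ℓ' A e p := by
  induction p generalizing e with
  | zero =>
    have := fm_flip hl (Nat.zero_le m) (A m)
    have h0 := hX 0 (by omega)
    rw [Nat.sub_zero] at h0 this
    simp [dsc, this, h0]
  | succ p ih =>
    rw [wp_range_succ, ih (e + 1) (by omega), mul_assoc, dsc_succ', fm_flip hl (by omega),
      hX _ (by omega)]
    have : m - (p + 1) = e + 1 := by omega
    rw [this]

/-- At stage `m` nothing is left to truncate, so the scheme starts from the true factor `N_m` with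
`Y = A_m`. -/
theorem tp_top {m : ℕ} (hℓ : Function.Injective ℓ) (hm : ∀ c, ℓ c < m) (Y : R) : tp ℓ m Y = nf ℓ m Y := by
  ext c d
  have h1 := hm c
  have h2 := hm d
  have h3 : ℓ c ≠ m := h1.ne
  have h4 : ℓ d ≠ m := h2.ne
  simp only [tp, nf, Matrix.diagonal_apply, Matrix.of_apply]
  by_cases h : c = d
  · subst h
    by_cases h5 : ℓ c + 1 = m
    · simp [h5]
    · have h6 : ℓ c + 1 < m := by omega
      simp [h5, h6, h3]
  · have h5 : ¬ (ℓ c + 1 = m ∧ ℓ d + 1 = m) := fun h5 => h (hℓ (by omega))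
    simp [h, h5, h3, h4]

end Elimination

/-! ### Passage between block matrices and plain matrices -/

section Flatten

variable {n m r : ℕ} {K : Type*} [CommRing K]

/-- Block matrices as plain matrices. -/
def fl : Matrix (Fin m) (Fin m) (Matrix (Fin n) (Fin n) K) ≃+*
    Matrix (Fin m × Fin n) (Fin m × Fin n) K :=
  Matrix.compRingEquiv (Fin m) (Fin n) K

theorem fl_apply (M : Matrix (Fin m) (Fin m) (Matrix (Fin n) (Fin n) K)) (p q : Fin m × Fin n) :
    fl M p q = M p.1 q.1 p.2 q.2 := rfl

theorem fl_sgn (ε : Fin m → ℤˣ) :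
    fl (sgn ε : Matrix (Fin m) (Fin m) (Matrix (Fin n) (Fin n) ℂ)) = quasiIdentity n ε := by
  ext ⟨a, i⟩ ⟨b, j⟩
  rw [fl_apply, sgn, quasiIdentity, Matrix.diagonal_apply, Matrix.diagonal_apply]
  by_cases h : a = b
  · subst h
    rcases Int.units_eq_one_or (ε a) with h1 | h1 <;> by_cases hij : i = j <;>
      simp [h1, hij]
  · simp [h]

theorem transpose_fl_fm (ℓ : Fin m → ℕ) (i : ℕ) (x : Matrix (Fin n) (Fin n) K) :
    (fl (fm ℓ i x))ᵀ = fl (fm ℓ i xᵀ) := by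
  ext ⟨a, s⟩ ⟨b, t⟩
  simp only [Matrix.transpose_apply, fl_apply, fm, Matrix.of_apply]
  by_cases h1 : ℓ a = i ∧ ℓ b = i
  · simp [h1]
  · have h1' : ¬ (ℓ b = i ∧ ℓ a = i) := fun h => h1 h.symm
    rw [if_neg h1, if_neg h1']
    by_cases h2 : (ℓ a + 1 = i ∧ ℓ b = i) ∨ (ℓ a = i ∧ ℓ b + 1 = i)
    · have h2' : (ℓ b + 1 = i ∧ ℓ a = i) ∨ (ℓ b = i ∧ ℓ a + 1 = i) := by tauto
      rw [if_pos h2, if_pos h2', Matrix.one_apply, Matrix.one_apply]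
      simp only [eq_comm]
    · have h2' : ¬ ((ℓ b + 1 = i ∧ ℓ a = i) ∨ (ℓ b = i ∧ ℓ a + 1 = i)) := by tauto
      rw [if_neg h2, if_neg h2']
      by_cases h3 : ℓ a + 1 = i ∧ ℓ b + 1 = i
      · simp [h3]
      · have h3' : ¬ (ℓ b + 1 = i ∧ ℓ a + 1 = i) := fun h => h3 h.symm
        rw [if_neg h3, if_neg h3']
        by_cases h4 : a = b
        · subst h4
          simp only [if_true, Matrix.one_apply, eq_comm]
        · simp [h4, Ne.symm h4]

/-- Each Fiedler matrix is symmetric up to transposing its block, and a skew-symmetric block changes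
sign; transposition of the product reverses the word. -/
theorem transpose_fl_wp (ℓ : Fin m → ℕ) (X : ℕ → Matrix (Fin n) (Fin n) K) (t : List ℕ)
    (hX : ∀ i ∈ t, (X i)ᵀ = -X i) : (fl (wp ℓ X t))ᵀ = fl (wp ℓ (-X) t.reverse) := by
  induction t with
  | nil => simp
  | cons i t ih =>
    rw [wp_cons, map_mul, Matrix.transpose_mul, ih fun j hj => hX j (List.mem_cons_of_mem _ hj),
      transpose_fl_fm, hX i List.mem_cons_self, List.reverse_cons, wp_append, map_mul]
    simp

theorem fiedlerP_natCast (coef : ℕ → Matrix (Fin n) (Fin n) ℂ) {i : ℕ} (hi : i < m) :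
    fiedlerP m coef i = fl (fm (lw m) i (-coef i)) := by
  rw [fiedlerP, if_pos (Int.natCast_nonneg i), Int.toNat_natCast]
  ext ⟨a, s⟩ ⟨b, t⟩
  rw [fl_apply, elemMat, Matrix.of_apply, elemBlock, fm, Matrix.of_apply]
  have ha := a.2
  have hb := b.2
  have e1 : ∀ c : Fin m, (c : ℤ) + 1 = m - i ↔ lw m c = i := fun c => by
    have := c.2
    simp only [lw]
    omega
  have e2 : ∀ c : Fin m, (c : ℤ) + 1 = m - i + 1 ↔ lw m c + 1 = i := fun c => by
    have := c.2
    simp only [lw]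
    omega
  rcases Nat.eq_zero_or_pos i with rfl | h0
  · simp only [Nat.cast_zero, if_true]
    by_cases hab : a = b
    · subst hab
      have := e1 a
      simp only [Nat.cast_zero, sub_zero] at this
      simp [this]
    · have h1 : ¬ (lw m a = 0 ∧ lw m b = 0) := fun h => hab (lw_inj m (h.1.trans h.2.symm))
      simp [hab, h1]
  · rw [if_neg (by omega), if_neg (by omega), if_pos (by omega)]
    simp only [e1, e2]
    by_cases h1 : lw m a = i ∧ lw m b = i
    · simp [h1]
    · simp only [if_neg h1]
      by_cases h2 : lw m a = i ∧ lw m b + 1 = i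
      · simp [h2]
      · by_cases h3 : lw m a + 1 = i ∧ lw m b = i <;> simp [h2, h3]

/-- Writing a negative index as `j - m` and counting blocks from the top gives the same normal form
as in `fiedlerP_natCast`, with block `A_{m-j}`. -/
theorem fiedlerP_sub (coef : ℕ → Matrix (Fin n) (Fin n) ℂ) {j : ℕ} (hj : j < m) :
    fiedlerP m coef ((j : ℤ) - m) = fl (fm (lz m) j (coef (m - j))) := by
  have e0 : (-((j : ℤ) - m)).toNat = m - j := by omega
  rw [fiedlerP, if_neg (by omega), e0]
  ext ⟨a, s⟩ ⟨b, t⟩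
  rw [fl_apply, elemMat, Matrix.of_apply, elemBlock, fm, Matrix.of_apply]
  have ha := a.2
  have hb := b.2
  have e1 : ∀ c : Fin m, (c : ℤ) + 1 = m + (j - m) ↔ lz m c + 1 = j := fun c => by
    have := c.2
    simp only [lz]
    omega
  have e2 : ∀ c : Fin m, (c : ℤ) + 1 = m + (j - m) + 1 ↔ lz m c = j := fun c => by
    have := c.2
    simp only [lz]
    omega
  rw [if_neg (by omega)]
  rcases Nat.eq_zero_or_pos j with rfl | h0
  · rw [if_pos (by omega)]
    by_cases hab : a = b
    · subst hab
      have : ((a : ℕ) : ℤ) + 1 = 1 ↔ lz m a = 0 := by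
        simp only [lz]
        omega
      simp [this]
    · have h1 : ¬ (lz m a = 0 ∧ lz m b = 0) := fun h => hab (lz_inj m (h.1.trans h.2.symm))
      simp [hab, h1]
  · rw [if_neg (by omega), if_neg (by omega)]
    simp only [e1, e2]
    by_cases h1 : lz m a = j ∧ lz m b = j
    · simp [h1]
    · by_cases h4 : lz m a + 1 = j ∧ lz m b + 1 = j
      · simp [h4, h1]
        have : ¬ (lz m a = j) := by omega
        have h' : ¬ (lz m b = j) := by omega
        simp [this, h']
      · simp only [if_neg h1, if_neg h4]
        by_cases h2 : lz m a = j ∧ lz m b + 1 = j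
        · simp [h2]
        · by_cases h3 : lz m a + 1 = j ∧ lz m b = j <;> simp [h2, h3]

/-- The list of the indices `j - m`. -/
def subL (m : ℕ) (t : List ℕ) : List ℤ := t.map fun j : ℕ => (j : ℤ) - m

theorem eq_subL {m : ℕ} {t : List ℤ} {s : List ℕ} (h : shift t m = castL s) : t = subL m s := by
  have : t = (shift t m).map fun i => i - (m : ℤ) := by
    rw [shift, List.map_map]
    conv_lhs => rw [← List.map_id t]
    refine List.map_congr_left fun i _ => ?_
    simp
  rw [this, h, castL, List.map_map]
  rfl

theorem subL_append (m : ℕ) (s t : List ℕ) : subL m (s ++ t) = subL m s ++ subL m t := by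
  simp [subL]

theorem subL_reverse (m : ℕ) (t : List ℕ) : (subL m t).reverse = subL m t.reverse := by
  simp [subL]

theorem tupleProd_append {M : Type*} [Monoid M] (f : ℤ → M) (s t : List ℤ) :
    tupleProd f (s ++ t) = tupleProd f s * tupleProd f t := by simp [tupleProd]

theorem tupleProd_cons {M : Type*} [Monoid M] (f : ℤ → M) (i : ℤ) (t : List ℤ) :
    tupleProd f (i :: t) = f i * tupleProd f t := by simp [tupleProd]

theorem tupleProd_castL (coef : ℕ → Matrix (Fin n) (Fin n) ℂ) {t : List ℕ} (ht : ∀ i ∈ t, i < m) :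
    tupleProd (fiedlerP m coef) (castL t) = fl (wp (lw m) (fun i => -coef i) t) := by
  rw [tupleProd, castL, List.map_map, wp, map_list_prod, List.map_map]
  congr 1
  refine List.map_congr_left fun i hi => ?_
  simp [fiedlerP_natCast coef (ht i hi)]

theorem tupleProd_subL (coef : ℕ → Matrix (Fin n) (Fin n) ℂ) {t : List ℕ} (ht : ∀ i ∈ t, i < m) :
    tupleProd (fiedlerP m coef) (subL m t) = fl (wp (lz m) (fun j => coef (m - j)) t) := by
  rw [tupleProd, subL, List.map_map, wp, map_list_prod, List.map_map]
  congr 1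
  refine List.map_congr_left fun i hi => ?_
  simp [fiedlerP_sub coef (ht i hi)]

theorem tupleProd_fiedlerPExt (r : ℕ) (coef : ℕ → Matrix (Fin n) (Fin n) ℂ) (t : List ℤ) :
    tupleProd (fiedlerPExt r m coef) t = extId r (tupleProd (fiedlerP m coef) t) := by
  induction t with
  | nil => simp [tupleProd, extId, Matrix.fromBlocks_one]
  | cons i t ih =>
    rw [tupleProd_cons, tupleProd_cons, ih, extId, extId, fiedlerPExt, Matrix.fromBlocks_multiply]
    simp

theorem tupleProd_fiedlerS (coef : ℕ → Matrix (Fin n) (Fin n) ℂ)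
    (C : Matrix (Fin n) (Fin r) ℂ) (E A : Matrix (Fin r) (Fin r) ℂ)
    (B : Matrix (Fin r) (Fin n) ℂ) (t : List ℤ) (h : ∀ i ∈ t, i ≠ 0 ∧ i ≠ -m) :
    tupleProd (fiedlerS m coef C E A B) t = extId r (tupleProd (fiedlerP m coef) t) := by
  rw [← tupleProd_fiedlerPExt, tupleProd, tupleProd]
  congr 1
  refine List.map_congr_left fun i hi => ?_
  rw [fiedlerS, if_neg (h i hi).1, if_neg (h i hi).2]

theorem fl_mul_eCol (M : Matrix (Fin m) (Fin m) (Matrix (Fin n) (Fin n) K)) {a k : Fin m}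
    (h : ∀ c, M c a = if c = k then 1 else 0) (C : Matrix (Fin n) (Fin r) K) :
    fl M * eCol m ((a : ℤ) + 1) C = eCol m ((k : ℤ) + 1) C := by
  have e : ∀ b c : Fin m, (b : ℤ) + 1 = (c : ℤ) + 1 ↔ b = c := fun b c => by
    rw [Fin.ext_iff]
    omega
  ext ⟨c, i⟩ j
  rw [Matrix.mul_apply, Fintype.sum_prod_type, Finset.sum_eq_single a]
  · simp only [fl_apply, h, eCol, Matrix.of_apply, e, if_true]
    by_cases hc : c = k
    · simp [hc, Matrix.one_apply]
    · simp [hc]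
  · intro b _ hb
    simp [eCol, e, hb]
  · simp

theorem eRow_mul_fl (M : Matrix (Fin m) (Fin m) (Matrix (Fin n) (Fin n) K)) {a k : Fin m}
    (h : ∀ c, M a c = if c = k then 1 else 0) (B : Matrix (Fin r) (Fin n) K) :
    eRow m ((a : ℤ) + 1) B * fl M = eRow m ((k : ℤ) + 1) B := by
  have e : ∀ b c : Fin m, (b : ℤ) + 1 = (c : ℤ) + 1 ↔ b = c := fun b c => by
    rw [Fin.ext_iff]
    omega
  ext j ⟨c, i⟩
  rw [Matrix.mul_apply, Fintype.sum_prod_type, Finset.sum_eq_single a]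
  · simp only [fl_apply, h, eRow, Matrix.of_apply, e, if_true]
    by_cases hc : c = k
    · simp [hc, Matrix.one_apply]
    · simp [hc]
  · intro b _ hb
    simp [eRow, e, hb]
  · simp

end Flatten

/-! ### Constant matrices, pencils and their coefficients -/

section Constants

variable {ι κ μ : Type*}

theorem cst_mul [Fintype κ] (M : Matrix ι κ ℂ) (N : Matrix κ μ ℂ) : cst (M * N) = cst M * cst N :=
  Matrix.map_mul (f := Polynomial.C)

theorem cst_one [DecidableEq ι] : cst (1 : Matrix ι ι ℂ) = 1 := by
  ext i j
  by_cases h : i = j <;> simp [cst, Matrix.one_apply, h]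

theorem cst_zero : cst (0 : Matrix ι κ ℂ) = 0 := by
  ext i j
  simp [cst]

theorem cst_neg (M : Matrix ι κ ℂ) : cst (-M) = -cst M := by
  ext i j
  simp [cst]

theorem cst_smul (c : ℂ) (M : Matrix ι κ ℂ) : cst (c • M) = Polynomial.C c • cst M := by
  ext i j
  simp [cst]

theorem cst_transpose (M : Matrix ι κ ℂ) : (cst M)ᵀ = cst Mᵀ := rfl

theorem cst_injective : Function.Injective (cst : Matrix ι κ ℂ → Matrix ι κ ℂ[X]) := fun M N h => by
  ext i j
  have := congrFun (congrFun h i) j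
  exact Polynomial.C_injective this

theorem cst_fromBlocks {ι' κ' : Type*} (M : Matrix ι κ ℂ) (N : Matrix ι κ' ℂ) (P : Matrix ι' κ ℂ)
    (Q : Matrix ι' κ' ℂ) :
    cst (Matrix.fromBlocks M N P Q) = Matrix.fromBlocks (cst M) (cst N) (cst P) (cst Q) :=
  Matrix.fromBlocks_map _ _ _ _ _

theorem cst_mul_pencil [Fintype κ] (M : Matrix ι κ ℂ) (E A : Matrix κ μ ℂ) :
    cst M * pencil E A = pencil (M * E) (M * A) := by
  rw [pencil, pencil, Matrix.mul_sub, Matrix.mul_smul, cst_mul, cst_mul]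

theorem pencil_mul_cst [Fintype κ] (E A : Matrix ι κ ℂ) (M : Matrix κ μ ℂ) :
    pencil E A * cst M = pencil (E * M) (A * M) := by
  rw [pencil, pencil, Matrix.sub_mul, Matrix.smul_mul, cst_mul, cst_mul]

theorem pencil_fromBlocks {ι' κ' : Type*} (M M' : Matrix ι κ ℂ) (N N' : Matrix ι κ' ℂ)
    (P P' : Matrix ι' κ ℂ) (Q Q' : Matrix ι' κ' ℂ) :
    pencil (Matrix.fromBlocks M N P Q) (Matrix.fromBlocks M' N' P' Q') =
      Matrix.fromBlocks (pencil M M') (pencil N N') (pencil P P') (pencil Q Q') := by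
  rw [pencil, cst_fromBlocks, cst_fromBlocks, Matrix.fromBlocks_smul, sub_eq_add_neg,
    Matrix.fromBlocks_neg, Matrix.fromBlocks_add]
  simp only [pencil, sub_eq_add_neg]

theorem pencil_zero_left (A : Matrix ι κ ℂ) : pencil 0 A = -cst A := by
  rw [pencil, cst_zero, smul_zero, zero_sub]

theorem pencil_inj {E A E' A' : Matrix ι κ ℂ} : pencil E A = pencil E' A' ↔ E = E' ∧ A = A' := by
  refine ⟨fun h => ?_, fun h => by rw [h.1, h.2]⟩
  have key : ∀ i j, (X : ℂ[X]) * C (E i j) - C (A i j) = X * C (E' i j) - C (A' i j) := fun i j =>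
    congrFun (congrFun h i) j
  constructor <;> ext i j
  · simpa [Polynomial.coeff_C] using congrArg (fun p => p.coeff 1) (key i j)
  · simpa [Polynomial.coeff_C] using congrArg (fun p => p.coeff 0) (key i j)

theorem isSkewSymm_pencil {E A : Matrix ι ι ℂ} :
    IsSkewSymm (pencil E A) ↔ IsSkewSymm E ∧ IsSkewSymm A := by
  have h1 : (pencil E A)ᵀ = pencil Eᵀ Aᵀ := rfl
  have h2 : -pencil E A = pencil (-E) (-A) := by
    rw [pencil, pencil, cst_neg, cst_neg, smul_neg]
    abel
  rw [IsSkewSymm, h1, h2, pencil_inj]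
  rfl

theorem isSkewSymm_polyMat {n m : ℕ} {coef : ℕ → Matrix (Fin n) (Fin n) ℂ}
    (h : IsSkewSymm (polyMat m coef)) {j : ℕ} (hj : j ≤ m) : (coef j)ᵀ = -coef j := by
  have key : ∀ a b, ((polyMat m coef) a b).coeff j = coef j a b := fun a b => by
    simp only [polyMat, Matrix.sum_apply, Matrix.smul_apply, cst, Matrix.map_apply, smul_eq_mul,
      Polynomial.finsetSum_coeff, Polynomial.coeff_X_pow_mul', Polynomial.coeff_C]
    rw [Finset.sum_eq_single j]
    · simp
    · intro i _ hij
      split_ifs <;> first | rfl | omega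
    · intro hn
      exact absurd (Finset.mem_range.2 (by omega)) hn
  ext a b
  have := congrArg (fun p => p.coeff j) (congrFun (congrFun h a) b)
  simpa [key] using this

end Constants

/-! ### The block structure of the two pencils -/

section Structure

variable {n m r pz qz qw : ℕ}

/-- The factors of the pencil to the right of `λ M_z - M_w`. -/
def rightF {R : Type*} [Ring R] (X Z : ℕ → R) (pz qz qw : ℕ) (tw tz : List ℕ) :
    Matrix (Fin m) (Fin m) R :=
  wp (lw m) X (cpl 0 qw) * wp (lw m) X tw * wp (lz m) Z (cpl pz qz) * wp (lz m) Z tz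

theorem gfprP_eq (coef : ℕ → Matrix (Fin n) (Fin n) ℂ) (hm : pz + 2 * qz + 2 * qw + 1 = m)
    (tw tz : List ℕ) (htw : ∀ i ∈ tw, i < 2 * qw) (htz : ∀ i ∈ tz, i < pz + 2 * qz) :
    gfprP m coef (castL (adm 0 qw)) (castL (cpl 0 qw)) (castL tw) (subL m (adm pz qz))
      (subL m (cpl pz qz)) (subL m tz) =
    cst (fl (leftW (fun i => -coef i) (fun j => coef (m - j)) tw tz)) *
      pencil (fl (wp (lz m) (fun j => coef (m - j)) (adm pz qz)))
        (fl (wp (lw m) (fun i => -coef i) (adm 0 qw))) *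
      cst (fl (rightF (fun i => -coef i) (fun j => coef (m - j)) pz qz qw tw tz)) := by
  have h1 : ∀ i ∈ adm 0 qw, i < m := fun i hi => by
    have := adm_le hi
    omega
  have h2 : ∀ i ∈ cpl 0 qw, i < m := fun i hi => by
    have := cpl_lt hi
    omega
  have h3 : ∀ i ∈ adm pz qz, i < m := fun i hi => by
    have := adm_le hi
    omega
  have h4 : ∀ i ∈ cpl pz qz, i < m := fun i hi => by
    have := cpl_lt hi
    omega
  have h5 : ∀ i ∈ tw, i < m := fun i hi => by
    have := htw i hi
    omega
  have h6 : ∀ i ∈ tz, i < m := fun i hi => by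
    have := htz i hi
    omega
  rw [gfprP, castL_reverse, subL_reverse, tupleProd_castL coef h1, tupleProd_castL coef h2,
    tupleProd_castL coef h5, tupleProd_subL coef h3, tupleProd_subL coef h4,
    tupleProd_subL coef h6, tupleProd_castL coef fun i hi => h5 i (List.mem_reverse.1 hi),
    tupleProd_subL coef fun i hi => h6 i (List.mem_reverse.1 hi), leftW, rightF]
  simp only [map_mul]

/-- The leading coefficient of the pencil. -/
def kz {R : Type*} [Ring R] (X Z : ℕ → R) (pz qz qw : ℕ) (tw tz : List ℕ) :
    Matrix (Fin m) (Fin m) R :=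
  leftW X Z tw tz * coreZ X Z pz qz qw * rightW X Z tw tz

/-- The trailing coefficient of the pencil, up to sign. -/
def kw {R : Type*} [Ring R] (X Z : ℕ → R) (pz qz qw : ℕ) (tw tz : List ℕ) :
    Matrix (Fin m) (Fin m) R :=
  leftW X Z tw tz * coreW X Z pz qz qw * rightW X Z tw tz

theorem gfprP_eq_pencil (coef : ℕ → Matrix (Fin n) (Fin n) ℂ)
    (hm : pz + 2 * qz + 2 * qw + 1 = m)
    (tw tz : List ℕ) (htw : ∀ i ∈ tw, i < 2 * qw) (htz : ∀ i ∈ tz, i < pz + 2 * qz) :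
    gfprP m coef (castL (adm 0 qw)) (castL (cpl 0 qw)) (castL tw) (subL m (adm pz qz))
      (subL m (cpl pz qz)) (subL m tz) =
    pencil (fl (kz (fun i => -coef i) (fun j => coef (m - j)) pz qz qw tw tz))
      (fl (kw (fun i => -coef i) (fun j => coef (m - j)) pz qz qw tw tz)) := by
  rw [gfprP_eq coef hm tw tz htw htz, cst_mul_pencil, pencil_mul_cst, ← map_mul, ← map_mul,
    ← map_mul, ← map_mul, mul_assoc, mul_assoc, rightF, coefZ_eq _ _ hm tw tz htw,
    coefW_eq _ _ hm tw tz htw, ← mul_assoc, ← mul_assoc]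
  rfl

theorem extId_mul {ι : Type*} [Fintype ι] (M N : Matrix ι ι ℂ) :
    extId r M * extId r N = extId r (M * N) := by
  simp [extId, Matrix.fromBlocks_multiply]

theorem prs_pos {p q i : ℕ} (h : i ∈ prs p q) : 0 < i := by
  induction q with
  | zero => simp [prs] at h
  | succ q ih =>
    rw [prs, List.mem_cons, List.mem_cons] at h
    rcases h with h | h | h
    · omega
    · omega
    · exact ih h

theorem prs_le {p q i : ℕ} (h : i ∈ prs p q) : i ≤ p + 2 * q :=
  adm_le (by rw [adm_eq_prs]; exact List.mem_append_left _ h)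

/-- With index `0` the admissible tuple ends with the letter `0`. So the column with `B^T` is
multiplied by all the preceding pairs, while the row with `B` meets no further factor. -/
theorem gfprS_w (coef : ℕ → Matrix (Fin n) (Fin n) ℂ) (B : Matrix (Fin r) (Fin n) ℂ)
    (E A : Matrix (Fin r) (Fin r) ℂ) (hm : 0 < m) :
    tupleProd (fiedlerS m coef (-Bᵀ) (-E) (-A) B) (castL (adm 0 qw)) =
      Matrix.fromBlocks (tupleProd (fiedlerP m coef) (castL (adm 0 qw)))
        (tupleProd (fiedlerP m coef) (castL (prs 0 qw)) * eCol m m Bᵀ) (-eRow m m B) A := by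
  have hp : ∀ i ∈ castL (prs 0 qw), i ≠ 0 ∧ i ≠ -m := by
    intro i hi
    obtain ⟨j, hj, rfl⟩ := List.mem_map.1 hi
    have h1 : 0 < j := prs_pos hj
    constructor <;> omega
  have e : castL (adm 0 qw) = castL (prs 0 qw) ++ [0] := by
    rw [adm_eq_prs, castL_append]
    rfl
  have e1 : eCol m m (-Bᵀ) = -eCol m m Bᵀ := by
    ext p j
    simp only [eCol, Matrix.of_apply, Matrix.neg_apply]
    split_ifs <;> simp
  rw [e, tupleProd_append, tupleProd_append, tupleProd_fiedlerS _ _ _ _ _ _ hp]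
  simp only [tupleProd, List.map_cons, List.map_nil, List.prod_cons, List.prod_nil, mul_one]
  rw [fiedlerS, if_pos rfl, extId, Matrix.fromBlocks_multiply, e1]
  simp

/-- The letter `-m` occurs once and contributes `E`; every other factor is the identity on the last
`r` coordinates. -/
theorem gfprS_z (coef : ℕ → Matrix (Fin n) (Fin n) ℂ) (C : Matrix (Fin n) (Fin r) ℂ)
    (B : Matrix (Fin r) (Fin n) ℂ) (E A : Matrix (Fin r) (Fin r) ℂ) (h : pz + 2 * qz < m) :
    tupleProd (fiedlerS m coef C (-E) A B) (subL m (adm pz qz)) =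
      Matrix.fromBlocks (tupleProd (fiedlerP m coef) (subL m (adm pz qz))) 0 0 E := by
  have hp : ∀ i ∈ subL m (prs pz qz), i ≠ 0 ∧ i ≠ -m := by
    intro i hi
    obtain ⟨j, hj, rfl⟩ := List.mem_map.1 hi
    have h1 : 0 < j := prs_pos hj
    have h2 : j ≤ pz + 2 * qz := prs_le hj
    constructor <;> omega
  have hp' : ∀ i ∈ subL m (List.range' 1 pz), i ≠ 0 ∧ i ≠ -m := by
    intro i hi
    obtain ⟨j, hj, rfl⟩ := List.mem_map.1 hi
    have := List.mem_range'_1.1 hj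
    constructor <;> omega
  have e : subL m (adm pz qz) = subL m (prs pz qz) ++ -(m : ℤ) :: subL m (List.range' 1 pz) := by
    rw [adm_eq_prs, List.range_eq_range', List.range'_succ, subL_append]
    simp [subL]
  rw [e, tupleProd_append, tupleProd_append, tupleProd_cons, tupleProd_cons,
    tupleProd_fiedlerS _ _ _ _ _ _ hp, tupleProd_fiedlerS _ _ _ _ _ _ hp', fiedlerS,
    if_neg (by omega), if_pos rfl]
  simp [extId, Matrix.fromBlocks_multiply]

theorem gfprS_eq (coef : ℕ → Matrix (Fin n) (Fin n) ℂ) (B : Matrix (Fin r) (Fin n) ℂ)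
    (E A : Matrix (Fin r) (Fin r) ℂ) (hm : pz + 2 * qz + 2 * qw + 1 = m)
    (tw tz : List ℕ) (htw : ∀ i ∈ tw, i < 2 * qw) (htz : ∀ i ∈ tz, i < pz + 2 * qz)
    {k : Fin m} (hk1 : ∀ a, lw m a = 0 → ∀ c, (leftW (fun i => -coef i) (fun j => coef (m - j)) tw tz *
      wp (lw m) (fun i => -coef i) (prs 0 qw) : Matrix (Fin m) (Fin m) _) c a = if c = k then 1 else 0)
    (hk2 : ∀ a, lw m a = 0 → ∀ c, rightF (fun i => -coef i) (fun j => coef (m - j)) pz qz qw tw tz a c =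
      if c = k then 1 else 0) :
    gfprS m coef (-Bᵀ) (-E) (-A) B (castL (adm 0 qw)) (castL (cpl 0 qw)) (castL tw)
      (subL m (adm pz qz)) (subL m (cpl pz qz)) (subL m tz) =
    Matrix.fromBlocks (gfprP m coef (castL (adm 0 qw)) (castL (cpl 0 qw)) (castL tw)
        (subL m (adm pz qz)) (subL m (cpl pz qz)) (subL m tz))
      (-cst (eCol m ((k : ℤ) + 1) Bᵀ)) (cst (eRow m ((k : ℤ) + 1) B)) (pencil E A) := by
  obtain ⟨a, ha⟩ := lw_surj (m := m) (j := 0) (by omega)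
  have ha' : (m : ℤ) = (a : ℤ) + 1 := by
    have := a.2
    simp only [lw] at ha
    omega
  have h1 : ∀ i ∈ prs 0 qw, i < m := fun i hi => by
    have : i ≤ 0 + 2 * qw := prs_le hi
    omega
  have h2 : ∀ i ∈ cpl 0 qw, i < m := fun i hi => by
    have := cpl_lt hi
    omega
  have h4 : ∀ i ∈ cpl pz qz, i < m := fun i hi => by
    have := cpl_lt hi
    omega
  have h5 : ∀ i ∈ tw, i < m := fun i hi => by
    have := htw i hi
    omega
  have h6 : ∀ i ∈ tz, i < m := fun i hi => by
    have := htz i hi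
    omega
  have eL : tupleProd (fiedlerP m coef) (subL m tz).reverse *
      tupleProd (fiedlerP m coef) (castL tw).reverse =
      fl (leftW (fun i => -coef i) (fun j => coef (m - j)) tw tz) := by
    rw [castL_reverse, subL_reverse, tupleProd_castL coef fun i hi => h5 i (List.mem_reverse.1 hi),
      tupleProd_subL coef fun i hi => h6 i (List.mem_reverse.1 hi), leftW, map_mul]
  have eR : tupleProd (fiedlerP m coef) (castL (cpl 0 qw)) * tupleProd (fiedlerP m coef) (castL tw) *
      tupleProd (fiedlerP m coef) (subL m (cpl pz qz)) * tupleProd (fiedlerP m coef) (subL m tz) =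
      fl (rightF (fun i => -coef i) (fun j => coef (m - j)) pz qz qw tw tz) := by
    rw [tupleProd_castL coef h2, tupleProd_castL coef h5, tupleProd_subL coef h4,
      tupleProd_subL coef h6, rightF]
    simp only [map_mul]
  rw [gfprS, gfprS_w coef B E A (by omega), gfprS_z coef _ _ _ _ (by omega)]
  simp only [tupleProd_fiedlerPExt, extId_mul]
  rw [gfprP, eL, eR, pencil_fromBlocks, extId, extId, cst_fromBlocks, cst_fromBlocks,
    Matrix.fromBlocks_multiply, Matrix.fromBlocks_multiply, pencil_zero_left, pencil_zero_left,
    tupleProd_castL coef h1, ha']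
  have c1 := fl_mul_eCol (K := ℂ) _ (hk1 a ha) Bᵀ
  have c2 := eRow_mul_fl (K := ℂ) _ (hk2 a ha) B
  rw [map_mul, Matrix.mul_assoc] at c1
  simp only [cst_zero, cst_one, neg_zero, Matrix.zero_mul, Matrix.mul_zero, add_zero, zero_add,
    Matrix.one_mul, Matrix.mul_one, cst_neg, neg_neg, Matrix.mul_neg, ← cst_mul, c1, c2]

end Structure

/-! ### Skew-symmetry of the pencils and the signs that produce it -/

section Skew

variable {n m r pz qz qw : ℕ}

theorem transpose_leftW {X Z : ℕ → Matrix (Fin n) (Fin n) ℂ} {tw tz : List ℕ}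
    (hX : ∀ i ∈ tw, (X i)ᵀ = -X i) (hZ : ∀ i ∈ tz, (Z i)ᵀ = -Z i) :
    (fl (leftW (m := m) X Z tw tz))ᵀ = fl (rightW (-X) (-Z) tw tz) := by
  rw [leftW, rightW, map_mul, Matrix.transpose_mul, transpose_fl_wp _ _ _ fun i hi => hX i (List.mem_reverse.1 hi),
    transpose_fl_wp _ _ _ fun i hi => hZ i (List.mem_reverse.1 hi), map_mul, List.reverse_reverse,
    List.reverse_reverse]

theorem transpose_rightW {X Z : ℕ → Matrix (Fin n) (Fin n) ℂ} {tw tz : List ℕ}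
    (hX : ∀ i ∈ tw, (X i)ᵀ = -X i) (hZ : ∀ i ∈ tz, (Z i)ᵀ = -Z i) :
    (fl (rightW (m := m) X Z tw tz))ᵀ = fl (leftW (-X) (-Z) tw tz) := by
  rw [leftW, rightW, map_mul, Matrix.transpose_mul, transpose_fl_wp _ _ _ hX,
    transpose_fl_wp _ _ _ hZ, map_mul]

theorem transpose_core (ℓ : Fin m → ℕ) {X : ℕ → Matrix (Fin n) (Fin n) ℂ} {p q : ℕ}
    (hX : ∀ i ≤ p + 2 * q, (X i)ᵀ = -X i) : (fl (core ℓ X p q))ᵀ = fl (core ℓ (-X) p q) := by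
  have h : core ℓ X p q = wp ℓ X (adm p q ++ cpl p q) := by rw [core, wp_append]
  rw [h, transpose_fl_wp _ _ _ fun i hi => ?_, core_pal]
  rcases List.mem_append.1 hi with hi | hi
  · exact hX i (adm_le hi)
  · exact hX i (cpl_lt hi).le

theorem transpose_cpl (ℓ : Fin m → ℕ) {X : ℕ → Matrix (Fin n) (Fin n) ℂ} {p q : ℕ}
    (hX : ∀ i < p + 2 * q, (X i)ᵀ = -X i) :
    (fl (wp ℓ X (cpl p q)))ᵀ = fl (wp ℓ (-X) (cpl p q)) := by
  rw [transpose_fl_wp _ _ _ fun i hi => hX i (cpl_lt hi), cpl_pal]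

variable {X Z : ℕ → Matrix (Fin n) (Fin n) ℂ}

theorem transpose_coreZ (hm : pz + 2 * qz + 2 * qw + 1 = m) (hX : ∀ i < m, (X i)ᵀ = -X i)
    (hZ : ∀ i < m, (Z i)ᵀ = -Z i) :
    (fl (coreZ (m := m) X Z pz qz qw))ᵀ = fl (coreZ (-X) (-Z) pz qz qw) := by
  have h1 : Commute (core (lz m) (-Z) pz qz) (wp (lw m) (-X) (cpl 0 qw)) :=
    commute_sides (k := pz + 2 * qz + 1) (h := 2 * qw) (by omega) (supp_core _ _ _ _)
      (supp_wp _ _ _ fun i hi => by have := cpl_lt hi; omega)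
  rw [coreZ, coreZ, map_mul, Matrix.transpose_mul, transpose_core _ fun i hi => hZ i (by omega),
    transpose_cpl _ fun i hi => hX i (by omega), h1.eq, map_mul]

theorem transpose_coreW (hm : pz + 2 * qz + 2 * qw + 1 = m) (hX : ∀ i < m, (X i)ᵀ = -X i)
    (hZ : ∀ i < m, (Z i)ᵀ = -Z i) :
    (fl (coreW (m := m) X Z pz qz qw))ᵀ = fl (coreW (-X) (-Z) pz qz qw) := by
  have h1 : Commute (wp (lz m) (-Z) (cpl pz qz)) (core (lw m) (-X) 0 qw) :=
    commute_sides (k := pz + 2 * qz) (h := 0 + 2 * qw + 1) (by omega)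
      (supp_wp _ _ _ fun _ => cpl_lt) (supp_core _ _ _ _)
  rw [coreW, coreW, map_mul, Matrix.transpose_mul, transpose_core _ fun i hi => hX i (by omega),
    transpose_cpl _ fun i hi => hZ i (by omega), ← map_mul, h1.eq]

theorem sgn_neg {ι R : Type*} [Fintype ι] [DecidableEq ι] [Ring R] (ε : ι → ℤˣ) :
    (sgn (-ε) : Matrix ι ι R) = -sgn ε := by
  ext a b
  by_cases h : a = b
  · subst h
    simp [sgn]
  · simp [sgn, h]

theorem transpose_fl_sgn (ε : Fin m → ℤˣ) :
    (fl (sgn ε : Matrix (Fin m) (Fin m) (Matrix (Fin n) (Fin n) ℂ)))ᵀ = fl (sgn ε) := by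
  rw [fl_sgn, quasiIdentity, Matrix.diagonal_transpose]

/-- The product equals `M' D C N` with `D` the diagonal of signs. Its transpose is `M' C' D N`, and
pulling `D` through `C'` restores `C` and produces the factor `-1`. -/
theorem isSkewSymm_sandwich {ε D : Fin m → ℤˣ}
    {M M' C C' N : Matrix (Fin m) (Fin m) (Matrix (Fin n) (Fin n) ℂ)} (h1 : Sg D ε M' M)
    (h2 : Sg D (-D) C' C) (hM : (fl M')ᵀ = fl N) (hN : (fl N)ᵀ = fl M') (hC : (fl C)ᵀ = fl C') :
    IsSkewSymm (fl (sgn ε * (M * C * N))) := by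
  have e : sgn ε * (M * C * N) = M' * sgn D * C * N := by
    rw [h1, mul_assoc, mul_assoc, mul_assoc]
  rw [IsSkewSymm, e]
  simp only [map_mul, Matrix.transpose_mul, hM, hN, hC, transpose_fl_sgn]
  simp only [← map_mul, ← mul_assoc]
  rw [mul_assoc M' C', h2, sgn_neg]
  simp [mul_assoc]

theorem exists_isSkewSymm (hm : pz + 2 * qz + 2 * qw + 1 = m) (hX : ∀ i < m, (X i)ᵀ = -X i)
    (hZ : ∀ i < m, (Z i)ᵀ = -Z i) {tw tz : List ℕ}
    (htw : ∀ i ∈ tw, i < 2 * qw) (htz : ∀ i ∈ tz, i < pz + 2 * qz) (hhw : Hop (bit0 0 qw) tw)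
    (hhz : Hop (bit0 pz qz) tz) :
    ∃ ε : Fin m → ℤˣ, IsSkewSymm (fl (sgn ε * kz (m := m) X Z pz qz qw tw tz)) ∧
      IsSkewSymm (fl (sgn ε * kw (m := m) X Z pz qz qw tw tz)) := by
  obtain ⟨ε, D, h1, h2, h3⟩ := exists_signs X Z hm tw tz htw htz hhw hhz
  have hXw : ∀ i ∈ tw, (X i)ᵀ = -X i := fun i hi => hX i (by have := htw i hi; omega)
  have hZz : ∀ i ∈ tz, (Z i)ᵀ = -Z i := fun i hi => hZ i (by have := htz i hi; omega)
  have hM : (fl (leftW (m := m) (-X) (-Z) tw tz))ᵀ = fl (rightW X Z tw tz) := by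
    rw [transpose_leftW (fun i hi => ?_) fun i hi => ?_, neg_neg, neg_neg]
    · simp [hXw i hi]
    · simp [hZz i hi]
  exact ⟨ε, isSkewSymm_sandwich h1 h2 hM (transpose_rightW hXw hZz) (transpose_coreZ hm hX hZ),
    isSkewSymm_sandwich h1 h3 hM (transpose_rightW hXw hZz) (transpose_coreW hm hX hZ)⟩

theorem isSkewSymm_fl {M : Matrix (Fin m) (Fin m) (Matrix (Fin n) (Fin n) ℂ)} :
    IsSkewSymm (fl M) ↔ ∀ a b, (M b a)ᵀ = -M a b := by
  constructor
  · intro h a b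
    ext i j
    exact congrFun (congrFun h (a, i)) (b, j)
  · intro h
    ext ⟨a, i⟩ ⟨b, j⟩
    exact congrFun (congrFun (h a b) i) j

/-- Skew-symmetry expresses the block `M b a` through `(M a b)ᵀ` with the sign `-δ a δ b`. As a
nonzero block differs from its negative, `δ a δ b` and `δ' a δ' b` must agree. -/
theorem signs_eq {M : Matrix (Fin m) (Fin m) (Matrix (Fin n) (Fin n) ℂ)} {δ δ' : Fin m → ℤˣ}
    (h : IsSkewSymm (fl (sgn δ * M))) (h' : IsSkewSymm (fl (sgn δ' * M))) {a b : Fin m}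
    (hab : M a b ≠ 0) : (δ * δ') a = (δ * δ') b := by
  have h1 := isSkewSymm_fl.1 h a b
  have h2 := isSkewSymm_fl.1 h' a b
  simp only [sgn, Matrix.diagonal_mul] at h1 h2
  rw [Pi.mul_apply, Pi.mul_apply]
  have hne : M a b ≠ -M a b := fun h => hab (by
    have : (2 : ℂ) • M a b = 0 := by
      rw [two_smul]
      nth_rewrite 1 [h]
      simp
    simpa using this)
  have hne' : -M a b ≠ M a b := fun h => hne h.symm
  rcases Int.units_eq_one_or (δ a) with e1 | e1 <;> rcases Int.units_eq_one_or (δ b) with e2 | e2 <;>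
    rcases Int.units_eq_one_or (δ' a) with e3 | e3 <;>
    rcases Int.units_eq_one_or (δ' b) with e4 | e4 <;>
    simp [e1, e2, e3, e4] at h1 h2 ⊢ <;>
    first
    | exact hne (h1.symm.trans h2)
    | exact hne' (h1.symm.trans h2)
    | (rw [h2] at h1; first | exact hne h1 | exact hne' h1)
    | (rw [h1] at h2; first | exact hne h2 | exact hne' h2)

theorem isSkewSymm_fromBlocks {ι κ R : Type*} [Ring R] {M : Matrix ι ι R} {N : Matrix ι κ R}
    {P : Matrix κ ι R} {Q : Matrix κ κ R} :
    IsSkewSymm (Matrix.fromBlocks M N P Q) ↔ IsSkewSymm M ∧ Pᵀ = -N ∧ IsSkewSymm Q := by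
  rw [IsSkewSymm, Matrix.fromBlocks_transpose, Matrix.fromBlocks_neg, Matrix.fromBlocks_inj]
  constructor
  · exact fun h => ⟨h.1, h.2.1, h.2.2.2⟩
  · rintro ⟨h1, h2, h3⟩
    refine ⟨h1, h2, ?_, h3⟩
    have := congrArg Matrix.transpose h2
    rw [Matrix.transpose_transpose, Matrix.transpose_neg] at this
    rw [this, neg_neg]

theorem transpose_eRow {R : Type*} [Zero R] (k : ℤ) (B : Matrix (Fin r) (Fin n) R) :
    (eRow m k B)ᵀ = eCol m k Bᵀ := rfl

theorem quasiIdentity_mul_eCol (ε : Fin m → ℤˣ) (k : Fin m) (C : Matrix (Fin n) (Fin r) ℂ) :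
    quasiIdentity n ε * eCol m ((k : ℤ) + 1) C = (((ε k : ℤˣ) : ℤ) : ℂ) • eCol m ((k : ℤ) + 1) C := by
  ext ⟨a, i⟩ j
  rw [quasiIdentity, Matrix.diagonal_mul, Matrix.smul_apply, eCol, Matrix.of_apply, smul_eq_mul]
  by_cases h : a = k
  · subst h
    rfl
  · have : ¬ ((a : ℤ) + 1 = (k : ℤ) + 1) := fun e => h (Fin.ext (by omega))
    simp [this]

theorem isSkewSymm_toRat {ι : Type*} {M : Matrix ι ι ℂ[X]} (h : IsSkewSymm M) :
    IsSkewSymm (toRat M) := by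
  ext i j
  have := congrArg (algebraMap ℂ[X] (RatFunc ℂ)) (congrFun (congrFun h i) j)
  simpa [toRat] using this

theorem isSkewSymm_transfer {ι : Type*} {P : Matrix ι ι ℂ[X]} (hP : IsSkewSymm P)
    {E A : Matrix (Fin r) (Fin r) ℂ} (hEA : IsSkewSymm (pencil E A)) (B : Matrix (Fin r) ι ℂ) :
    IsSkewSymm (transfer P Bᵀ E A B) := by
  have h1 := isSkewSymm_toRat hP
  have h2 := isSkewSymm_toRat hEA
  rw [IsSkewSymm] at h1 h2
  have h3 : ((toRat (pencil E A))⁻¹)ᵀ = -(toRat (pencil E A))⁻¹ := by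
    rw [Matrix.transpose_nonsing_inv, h2]
    -- Nonsingularity is not assumed: a singular pencil has the default inverse `0`, which is
    -- skew-symmetric as well.
    by_cases hd : IsUnit (toRat (pencil E A)).det
    · refine Matrix.inv_eq_left_inv ?_
      rw [neg_mul_neg, Matrix.nonsing_inv_mul _ hd]
    · rw [Matrix.nonsing_inv_apply_not_isUnit _ hd, Matrix.nonsing_inv_apply_not_isUnit, neg_zero]
      rw [Matrix.det_neg]
      intro h
      exact hd (isUnit_of_mul_isUnit_right h)
  have h4 : (toRat (cst B))ᵀ = toRat (cst Bᵀ) := rfl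
  have h5 : (toRat (cst Bᵀ))ᵀ = toRat (cst B) := rfl
  rw [IsSkewSymm, transfer, Matrix.transpose_add, Matrix.transpose_mul, Matrix.transpose_mul, h1, h3,
    h4, h5, neg_add, Matrix.neg_mul, Matrix.mul_neg, Matrix.mul_assoc]

end Skew

/-! ### Reduction of the Fiedler pencil of two admissible tuples -/

section Reduction

variable {ι S R : Type*} [Fintype ι] [DecidableEq ι] [CommRing S] [Ring R] [Algebra S R]

/-- Dividing by all factors of the admissible tuple except that with index `0` leaves `λ N - M_0`,
where `N` collects the inverse-type factors `1, …, m`. They are built up around the diagonal as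
follows: `1, …, p` on the right, the pairs of both tuples on the left, the remaining run on the
right, and finally `N_m`. The statement is symmetric in the two ends, so it also serves at infinity.
-/
theorem reduces_pencil {ℓ ℓ' : ι → ℕ} {m p q p' q' : ℕ} (hℓ : Function.Injective ℓ)
    (hs : ∀ i < m, ∃ c, ℓ c = i) (hl : ∀ a, ℓ' a + ℓ a + 1 = m)
    (hm : p + 2 * q + (p' + 2 * q') + 1 = m) (lam : S) {A X Z : ℕ → R}
    (hX : ∀ i < m, X i = -A i) (hZ : ∀ j < m, Z j = A (m - j)) {c₀ : ι} (hc₀ : ℓ c₀ = 0) :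
    ∃ T, lam • wp ℓ' Z (adm p' q') - wp ℓ X (adm p q) =
        wp ℓ X (prs p q) * T * wp ℓ X (List.range' 1 p) ∧
      Req c₀ T (endMat ℓ (∑ i ∈ Finset.range (m + 1), lam ^ i • A i)) := by
  set e := p + 2 * (q + q') with he
  have r1 : Reduces ℓ c₀ lam A (p + 1) 1 (dsc ℓ A 0 p) := by
    have := (Reduces.base (c₀ := c₀) (lam := lam) (A := A) hℓ).dsc (e := 0) (n := p) hℓ hc₀
      (fun i hi => hs i (by omega)) (Supp.one _) (Supp.one _)
    rw [mul_one] at this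
    have e1 : 0 + 1 + p = p + 1 := by ring
    rwa [e1] at this
  have sd : Supp {c | ℓ c < p + 1} (dsc ℓ A 0 p) := by
    have := supp_dsc ℓ A 0 p
    rwa [zero_add] at this
  have r2 := (r1.apm hℓ hc₀ (q := q + q') (fun i hi => hs i (by omega)) sd)
  have e2 : p + 1 + 2 * (q + q') = e + 1 := by omega
  rw [e2] at r2
  have r3 := r2.dsc (n := p') hℓ hc₀ (fun i hi => hs i (by omega)) (supp_apm ℓ A p (q + q'))
    (supp_mono_lt (by omega) sd)
  have e3 : e + 1 + p' = m := by omega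
  rw [e3] at r3
  have r4 := r3 (A m)
  rw [tp_top hℓ (fun c => by have := hl c; omega), ← Finset.sum_range_succ] at r4
  refine ⟨_, ?_, r4⟩
  have hX' : ∀ i, 0 < i → i ≤ p + 2 * q → X i = -A i := fun i _ hi => hX i (by omega)
  have f1 := prs_mul_apm hℓ (A := A) (X := X) (a := p) (q := q) (fun i hi => hs i (by omega)) hX'
  have f2 := dsc_mul_range' hℓ (A := A) (X := X) (p := p) (fun i hi => hs i (by omega))
    fun i h hi => hX' i h (by omega)
  have f3 : wp ℓ' Z (adm p' q') =
      apm ℓ A (p + 2 * q) q' * (nf ℓ m (A m) * dsc ℓ A e p') := by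
    rw [adm_eq_prs, wp_append, prs_flip hl (fun i _ hi => hZ i hi) q' (p + 2 * q) (by omega),
      range_flip hl hZ p' e (by omega)]
  have f4 : wp ℓ X (adm p q) = wp ℓ X (prs p q) * fm ℓ 0 (-A 0) * wp ℓ X (List.range' 1 p) := by
    rw [adm_eq_prs, wp_append, List.range_eq_range', List.range'_succ, wp_cons, hX 0 (by omega),
      mul_assoc]
  rw [f4, mul_sub, sub_mul, f3, mul_smul_comm, smul_mul_assoc, apm_add]
  congr 2
  calc _ = 1 * (apm ℓ A (p + 2 * q) q' * (nf ℓ m (A m) * dsc ℓ A e p')) * 1 := by simp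
    _ = (wp ℓ X (prs p q) * apm ℓ A p q) * (apm ℓ A (p + 2 * q) q' *
        (nf ℓ m (A m) * dsc ℓ A e p')) * (dsc ℓ A 0 p * wp ℓ X (List.range' 1 p)) := by rw [f1, f2]
    _ = _ := by simp only [mul_assoc, he]

end Reduction

/-! ### Division by `λE - A` and minimality of realizations -/

section Division

variable {ι : Type*} {r : ℕ}

theorem toRat_mul {κ μ : Type*} [Fintype κ] (M : Matrix ι κ ℂ[X]) (N : Matrix κ μ ℂ[X]) :
    toRat (M * N) = toRat M * toRat N := Matrix.map_mul (f := algebraMap ℂ[X] (RatFunc ℂ))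

theorem toRat_add {κ : Type*} (M N : Matrix ι κ ℂ[X]) : toRat (M + N) = toRat M + toRat N := by
  ext i j
  simp [toRat]

theorem toRat_neg {κ : Type*} (M : Matrix ι κ ℂ[X]) : toRat (-M) = -toRat M := by
  ext i j
  simp [toRat]

theorem exists_sum_monomials [Finite ι] {κ : Type*} [Finite κ] (M : Matrix ι κ ℂ[X]) :
    ∃ d : ℕ, M = ∑ k ∈ Finset.range d, (Polynomial.X : ℂ[X]) ^ k •
      cst (Matrix.of fun i j => (M i j).coeff k) := by
  have := Fintype.ofFinite ι
  have := Fintype.ofFinite κ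
  refine ⟨(Finset.univ.sup fun p : ι × κ => (M p.1 p.2).natDegree) + 1, ?_⟩
  ext1 i j
  have h : (M i j).natDegree < (Finset.univ.sup fun p : ι × κ => (M p.1 p.2).natDegree) + 1 :=
    Nat.lt_succ_of_le (Finset.le_sup (f := fun p : ι × κ => (M p.1 p.2).natDegree)
      (Finset.mem_univ (i, j)))
  conv_lhs => rw [(M i j).as_sum_range_C_mul_X_pow' h]
  simp only [Matrix.sum_apply, Matrix.smul_apply, cst, Matrix.map_apply, Matrix.of_apply, smul_eq_mul,
    mul_comm]

theorem cst_add {κ : Type*} (M N : Matrix ι κ ℂ) : cst (M + N) = cst M + cst N := by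
  ext i j
  simp [cst]

/-- Since `λ N = N E⁻¹ (λE - A) + N E⁻¹ A`, a power of `λ` can be traded for a multiple of the
pencil, until a constant remains. -/
theorem exists_div_pencil [Finite ι] {E : Matrix (Fin r) (Fin r) ℂ} (hE : E.det ≠ 0)
    (A : Matrix (Fin r) (Fin r) ℂ) (M : Matrix ι (Fin r) ℂ[X]) :
    ∃ (Q : Matrix ι (Fin r) ℂ[X]) (C : Matrix ι (Fin r) ℂ), M = Q * pencil E A + cst C := by
  have hmono : ∀ (k : ℕ) (N : Matrix ι (Fin r) ℂ), ∃ (Q : Matrix ι (Fin r) ℂ[X])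
      (C : Matrix ι (Fin r) ℂ), (Polynomial.X : ℂ[X]) ^ k • cst N = Q * pencil E A + cst C := by
    intro k
    induction k with
    | zero => exact fun N => ⟨0, N, by simp⟩
    | succ k ih =>
      intro N
      obtain ⟨Q, C, h⟩ := ih (N * E⁻¹ * A)
      refine ⟨(Polynomial.X : ℂ[X]) ^ k • cst (N * E⁻¹) + Q, C, ?_⟩
      have h1 : cst (N * E⁻¹) * pencil E A = (Polynomial.X : ℂ[X]) • cst N - cst (N * E⁻¹ * A) := by
        rw [cst_mul_pencil, pencil, Matrix.mul_assoc N, Matrix.nonsing_inv_mul _ hE.isUnit,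
          Matrix.mul_one]
      rw [Matrix.add_mul, Matrix.smul_mul, h1, smul_sub, h, smul_smul, ← pow_succ]
      abel
  have hsum : ∀ (N : ℕ → Matrix ι (Fin r) ℂ) (d : ℕ), ∃ (Q : Matrix ι (Fin r) ℂ[X])
      (C : Matrix ι (Fin r) ℂ), ∑ k ∈ Finset.range d, (Polynomial.X : ℂ[X]) ^ k • cst (N k) =
        Q * pencil E A + cst C := by
    intro N d
    induction d with
    | zero => exact ⟨0, 0, by simp [cst_zero]⟩
    | succ d ih =>
      obtain ⟨Q, C, h⟩ := ih
      obtain ⟨Q', C', h'⟩ := hmono d (N d)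
      refine ⟨Q + Q', C + C', ?_⟩
      rw [Finset.sum_range_succ, h, h', Matrix.add_mul, cst_add]
      abel
  obtain ⟨d, hd⟩ := exists_sum_monomials M
  rw [hd]
  exact hsum _ d

theorem pencil_transpose {κ : Type*} (E A : Matrix ι κ ℂ) : (pencil E A)ᵀ = pencil Eᵀ Aᵀ := rfl

theorem exists_pencil_div [Finite ι] {E : Matrix (Fin r) (Fin r) ℂ} (hE : E.det ≠ 0)
    (A : Matrix (Fin r) (Fin r) ℂ) (M : Matrix (Fin r) ι ℂ[X]) :
    ∃ (Q : Matrix (Fin r) ι ℂ[X]) (B : Matrix (Fin r) ι ℂ), M = pencil E A * Q + cst B := by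
  obtain ⟨Q, C, h⟩ := exists_div_pencil (E := Eᵀ) (by rwa [Matrix.det_transpose]) Aᵀ Mᵀ
  refine ⟨Qᵀ, Cᵀ, ?_⟩
  rw [← Matrix.transpose_transpose M, h, Matrix.transpose_add, Matrix.transpose_mul,
    pencil_transpose, Matrix.transpose_transpose, Matrix.transpose_transpose, cst_transpose]

theorem isUnit_det_pencil {E : Matrix (Fin r) (Fin r) ℂ} (hE : E.det ≠ 0)
    (A : Matrix (Fin r) (Fin r) ℂ) : IsUnit (toRat (pencil E A)).det := by
  have h1 : (toRat (pencil E A)).det = algebraMap ℂ[X] (RatFunc ℂ) (pencil E A).det :=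
    (RingHom.map_det _ _).symm
  rw [h1, isUnit_iff_ne_zero, Ne, FaithfulSMul.algebraMap_eq_zero_iff]
  intro h
  have h2 := Polynomial.coeff_det_X_add_C_card E (-A)
  have h3 : (Polynomial.X : ℂ[X]) • E.map Polynomial.C + (-A).map Polynomial.C = pencil E A := by
    rw [pencil, sub_eq_add_neg, ← cst_neg]
    rfl
  rw [h3, h, Polynomial.coeff_zero] at h2
  exact hE h2.symm

/-- Dividing `U C` and `B V` by the pencil splits the product into a polynomial part and constant
remainders around the same resolvent, so the size `r` is kept. -/
theorem exists_transfer_eq [Fintype ι] {P : Matrix ι ι ℂ[X]} {C : Matrix ι (Fin r) ℂ}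
    {E A : Matrix (Fin r) (Fin r) ℂ} {B : Matrix (Fin r) ι ℂ} (hE : E.det ≠ 0)
    (U V : Matrix ι ι ℂ[X]) :
    ∃ P' C' B', toRat U * transfer P C E A B * toRat V = transfer P' C' E A B' := by
  obtain ⟨Q₁, C₁, h1⟩ := exists_div_pencil hE A (U * cst C)
  obtain ⟨Q₂, B₂, h2⟩ := exists_pencil_div hE A (cst B * V)
  refine ⟨U * P * V + Q₁ * pencil E A * Q₂ + Q₁ * cst B₂ + cst C₁ * Q₂, C₁, B₂, ?_⟩
  have hd := isUnit_det_pencil hE A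
  simp only [transfer, toRat_add, toRat_mul]
  have e : toRat U * (toRat P + toRat (cst C) * (toRat (pencil E A))⁻¹ * toRat (cst B)) * toRat V =
      toRat U * toRat P * toRat V +
        toRat (U * cst C) * (toRat (pencil E A))⁻¹ * toRat (cst B * V) := by
    simp only [toRat_mul, Matrix.mul_add, Matrix.add_mul, Matrix.mul_assoc]
  rw [e, h1, h2]
  simp only [toRat_add, toRat_mul, Matrix.mul_add, Matrix.add_mul, Matrix.mul_assoc]
  rw [Matrix.mul_nonsing_inv_cancel_left _ _ hd]
  rw [Matrix.nonsing_inv_mul_cancel_left _ _ hd, Matrix.mul_nonsing_inv_cancel_left _ _ hd]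
  abel

theorem transfer_submatrix {κ : Type*} (f : κ → ι) (P : Matrix ι ι ℂ[X]) (C : Matrix ι (Fin r) ℂ)
    (E A : Matrix (Fin r) (Fin r) ℂ) (B : Matrix (Fin r) ι ℂ) :
    (transfer P C E A B).submatrix f f =
      transfer (P.submatrix f f) (C.submatrix f id) E A (B.submatrix id f) := rfl

/-- Minimality of a realization is preserved by unimodular equivalence of the transfer function. -/
theorem isMinimalRealization_of_unimodular {n m r : ℕ} {G : Matrix (Fin n) (Fin n) (RatFunc ℂ)}
    {P : Matrix (Fin n) (Fin n) ℂ[X]} {C : Matrix (Fin n) (Fin r) ℂ} {B : Matrix (Fin r) (Fin n) ℂ}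
    {E A : Matrix (Fin r) (Fin r) ℂ} (hmin : IsMinimalRealization G P C E A B) (hm : 0 < m)
    {P' : Matrix (Fin m × Fin n) (Fin m × Fin n) ℂ[X]} {C' : Matrix (Fin m × Fin n) (Fin r) ℂ}
    {B' : Matrix (Fin r) (Fin m × Fin n) ℂ} {K H : Matrix (Fin r) (Fin r) ℂ} (hK : K.det ≠ 0)
    {U V : Matrix (Fin m × Fin n) (Fin m × Fin n) ℂ[X]}
    (h : toRat U * transfer P' C' K H B' * toRat V = padId m G) :
    IsMinimalRealization (transfer P' C' K H B') P' C' K H B' := by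
  refine ⟨⟨hK, rfl⟩, fun r' P₂ C₂ E₂ A₂ B₂ h2 => ?_⟩
  -- A competing realization is carried along by `U` and `V` to one of the padded `G` of the same
  -- size; restricted to the last block it realizes `G` itself.
  obtain ⟨P₃, C₃, B₃, h3⟩ := exists_transfer_eq (P := P₂) (C := C₂) (A := A₂) (B := B₂) h2.1 U V
  rw [← h2.2, h] at h3
  let f : Fin n → Fin m × Fin n := fun i => (⟨m - 1, by omega⟩, i)
  have h4 : (padId m G).submatrix f f = G := by
    ext i j
    have : ((m - 1 : ℕ) : ℤ) + 1 = m := by omega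
    simp [padId, f, this]
  rw [h3, transfer_submatrix] at h4
  exact hmin.2 _ _ _ _ _ _ ⟨h2.1, h4.symm⟩

end Division

/-! ### Equivalence of the signed pencil with `diag(I, P(λ))` -/

section BlockEquivalence

variable {m pz qz qw : ℕ} {S R : Type*} [CommRing S] [Ring R] [Algebra S R]

theorem isUnit_sgn {ι : Type*} [Fintype ι] [DecidableEq ι] (ε : ι → ℤˣ) :
    IsUnit (sgn ε : Matrix ι ι R) := by
  have h : (sgn ε : Matrix ι ι R) * sgn ε = 1 := by
    rw [sgn, Matrix.diagonal_mul_diagonal, ← Matrix.diagonal_one]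
    congr 1
    funext c
    rcases Int.units_eq_one_or (ε c) with h | h <;> simp [h]
  exact ⟨⟨_, _, h, h⟩, rfl⟩

theorem isUnit_prs {ℓ : Fin m → ℕ} (hℓ : Function.Injective ℓ) {p q : ℕ}
    (hs : ∀ i ≤ p + 2 * q, ∃ a, ℓ a = i) (X : ℕ → R) : IsUnit (wp ℓ X (prs p q)) :=
  isUnit_wp hℓ (k := p + 2 * q + 1) (fun j hj => hs j (by omega)) _
    (fun i hi => Nat.lt_succ_of_le (prs_le hi)) fun h => absurd (prs_pos h) (lt_irrefl 0)

theorem isUnit_leftW {X Z : ℕ → R} {tw tz : List ℕ} (htw : ∀ i ∈ tw, i < m) (htz : ∀ i ∈ tz, i < m)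
    (hX : 0 ∈ tw → IsUnit (X 0)) (hZ : 0 ∈ tz → IsUnit (Z 0)) :
    IsUnit (leftW (m := m) X Z tw tz) :=
  (isUnit_wp (lz_inj m) (fun _ => lz_surj) _ (fun i hi => htz i (List.mem_reverse.1 hi))
    fun h => hZ (List.mem_reverse.1 h)).mul
  (isUnit_wp (lw_inj m) (fun _ => lw_surj) _ (fun i hi => htw i (List.mem_reverse.1 hi))
    fun h => hX (List.mem_reverse.1 h))

theorem zero_mem_cpl {q : ℕ} : 0 ∉ cpl 0 q := by
  induction q with
  | zero => simp [cpl, tri]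
  | succ q ih =>
    rw [cpl, List.mem_cons]
    rintro (h | h)
    · omega
    · exact ih h

theorem isUnit_rightF {X Z : ℕ → R} {tw tz : List ℕ} (hm : pz + 2 * qz + 2 * qw + 1 = m)
    (htw : ∀ i ∈ tw, i < m) (htz : ∀ i ∈ tz, i < m)
    (hX : 0 ∈ tw → IsUnit (X 0)) (hZ : 0 ∈ tz → IsUnit (Z 0)) (hp : pz ≠ 0 → IsUnit (Z 0)) :
    IsUnit (rightF (m := m) X Z pz qz qw tw tz) := by
  refine (((isUnit_wp (lw_inj m) (fun _ => lw_surj) _ (fun i hi => ?_) fun h => ?_).mul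
    (isUnit_wp (lw_inj m) (fun _ => lw_surj) _ htw hX)).mul
    (isUnit_wp (lz_inj m) (fun _ => lz_surj) _ (fun i hi => ?_) fun h => hp ?_)).mul
    (isUnit_wp (lz_inj m) (fun _ => lz_surj) _ htz hZ)
  · have := cpl_lt hi
    omega
  · exact absurd h zero_mem_cpl
  · have := cpl_lt hi
    omega
  · rintro rfl
    exact zero_mem_cpl h

/-- The invertible outer factors are divided off and `reduces_pencil` does the rest. Since the
reduction fixes block column and row `a₀`, and `L` and `N` relate these to number `k`, the
transformations also bring the corner blocks into place; `ε k = 1` avoids a sign there. -/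
theorem exists_block_equivalence (hm : pz + 2 * qz + 2 * qw + 1 = m) (lam : S) {A X Z : ℕ → R}
    (hX : ∀ i < m, X i = -A i) (hZ : ∀ j < m, Z j = A (m - j)) {L N : Matrix (Fin m) (Fin m) R}
    (hL : IsUnit L) (hN : IsUnit N) {a₀ k : Fin m} (ha₀ : lw m a₀ = 0)
    (hk1 : ∀ c, (L * wp (lw m) X (prs 0 qw)) c a₀ = if c = k then 1 else 0)
    (hk2 : ∀ c, N a₀ c = if c = k then 1 else 0) {ε : Fin m → ℤˣ} (hε : ε k = 1) :
    ∃ U V : Matrix (Fin m) (Fin m) R, IsUnit U ∧ IsUnit V ∧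
      U * (sgn ε * (L * (lam • wp (lz m) Z (adm pz qz) - wp (lw m) X (adm 0 qw)) * N)) * V =
        Matrix.diagonal (fun c => if lw m c = 0 then ∑ i ∈ Finset.range (m + 1), lam ^ i • A i
          else 1) ∧
      (∀ c, U c k = if c = a₀ then 1 else 0) ∧ ∀ c, V k c = if c = a₀ then 1 else 0 := by
  obtain ⟨T, hT, U₀, V₀, hU₀, hV₀, hUV, hUc, hVc⟩ := reduces_pencil (lw_inj m) (fun _ => lw_surj)
    (ℓ' := lz m) (fun a => by have := lw_add_lz m a; omega) (p := 0) (q := qw) (p' := pz) (q' := qz)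
    (by omega) lam hX hZ ha₀
  rw [List.range'_zero, wp_nil, mul_one] at hT
  obtain ⟨M, hM⟩ := (isUnit_sgn (R := R) ε).mul
    (hL.mul (isUnit_prs (lw_inj m) (p := 0) (q := qw) (fun i hi => lw_surj (by omega)) X))
  obtain ⟨N, rfl⟩ := hN
  have hE : IsUnit (endMat (lw m) (1 : R)) := by
    have h : endMat (lw m) (1 : R) * endMat (lw m) 1 = 1 := by
      rw [endMat, Matrix.diagonal_mul_diagonal, ← Matrix.diagonal_one]
      congr 1
      funext c
      split_ifs <;> simp
    exact ⟨⟨_, _, h, h⟩, rfl⟩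
  have hMk : ∀ c, (M : Matrix (Fin m) (Fin m) R) c a₀ = if c = k then 1 else 0 := fun c => by
    rw [hM, sgn, Matrix.diagonal_mul, hk1]
    by_cases h : c = k
    · simp [h, hε]
    · simp [h]
  refine ⟨endMat (lw m) 1 * U₀ * (↑M⁻¹ : Matrix (Fin m) (Fin m) R),
    (↑N⁻¹ : Matrix (Fin m) (Fin m) R) * V₀, (hE.mul hU₀).mul (Units.isUnit _),
    (Units.isUnit _).mul hV₀, ?_, fun c => ?_, fun c => ?_⟩
  · rw [hT]
    calc _ = endMat (lw m) (1 : R) * U₀ * ((↑M⁻¹ : Matrix (Fin m) (Fin m) R) *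
          (sgn ε * (L * wp (lw m) X (prs 0 qw)))) * T * ((↑N : Matrix (Fin m) (Fin m) R) * (↑N⁻¹ : Matrix (Fin m) (Fin m) R)) *
          V₀ := by simp only [mul_assoc]
      _ = endMat (lw m) (1 : R) * (U₀ * T * V₀) := by
        rw [← hM, Units.inv_mul, Units.mul_inv]
        simp only [mul_one, mul_assoc]
      _ = _ := by
        rw [hUV, endMat, endMat, Matrix.diagonal_mul_diagonal]
        congr 1
        funext c
        split_ifs <;> simp
  · rw [← mul_col (M := endMat (lw m) 1 * U₀ * (↑M⁻¹ : Matrix (Fin m) (Fin m) R)) hMk, mul_assoc,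
      Units.inv_mul, mul_one, endMat, Matrix.diagonal_mul, hUc, Matrix.one_apply]
    by_cases h : c = a₀
    · simp [h, ha₀]
    · simp [h]
  · rw [← row_mul (N := (↑N⁻¹ : Matrix (Fin m) (Fin m) R) * V₀) hk2, ← mul_assoc, Units.mul_inv,
      one_mul, hVc, Matrix.one_apply]
    simp only [eq_comm]

end BlockEquivalence

/-! ### Unimodular equivalence compatible with the corner blocks -/

section SystemEquivalence

variable {n m r pz qz qw : ℕ}

theorem fl_smul {K : Type*} [CommRing K] (c : K)
    (M : Matrix (Fin m) (Fin m) (Matrix (Fin n) (Fin n) K)) : fl (c • M) = c • fl M := rfl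

theorem isUnimodular_of_isUnit {ι : Type*} [Fintype ι] [DecidableEq ι] {U : Matrix ι ι ℂ[X]}
    (h : IsUnit U) : IsUnimodular U := by
  obtain ⟨c, hc, e⟩ := Polynomial.isUnit_iff.1 ((Matrix.isUnit_iff_isUnit_det _).1 h)
  exact ⟨c, hc.ne_zero, e.symm⟩

theorem cst_eCol (k : ℤ) (C : Matrix (Fin n) (Fin r) ℂ) : cst (eCol m k C) = eCol m k (cst C) := by
  ext p j
  simp only [cst, eCol, Matrix.map_apply, Matrix.of_apply]
  split_ifs <;> simp

theorem cst_eRow (k : ℤ) (B : Matrix (Fin r) (Fin n) ℂ) : cst (eRow m k B) = eRow m k (cst B) := by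
  ext p j
  simp only [cst, eRow, Matrix.map_apply, Matrix.of_apply]
  split_ifs <;> simp

theorem fl_diagonal {K : Type*} [CommRing K] (P : Matrix (Fin n) (Fin n) K) :
    fl (Matrix.diagonal fun c : Fin m => if lw m c = 0 then P else 1) = padId m P := by
  ext ⟨a, i⟩ ⟨b, j⟩
  simp only [fl_apply, padId, Matrix.diagonal_apply, Matrix.of_apply]
  have h : lw m a = 0 ↔ (a : ℤ) + 1 = m := by
    have := a.2
    simp only [lw]
    omega
  by_cases hab : a = b
  · subst hab
    simp only [if_true, h]
    split_ifs <;> rfl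
  · simp [hab]

theorem exists_system_equivalence {coef : ℕ → Matrix (Fin n) (Fin n) ℂ}
    (hm : pz + 2 * qz + 2 * qw + 1 = m)
    {tw tz : List ℕ} (htw : ∀ i ∈ tw, i < 2 * qw) (htz : ∀ i ∈ tz, i < pz + 2 * qz)
    {k : Fin m} (hk1 : ∀ a, lw m a = 0 → ∀ c, (leftW (fun i => -coef i) (fun j => coef (m - j)) tw tz *
      wp (lw m) (fun i => -coef i) (prs 0 qw) : Matrix (Fin m) (Fin m) _) c a = if c = k then 1 else 0)
    (hk2 : ∀ a, lw m a = 0 → ∀ c, rightF (fun i => -coef i) (fun j => coef (m - j)) pz qz qw tw tz a c =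
      if c = k then 1 else 0)
    (hL : IsUnit (leftW (m := m) (fun i => -coef i) (fun j => coef (m - j)) tw tz))
    (hR : IsUnit (rightF (m := m) (fun i => -coef i) (fun j => coef (m - j)) pz qz qw tw tz))
    {ε : Fin m → ℤˣ} (hε : ε k = 1) :
    ∃ U V : Matrix (Fin m × Fin n) (Fin m × Fin n) ℂ[X], IsUnimodular U ∧ IsUnimodular V ∧
      U * (cst (quasiIdentity n ε) * gfprP m coef (castL (adm 0 qw)) (castL (cpl 0 qw)) (castL tw)
        (subL m (adm pz qz)) (subL m (cpl pz qz)) (subL m tz)) * V = padId m (polyMat m coef) ∧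
      (∀ C : Matrix (Fin n) (Fin r) ℂ,
        U * cst (eCol m ((k : ℤ) + 1) C) = cst (eCol m m C)) ∧
      ∀ B : Matrix (Fin r) (Fin n) ℂ, cst (eRow m ((k : ℤ) + 1) B) * V = cst (eRow m m B) := by
  obtain ⟨a₀, ha₀⟩ := lw_surj (m := m) (j := 0) (by omega)
  have ha' : (m : ℤ) = (a₀ : ℤ) + 1 := by
    have := a₀.2
    simp only [lw] at ha₀
    omega
  set f : Matrix (Fin n) (Fin n) ℂ →+* Matrix (Fin n) (Fin n) ℂ[X] :=
    (Polynomial.C : ℂ →+* ℂ[X]).mapMatrix with hf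
  set X : ℕ → Matrix (Fin n) (Fin n) ℂ := fun i => -coef i with hXd
  set Z : ℕ → Matrix (Fin n) (Fin n) ℂ := fun j => coef (m - j) with hZd
  have hite : ∀ c d : Fin m, f (if c = d then 1 else 0) = if c = d then 1 else 0 := fun c d => by
    split_ifs
    · exact map_one f
    · exact map_zero f
  obtain ⟨U, V, hU, hV, hUV, hUk, hVk⟩ := exists_block_equivalence (pz := pz) (qz := qz) (qw := qw)
    hm (Polynomial.X : ℂ[X]) (A := fun i => f (coef i)) (X := fun i => f (X i))
    (Z := fun i => f (Z i)) (fun i _ => map_neg f _) (fun j _ => rfl)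
    (L := (leftW X Z tw tz).map f) (N := (rightF X Z pz qz qw tw tz).map f)
    (hL.map f.mapMatrix) (hR.map f.mapMatrix) ha₀ (k := k) (fun c => by
      rw [← map_wp, ← Matrix.map_mul, Matrix.map_apply, hk1 a₀ ha₀, hite])
    (fun c => by rw [Matrix.map_apply, hk2 a₀ ha₀, hite]) hε
  refine ⟨fl U, fl V, isUnimodular_of_isUnit (hU.map fl), isUnimodular_of_isUnit (hV.map fl),
    ?_, fun C => ?_, fun B => ?_⟩
  · have hP : polyMat m coef = ∑ i ∈ Finset.range (m + 1), (Polynomial.X : ℂ[X]) ^ i • f (coef i) :=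
      rfl
    have hsg : fl ((sgn ε : Matrix (Fin m) (Fin m) (Matrix (Fin n) (Fin n) ℂ)).map f) =
        cst (quasiIdentity n ε) := by rw [← fl_sgn]; rfl
    have hsg' : (sgn ε : Matrix (Fin m) (Fin m) (Matrix (Fin n) (Fin n) ℂ)).map f = sgn ε := by
      rw [sgn, Matrix.diagonal_map (map_zero f), sgn]
      congr 1
      funext c
      simp
    rw [hP, ← fl_diagonal, ← hUV, gfprP_eq coef hm tw tz htw htz, ← hsg, hsg', ← map_wp, ← map_wp]
    simp only [map_mul, map_sub, fl_smul]
    rfl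
  · rw [cst_eCol, cst_eCol, ha', fl_mul_eCol U hUk]
  · rw [cst_eRow, cst_eRow, ha', eRow_mul_fl V hVk]

end SystemEquivalence

/-! ### The ring of rational functions with a limit at infinity -/

section Proper

/-- A denominator has finitely many zeros, so near infinity evaluation respects sums and products;
all limit rules rest on this. -/
theorem eventually_eval_denom_ne_zero (f : RatFunc ℂ) :
    ∀ᶠ x in Bornology.cobounded ℂ, Polynomial.eval₂ (RingHom.id ℂ) x f.denom ≠ 0 := by
  have h : {x : ℂ | Polynomial.IsRoot f.denom x}.Finite :=
    Polynomial.finite_setOfPred_isRoot f.denom_ne_zero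
  have h1 := Bornology.isBounded_def.1 h.isBounded
  filter_upwards [h1] with x hx h2
  exact hx h2

/-- The rational function `f` tends to `d` at infinity. -/
def HasLim (f : RatFunc ℂ) (d : ℂ) : Prop :=
  Tendsto (fun x : ℂ => RatFunc.eval (RingHom.id ℂ) x f) (Bornology.cobounded ℂ) (𝓝 d)

theorem HasLim.unique {f : RatFunc ℂ} {d d' : ℂ} (h : HasLim f d) (h' : HasLim f d') : d = d' :=
  tendsto_nhds_unique h h'

theorem HasLim.add {f g : RatFunc ℂ} {d e : ℂ} (hf : HasLim f d) (hg : HasLim g e) :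
    HasLim (f + g) (d + e) := by
  refine (Tendsto.add hf hg).congr' ?_
  filter_upwards [eventually_eval_denom_ne_zero f, eventually_eval_denom_ne_zero g] with x hx hy
  exact (RatFunc.eval_add _ _ hx hy).symm

theorem HasLim.mul {f g : RatFunc ℂ} {d e : ℂ} (hf : HasLim f d) (hg : HasLim g e) :
    HasLim (f * g) (d * e) := by
  refine (Tendsto.mul hf hg).congr' ?_
  filter_upwards [eventually_eval_denom_ne_zero f, eventually_eval_denom_ne_zero g] with x hx hy
  exact (RatFunc.eval_mul _ _ hx hy).symm

theorem hasLim_C (c : ℂ) : HasLim (algebraMap ℂ[X] (RatFunc ℂ) (Polynomial.C c)) c := by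
  have : ∀ x : ℂ, RatFunc.eval (RingHom.id ℂ) x (algebraMap ℂ[X] (RatFunc ℂ) (Polynomial.C c)) = c :=
    fun x => by rw [RatFunc.algebraMap_C, RatFunc.eval_C, RingHom.id_apply]
  rw [HasLim]
  simp only [this]
  exact tendsto_const_nhds

theorem hasLim_one : HasLim 1 1 := by simpa using hasLim_C 1

theorem hasLim_zero : HasLim 0 0 := by simpa using hasLim_C 0

theorem HasLim.neg {f : RatFunc ℂ} {d : ℂ} (hf : HasLim f d) : HasLim (-f) (-d) := by
  have := (hasLim_C (-1)).mul hf
  simpa using this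

theorem HasLim.inv {f : RatFunc ℂ} {d : ℂ} (hf : HasLim f d) (hd : d ≠ 0) : HasLim f⁻¹ d⁻¹ := by
  have h0 : f ≠ 0 := by
    rintro rfl
    exact hd (hf.unique hasLim_zero)
  refine (Tendsto.inv₀ hf hd).congr' ?_
  filter_upwards [eventually_eval_denom_ne_zero f, eventually_eval_denom_ne_zero f⁻¹] with x hx hy
  have := RatFunc.eval_mul _ _ hx hy
  rw [mul_inv_cancel₀ h0, RatFunc.eval_one] at this
  exact inv_eq_of_mul_eq_one_right this.symm

theorem hasLim_inv_X : HasLim (RatFunc.X : RatFunc ℂ)⁻¹ 0 := by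
  have h : Tendsto (fun x : ℂ => x⁻¹) (Bornology.cobounded ℂ) (𝓝 0) := tendsto_inv₀_cobounded
  refine h.congr' ?_
  filter_upwards [eventually_eval_denom_ne_zero (RatFunc.X : RatFunc ℂ),
    eventually_eval_denom_ne_zero (RatFunc.X : RatFunc ℂ)⁻¹] with x hx hy
  have := RatFunc.eval_mul _ _ hx hy
  rw [mul_inv_cancel₀ RatFunc.X_ne_zero, RatFunc.eval_one, RatFunc.eval_X] at this
  exact inv_eq_of_mul_eq_one_right this.symm

/-- The ring of rational functions with a limit at infinity. -/
def properRing : Subring (RatFunc ℂ) where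
  carrier := {f | ∃ d, HasLim f d}
  mul_mem' := fun ⟨_, h⟩ ⟨_, h'⟩ => ⟨_, h.mul h'⟩
  one_mem' := ⟨1, hasLim_one⟩
  add_mem' := fun ⟨_, h⟩ ⟨_, h'⟩ => ⟨_, h.add h'⟩
  zero_mem' := ⟨0, hasLim_zero⟩
  neg_mem' := fun ⟨_, h⟩ => ⟨_, h.neg⟩

theorem hasLim_choose (f : properRing) : HasLim f (Classical.choose f.2) := Classical.choose_spec f.2

/-- The value at infinity. -/
def limHom : properRing →+* ℂ where
  toFun f := Classical.choose f.2
  map_one' := (hasLim_choose 1).unique hasLim_one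
  map_mul' f g := (hasLim_choose (f * g)).unique ((hasLim_choose f).mul (hasLim_choose g))
  map_zero' := (hasLim_choose 0).unique hasLim_zero
  map_add' f g := (hasLim_choose (f + g)).unique ((hasLim_choose f).add (hasLim_choose g))

theorem hasLim_limHom (f : properRing) : HasLim f (limHom f) := hasLim_choose f

/-- The constants. -/
def constHom : ℂ →+* properRing :=
  ((algebraMap ℂ[X] (RatFunc ℂ)).comp Polynomial.C).codRestrict properRing fun c => ⟨c, hasLim_C c⟩

/-- The uniformizer at infinity. -/
def invX : properRing := ⟨RatFunc.X⁻¹, 0, hasLim_inv_X⟩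

theorem limHom_constHom (c : ℂ) : limHom (constHom c) = c :=
  (hasLim_limHom _).unique (hasLim_C c)

theorem limHom_invX : limHom invX = 0 := (hasLim_limHom _).unique hasLim_inv_X

theorem isUnit_of_limHom {f : properRing} (h : limHom f ≠ 0) : IsUnit f := by
  have h1 := (hasLim_limHom f).inv h
  have h0 : (f : RatFunc ℂ) ≠ 0 := by
    intro e
    refine h ((hasLim_limHom f).unique ?_)
    rw [e]
    exact hasLim_zero
  refine IsUnit.of_mul_eq_one ⟨_, _, h1⟩ (Subtype.ext ?_)
  exact mul_inv_cancel₀ h0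

/-- The value at infinity is a ring homomorphism on proper functions, hence it maps an invertible
matrix to one with nonzero determinant, and this is the required limit. -/
theorem isBiproper_of_isUnit {ι : Type*} [Fintype ι] [DecidableEq ι] {M : Matrix ι ι properRing}
    (h : IsUnit M) : IsBiproper (M.map properRing.subtype) := by
  refine ⟨M.map limHom, ?_, fun i j => hasLim_limHom (M i j)⟩
  exact ((Matrix.isUnit_iff_isUnit_det _).1 (h.map limHom.mapMatrix)).ne_zero

/-- `λE - A = λ (E - λ⁻¹ A)`, and the bracket is a proper matrix with nonsingular limit `E`. -/
theorem exists_resolvent {r : ℕ} {E : Matrix (Fin r) (Fin r) ℂ} (hE : E.det ≠ 0)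
    (A : Matrix (Fin r) (Fin r) ℂ) : ∃ W : Matrix (Fin r) (Fin r) properRing,
      (toRat (pencil E A))⁻¹ = (RatFunc.X : RatFunc ℂ)⁻¹ • W.map properRing.subtype := by
  set M : Matrix (Fin r) (Fin r) properRing := E.map constHom - invX • A.map constHom with hM
  have h1 : M.map limHom = E := by
    ext i j
    simp [hM, limHom_constHom, limHom_invX]
  have h2 : IsUnit M.det := by
    refine isUnit_of_limHom ?_
    rw [RingHom.map_det]
    change (M.map limHom).det ≠ 0
    rwa [h1]
  have h3 : toRat (pencil E A) = (RatFunc.X : RatFunc ℂ) • M.map properRing.subtype := by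
    ext i j
    have hX : (RatFunc.X : RatFunc ℂ) * (RatFunc.X)⁻¹ = 1 := mul_inv_cancel₀ RatFunc.X_ne_zero
    have e : (M.map properRing.subtype) i j = algebraMap ℂ[X] (RatFunc ℂ) (Polynomial.C (E i j)) -
        (RatFunc.X)⁻¹ * algebraMap ℂ[X] (RatFunc ℂ) (Polynomial.C (A i j)) := rfl
    rw [Matrix.smul_apply, e, smul_eq_mul, mul_sub, ← mul_assoc, hX, one_mul]
    rw [mul_comm]
    simp [toRat, pencil, cst]
  refine ⟨M⁻¹, Matrix.inv_eq_left_inv ?_⟩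
  rw [h3, Matrix.smul_mul, Matrix.mul_smul, smul_smul, inv_mul_cancel₀ RatFunc.X_ne_zero, one_smul,
    ← Matrix.map_mul, Matrix.nonsing_inv_mul _ h2, Matrix.map_one _ (map_zero _) (map_one _)]

end Proper

/-! ### The block reduction seen from the other end -/

section AtInfinity

variable {m pz qz qw : ℕ} {S R : Type*} [CommRing S] [Ring R] [Algebra S R]

theorem wp_congr {ι : Type*} [Fintype ι] [DecidableEq ι] (ℓ : ι → ℕ) {X Y : ℕ → R} {t : List ℕ}
    (h : ∀ i ∈ t, X i = Y i) : wp ℓ X t = wp ℓ Y t := by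
  rw [wp, wp]
  congr 1
  exact List.map_congr_left fun i hi => by rw [h i hi]

/-- The block permutation matrix which reverses the order of the blocks. -/
def revMat : Matrix (Fin m) (Fin m) R := Matrix.of fun a b => if b = Fin.rev a then 1 else 0

theorem revMat_mul (M : Matrix (Fin m) (Fin m) R) (a c : Fin m) :
    ((revMat : Matrix (Fin m) (Fin m) R) * M) a c = M (Fin.rev a) c := row_mul (fun _ => rfl) c

theorem mul_revMat (M : Matrix (Fin m) (Fin m) R) (c a : Fin m) :
    (M * (revMat : Matrix (Fin m) (Fin m) R)) c a = M c (Fin.rev a) :=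
  mul_col (fun b => by
    rw [revMat, Matrix.of_apply]
    have h : a = Fin.rev b ↔ b = Fin.rev a := by rw [eq_comm, Fin.rev_eq_iff]
    simp only [h]) c

theorem isUnit_revMat : IsUnit (revMat : Matrix (Fin m) (Fin m) R) := by
  have h : (revMat : Matrix (Fin m) (Fin m) R) * revMat = 1 := by
    ext a b
    rw [revMat_mul, revMat, Matrix.of_apply, Fin.rev_rev, Matrix.one_apply]
    simp only [eq_comm]
  exact ⟨⟨_, _, h, h⟩, rfl⟩

/-- `reduces_pencil` is applied with labels from the top and the roles of the two tuples exchanged,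
which reduces the reversed pencil. The surviving block is then the first one, and `revMat` brings it
to the last place. -/
theorem exists_block_equivalence_infty (hm : pz + 2 * qz + 2 * qw + 1 = m) (mu : S)
    {A X Z : ℕ → R} (hZ : ∀ j < m, Z j = -A j) (hX : ∀ i < m, X i = A (m - i))
    {L N : Matrix (Fin m) (Fin m) R} (hL : IsUnit L) (hN : IsUnit N) (ε : Fin m → ℤˣ) :
    ∃ U V : Matrix (Fin m) (Fin m) R, IsUnit U ∧ IsUnit V ∧
      U * (sgn ε * (L * (wp (lz m) Z (adm pz qz) - mu • wp (lw m) X (adm 0 qw)) * N)) * V =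
        Matrix.diagonal (fun c => if lw m c = 0 then
          -∑ i ∈ Finset.range (m + 1), mu ^ i • A i else 1) := by
  obtain ⟨a₀, ha₀⟩ := lz_surj (m := m) (j := 0) (by omega)
  obtain ⟨T, hT, U₀, V₀, hU₀, hV₀, hUV, -, -⟩ := reduces_pencil (lz_inj m) (fun _ => lz_surj)
    (ℓ' := lw m) (lw_add_lz m) (p := pz) (q := qz) (p' := 0) (q' := qw)
    (by omega) mu hZ hX ha₀
  obtain ⟨M, hM⟩ := (isUnit_sgn (R := R) ε).mul
    (hL.mul (isUnit_prs (lz_inj m) (p := pz) (q := qz) (fun i hi => lz_surj (by omega)) Z))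
  have hS : IsUnit (wp (lz m) Z (List.range' 1 pz)) := isUnit_wp (lz_inj m) (fun _ => lz_surj) _
    (fun i hi => by have := List.mem_range'_1.1 hi; omega)
    fun h => by have := List.mem_range'_1.1 h; omega
  obtain ⟨N', hN'⟩ := hS.mul hN
  refine ⟨revMat * U₀ * (↑M⁻¹ : Matrix (Fin m) (Fin m) R),
    (↑N'⁻¹ : Matrix (Fin m) (Fin m) R) * V₀ * revMat, (isUnit_revMat.mul hU₀).mul (Units.isUnit _),
    ((Units.isUnit _).mul hV₀).mul isUnit_revMat, ?_⟩
  rw [← neg_sub, hT]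
  calc _ = -(revMat * U₀ * ((↑M⁻¹ : Matrix (Fin m) (Fin m) R) *
        (sgn ε * (L * wp (lz m) Z (prs pz qz)))) * T * ((wp (lz m) Z (List.range' 1 pz) * N) *
        (↑N'⁻¹ : Matrix (Fin m) (Fin m) R)) * V₀ * revMat) := by
        simp only [mul_assoc, mul_neg, neg_mul]
    _ = -(revMat * (U₀ * T * V₀) * revMat) := by
      rw [← hM, ← hN', Units.inv_mul, Units.mul_inv]
      simp only [mul_one, mul_assoc]
    _ = _ := by
      rw [hUV]
      ext a b
      have h1 : lz m (Fin.rev a) = lw m a := by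
        simp only [lz, lw, Fin.val_rev]
        omega
      rw [Matrix.neg_apply, mul_revMat, revMat_mul, endMat, Matrix.diagonal_apply,
        Matrix.diagonal_apply, h1]
      simp only [Fin.rev_inj]
      split_ifs <;> simp

end AtInfinity

/-! ### Biproper equivalence of the transfer functions at infinity -/

section Infinity

variable {n m r pz qz qw : ℕ}

/-- Constant blocks over the ring of proper rational functions. -/
def cBlk : Matrix (Fin n) (Fin n) ℂ →+* Matrix (Fin n) (Fin n) properRing := constHom.mapMatrix

/-- Block matrices over the ring of proper rational functions as plain rational matrices. -/
def flR : Matrix (Fin m) (Fin m) (Matrix (Fin n) (Fin n) properRing) →+*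
    Matrix (Fin m × Fin n) (Fin m × Fin n) (RatFunc ℂ) :=
  (properRing.subtype.mapMatrix).comp fl.toRingHom

theorem flR_map (M : Matrix (Fin m) (Fin m) (Matrix (Fin n) (Fin n) ℂ)) :
    flR (M.map cBlk) = toRat (cst (fl M)) := rfl

theorem flR_smul (M : Matrix (Fin m) (Fin m) (Matrix (Fin n) (Fin n) properRing)) :
    flR (invX • M) = (RatFunc.X : RatFunc ℂ)⁻¹ • flR M := rfl

theorem isBiproper_flR {M : Matrix (Fin m) (Fin m) (Matrix (Fin n) (Fin n) properRing)}
    (h : IsUnit M) : IsBiproper (flR M) := isBiproper_of_isUnit (h.map fl)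

theorem flR_diagonal (P : Matrix (Fin n) (Fin n) properRing) :
    flR (Matrix.diagonal fun c : Fin m => if lw m c = 0 then P else 1) =
      padId m (P.map properRing.subtype) := by
  change (fl (Matrix.diagonal fun c : Fin m => if lw m c = 0 then P else 1)).map properRing.subtype = _
  rw [fl_diagonal]
  ext ⟨a, i⟩ ⟨b, j⟩
  simp only [padId, Matrix.map_apply, Matrix.of_apply]
  split_ifs
  · rfl
  · by_cases hij : i = j <;> simp [hij, Matrix.one_apply]
  · simp

theorem eCol_mul_mul_eRow {a : Fin m} {K : Type*} [CommRing K] (C : Matrix (Fin n) (Fin r) K)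
    (W : Matrix (Fin r) (Fin r) K) (B : Matrix (Fin r) (Fin n) K) :
    eCol m ((a : ℤ) + 1) C * W * eRow m ((a : ℤ) + 1) B = fl (Matrix.single a a (C * W * B)) := by
  have e : ∀ b : Fin m, (b : ℤ) + 1 = (a : ℤ) + 1 ↔ a = b := fun b => by
    rw [Fin.ext_iff]
    omega
  ext ⟨b, i⟩ ⟨c, j⟩
  simp only [fl_apply, Matrix.single_apply, Matrix.mul_apply, eCol, eRow, Matrix.of_apply, e]
  by_cases hb : a = b
  · by_cases hc : a = c
    · simp [hb, ← hc, Matrix.mul_apply]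
    · simp [hc]
  · simp [hb]

theorem toRat_polyMat (coef : ℕ → Matrix (Fin n) (Fin n) ℂ) :
    toRat (polyMat m coef) =
      ∑ j ∈ Finset.range (m + 1), (RatFunc.X : RatFunc ℂ) ^ j • toRat (cst (coef j)) := by
  ext a b
  simp only [toRat, polyMat, Matrix.map_apply, Matrix.sum_apply, Matrix.smul_apply, smul_eq_mul,
    map_sum, map_mul, map_pow, RatFunc.algebraMap_X]

theorem toRat_pencil {ι κ : Type*} (E A : Matrix ι κ ℂ) :
    toRat (pencil E A) = (RatFunc.X : RatFunc ℂ) • toRat (cst E) - toRat (cst A) := by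
  ext a b
  simp [toRat, pencil]

theorem wp_adm_zero {R ι : Type*} [Ring R] [Fintype ι] [DecidableEq ι] (ℓ : ι → ℕ) (X : ℕ → R)
    (q : ℕ) : wp ℓ X (adm 0 q) = wp ℓ X (prs 0 q) * fm ℓ 0 (X 0) := by
  rw [adm_eq_prs, wp_append, zero_add, List.range_one, wp_cons, wp_nil, mul_one]

theorem fm_zero_sub {R ι : Type*} [Ring R] [Fintype ι] [DecidableEq ι] {ℓ : ι → ℕ}
    (hℓ : Function.Injective ℓ) {a : ι} (ha : ℓ a = 0) (x y : R) :
    fm ℓ 0 (x - y) = fm ℓ 0 x - Matrix.single a a y := by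
  have e : ∀ c, ℓ c = 0 ↔ a = c := fun c => ⟨fun h => hℓ (ha.trans h.symm), fun h => h ▸ ha⟩
  ext c d
  simp only [fm, Matrix.sub_apply, Matrix.of_apply, Matrix.single_apply, e]
  split_ifs <;> simp_all

theorem sum_invX (coef : ℕ → Matrix (Fin n) (Fin n) ℂ) (Γ : Matrix (Fin n) (Fin n) properRing) :
    (-∑ i ∈ Finset.range (m + 1), invX ^ i •
      (if i = m then -(cBlk (coef 0) + invX • Γ) else -cBlk (coef (m - i)))).map properRing.subtype =
    ((RatFunc.X : RatFunc ℂ)⁻¹ ^ m) • (toRat (polyMat m coef) +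
      (RatFunc.X : RatFunc ℂ)⁻¹ • Γ.map properRing.subtype) := by
  have hX : (RatFunc.X : RatFunc ℂ) ≠ 0 := RatFunc.X_ne_zero
  rw [Finset.sum_range_succ, if_pos rfl, toRat_polyMat, Finset.sum_range_succ', pow_zero, one_smul,
    add_assoc, smul_add, Finset.smul_sum, ← Finset.sum_range_reflect
      fun x => (RatFunc.X : RatFunc ℂ)⁻¹ ^ m • RatFunc.X ^ (x + 1) • toRat (cst (coef (x + 1)))]
  have h1 : ∑ i ∈ Finset.range m, invX ^ i • (if i = m then -(cBlk (coef 0) + invX • Γ) else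
      -cBlk (coef (m - i))) = -∑ i ∈ Finset.range m, invX ^ i • cBlk (coef (m - i)) := by
    rw [← Finset.sum_neg_distrib]
    refine Finset.sum_congr rfl fun i hi => ?_
    rw [if_neg (Finset.mem_range.1 hi).ne, smul_neg]
  rw [h1, smul_neg, ← neg_add, neg_neg]
  change properRing.subtype.mapMatrix _ = _
  rw [map_add, map_sum]
  congr 1
  refine Finset.sum_congr rfl fun i hi => ?_
  have hi' := Finset.mem_range.1 hi
  have e1 : m - 1 - i + 1 = m - i := by omega
  rw [e1, smul_smul]
  have e2 : (RatFunc.X : RatFunc ℂ)⁻¹ ^ m * RatFunc.X ^ (m - i) = (RatFunc.X)⁻¹ ^ i := by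
    rw [show m = i + (m - i) by omega, pow_add, Nat.add_sub_cancel_left, mul_assoc, ← mul_pow,
      inv_mul_cancel₀ hX, one_pow, mul_one]
  rw [e2]
  rfl

/-- Since `(λE - A)⁻¹ = λ⁻¹ W` with `W` proper, `G` looks like `P` with `A_0` replaced by `A_0 + λ⁻¹
C W B`. The corner term of the transfer function makes the same replacement in the Fiedler pencil,
so the reduction at infinity over proper functions yields `λ^{-m} G` in one stroke. -/
theorem exists_infinity_equivalence {coef : ℕ → Matrix (Fin n) (Fin n) ℂ}
    {B : Matrix (Fin r) (Fin n) ℂ} {C : Matrix (Fin n) (Fin r) ℂ}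
    {E A : Matrix (Fin r) (Fin r) ℂ} (hE : E.det ≠ 0) (hm : pz + 2 * qz + 2 * qw + 1 = m)
    {tw tz : List ℕ} (htw : ∀ i ∈ tw, i < 2 * qw) (htz : ∀ i ∈ tz, i < pz + 2 * qz)
    {k : Fin m} (hk1 : ∀ a, lw m a = 0 → ∀ c, (leftW (fun i => -coef i) (fun j => coef (m - j)) tw tz *
      wp (lw m) (fun i => -coef i) (prs 0 qw) : Matrix (Fin m) (Fin m) _) c a = if c = k then 1 else 0)
    (hk2 : ∀ a, lw m a = 0 → ∀ c, rightF (fun i => -coef i) (fun j => coef (m - j)) pz qz qw tw tz a c =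
      if c = k then 1 else 0)
    (hL : IsUnit (leftW (m := m) (fun i => -coef i) (fun j => coef (m - j)) tw tz))
    (hR : IsUnit (rightF (m := m) (fun i => -coef i) (fun j => coef (m - j)) pz qz qw tw tz))
    {ε : Fin m → ℤˣ} (hε : ε k = 1) :
    ∃ Ol Or : Matrix (Fin m × Fin n) (Fin m × Fin n) (RatFunc ℂ), IsBiproper Ol ∧ IsBiproper Or ∧
      Ol * ((RatFunc.X : RatFunc ℂ)⁻¹ • transfer (cst (quasiIdentity n ε) * gfprP m coef
        (castL (adm 0 qw)) (castL (cpl 0 qw)) (castL tw) (subL m (adm pz qz))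
        (subL m (cpl pz qz)) (subL m tz)) (eCol m ((k : ℤ) + 1) C) E A (eRow m ((k : ℤ) + 1) B)) *
        Or = padId m (((RatFunc.X : RatFunc ℂ)⁻¹ ^ m) • transfer (polyMat m coef) C E A B) := by
  obtain ⟨a₀, ha₀⟩ := lw_surj (m := m) (j := 0) (by omega)
  obtain ⟨W, hW⟩ := exists_resolvent hE A
  set X : ℕ → Matrix (Fin n) (Fin n) ℂ := fun i => -coef i with hXd
  set Z : ℕ → Matrix (Fin n) (Fin n) ℂ := fun j => coef (m - j) with hZd
  set Lf : Matrix (Fin m) (Fin m) _ := leftW X Z tw tz with hLf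
  set Rf : Matrix (Fin m) (Fin m) _ := rightF X Z pz qz qw tw tz with hRf
  set Γ : Matrix (Fin n) (Fin n) properRing := C.map constHom * W * B.map constHom with hΓ
  -- Coefficients in reversed order with a minus sign, as the reduction from the top requires; only
  -- the one at `m`, belonging to `A_0`, carries the strictly proper correction.
  set A' : ℕ → Matrix (Fin n) (Fin n) properRing := fun i =>
    if i = m then -(cBlk (coef 0) + invX • Γ) else -cBlk (coef (m - i)) with hA'
  obtain ⟨U, V, hU, hV, hUV⟩ := exists_block_equivalence_infty (pz := pz) (qz := qz) (qw := qw) hm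
    invX (A := A') (X := fun i => A' (m - i)) (Z := fun i => cBlk (Z i))
    (fun j hj => by simp only [hA', if_neg hj.ne, neg_neg]; rfl) (fun i _ => rfl)
    (L := Lf.map cBlk) (N := Rf.map cBlk) (hL.map cBlk.mapMatrix) (hR.map cBlk.mapMatrix) ε
  refine ⟨flR U, flR V, isBiproper_flR hU, isBiproper_flR hV, ?_⟩
  have hsg : (sgn ε : Matrix (Fin m) (Fin m) (Matrix (Fin n) (Fin n) ℂ)).map cBlk = sgn ε := by
    rw [sgn, Matrix.diagonal_map (map_zero cBlk), sgn]
    congr 1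
    funext c
    simp
  have hw : wp (lw m) (fun i => A' (m - i)) (adm 0 qw) = (wp (lw m) X (adm 0 qw)).map cBlk -
      (wp (lw m) X (prs 0 qw)).map cBlk * (invX • Matrix.single a₀ a₀ Γ) := by
    have h0 : A' (m - 0) = cBlk (X 0) - invX • Γ := by
      simp only [hA', Nat.sub_zero, if_true, hXd, map_neg, neg_add, sub_eq_add_neg]
    have h1 : wp (lw m) (fun i => A' (m - i)) (prs 0 qw) =
        wp (lw m) (fun i => cBlk (X i)) (prs 0 qw) := wp_congr _ fun i hi => by
      have h2 := prs_pos hi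
      have h3 := prs_le hi
      have h4 : m - (m - i) = i := by omega
      simp only [hA', if_neg (show m - i ≠ m by omega), h4, hXd, map_neg]
    rw [map_wp, map_wp, wp_adm_zero, wp_adm_zero, h1, h0, fm_zero_sub (lw_inj m) ha₀, mul_sub,
      Matrix.smul_single]
  -- By tracking, the columns and rows at block `k` are the images of those at `a₀`. So the corner
  -- term is the outer factors applied to `Γ` at position `(a₀, a₀)`, which is the correction found
  -- in `hw`.
  have hcorner : toRat (cst (eCol m ((k : ℤ) + 1) C)) * (toRat (pencil E A))⁻¹ *
      toRat (cst (eRow m ((k : ℤ) + 1) B)) = flR (sgn ε * (Lf.map cBlk *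
        ((wp (lw m) X (prs 0 qw)).map cBlk * (invX • Matrix.single a₀ a₀ Γ)) * Rf.map cBlk)) := by
    have c0 : cst (quasiIdentity n ε) * cst (eCol m ((k : ℤ) + 1) C) =
        cst (eCol m ((k : ℤ) + 1) C) := by
      rw [← cst_mul, quasiIdentity_mul_eCol, hε]
      simp
    have c1 := fl_mul_eCol (K := ℂ) _ (hk1 a₀ ha₀) C
    have c2 := eRow_mul_fl (K := ℂ) _ (hk2 a₀ ha₀) B
    have c3 := eCol_mul_mul_eRow (a := a₀) (C.map constHom) W (B.map constHom)
    have c5 : toRat (cst (eCol m ((a₀ : ℤ) + 1) C)) * W.map properRing.subtype *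
        toRat (cst (eRow m ((a₀ : ℤ) + 1) B)) = flR (Matrix.single a₀ a₀ Γ) := by
      have e1 : toRat (cst (eCol m ((a₀ : ℤ) + 1) C)) =
          (eCol m ((a₀ : ℤ) + 1) (C.map constHom)).map properRing.subtype := by
        ext p j
        simp only [toRat, cst, eCol, Matrix.map_apply, Matrix.of_apply]
        split_ifs
        · rfl
        · simp
      have e2 : toRat (cst (eRow m ((a₀ : ℤ) + 1) B)) =
          (eRow m ((a₀ : ℤ) + 1) (B.map constHom)).map properRing.subtype := by
        ext p j
        simp only [toRat, cst, eRow, Matrix.map_apply, Matrix.of_apply]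
        split_ifs
        · rfl
        · simp
      rw [e1, e2, ← Matrix.map_mul, ← Matrix.map_mul, c3]
      rfl
    rw [← c0, ← c1, ← c2, hW, ← fl_sgn]
    simp only [map_mul, flR_smul, flR_map, ← c5, ← hsg, cst_mul, toRat_mul, Matrix.mul_smul,
      Matrix.smul_mul, Matrix.mul_assoc]
  have hmain : (RatFunc.X : RatFunc ℂ)⁻¹ • transfer (cst (quasiIdentity n ε) * gfprP m coef
        (castL (adm 0 qw)) (castL (cpl 0 qw)) (castL tw) (subL m (adm pz qz))
        (subL m (cpl pz qz)) (subL m tz)) (eCol m ((k : ℤ) + 1) C) E A (eRow m ((k : ℤ) + 1) B) =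
      flR (sgn ε * (Lf.map cBlk * (wp (lz m) (fun i => cBlk (Z i)) (adm pz qz) -
        invX • wp (lw m) (fun i => A' (m - i)) (adm 0 qw)) * Rf.map cBlk)) := by
    have hg : gfprP m coef (castL (adm 0 qw)) (castL (cpl 0 qw)) (castL tw) (subL m (adm pz qz))
        (subL m (cpl pz qz)) (subL m tz) = cst (fl Lf) * pencil (fl (wp (lz m) Z (adm pz qz)))
        (fl (wp (lw m) X (adm 0 qw))) * cst (fl Rf) := gfprP_eq coef hm tw tz htw htz
    rw [transfer, hcorner, hw, hg, ← fl_sgn, toRat_mul, toRat_mul,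
      toRat_mul, toRat_pencil, ← flR_map, ← flR_map, ← flR_map, ← flR_map, ← flR_map, hsg, ← map_wp]
    simp only [map_mul, map_sub, flR_smul, mul_sub, sub_mul, smul_sub, smul_add,
      inv_smul_smul₀ (RatFunc.X_ne_zero (K := ℂ)), mul_smul_comm, smul_mul_assoc]
    abel
  rw [hmain, ← map_mul, ← map_mul, hUV, flR_diagonal, sum_invX, transfer, hW]
  congr 3
  rw [Matrix.mul_smul, Matrix.smul_mul, Matrix.map_mul, Matrix.map_mul]
  rfl

end Infinity

/-! ### The Rosenbrock strong linearization and the normalization of signs -/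

theorem pencil_neg {ι κ : Type*} (E A : Matrix ι κ ℂ) : pencil (-E) (-A) = -pencil E A := by
  rw [pencil, pencil, cst_neg, cst_neg, smul_neg]
  abel

/-- The definition of a strong linearization writes the state block as `H - λK`, here with `K = -E`
and `H = -A`; together with the corner `-B^T` the two changes of sign cancel. -/
theorem transfer_neg {ι : Type*} {r : ℕ} (P : Matrix ι ι ℂ[X]) (C : Matrix ι (Fin r) ℂ)
    {E : Matrix (Fin r) (Fin r) ℂ} (hE : E.det ≠ 0) (A : Matrix (Fin r) (Fin r) ℂ)
    (B : Matrix (Fin r) ι ℂ) : transfer P (-C) (-E) (-A) B = transfer P C E A B := by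
  have h : (toRat (pencil (-E) (-A)))⁻¹ = -(toRat (pencil E A))⁻¹ := by
    refine Matrix.inv_eq_left_inv ?_
    rw [pencil_neg, toRat_neg, neg_mul_neg, Matrix.nonsing_inv_mul _ (isUnit_det_pencil hE A)]
  rw [transfer, transfer, h, cst_neg, toRat_neg, Matrix.neg_mul, Matrix.mul_neg, neg_neg]

theorem padId_transfer {n m r : ℕ} (hm : 0 < m) (P : Matrix (Fin n) (Fin n) ℂ[X])
    (C : Matrix (Fin n) (Fin r) ℂ) (E A : Matrix (Fin r) (Fin r) ℂ) (B : Matrix (Fin r) (Fin n) ℂ) :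
    padId m (transfer P C E A B) = toRat (padId m P) +
      toRat (cst (eCol m m C)) * (toRat (pencil E A))⁻¹ * toRat (cst (eRow m m B)) := by
  obtain ⟨a₀, ha₀⟩ := lw_surj (m := m) (j := 0) hm
  have ha' : (m : ℤ) = (a₀ : ℤ) + 1 := by
    have := a₀.2
    simp only [lw] at ha₀
    omega
  have e1 : toRat (cst (eCol m ((a₀ : ℤ) + 1) C)) = eCol m ((a₀ : ℤ) + 1) (toRat (cst C)) := by
    ext p j
    simp only [toRat, cst, eCol, Matrix.map_apply, Matrix.of_apply]
    split_ifs <;> simp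
  have e2 : toRat (cst (eRow m ((a₀ : ℤ) + 1) B)) = eRow m ((a₀ : ℤ) + 1) (toRat (cst B)) := by
    ext p j
    simp only [toRat, cst, eRow, Matrix.map_apply, Matrix.of_apply]
    split_ifs <;> simp
  have e3 : ∀ a : Fin m, (a : ℤ) + 1 = m ↔ a₀ = a := fun a => by
    rw [Fin.ext_iff]
    omega
  rw [show eCol m m C = eCol m ((a₀ : ℤ) + 1) C by rw [← ha'],
    show eRow m m B = eRow m ((a₀ : ℤ) + 1) B by rw [← ha'], e1, e2, eCol_mul_mul_eRow, transfer]
  ext ⟨a, i⟩ ⟨b, j⟩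
  simp only [padId, toRat, Matrix.of_apply, Matrix.add_apply, Matrix.map_apply, fl_apply,
    Matrix.single_apply, e3]
  by_cases hab : a = b
  · subst hab
    by_cases ha : a₀ = a
    · simp [ha]
    · by_cases hij : i = j <;> simp [ha, hij, Matrix.one_apply]
  · have : ¬ (a₀ = a ∧ a₀ = b) := by
      rintro ⟨rfl, rfl⟩
      exact hab rfl
    simp [hab, this]

theorem isRosenbrockStrongLinearization_gfpr {n m r pz qz qw : ℕ}
    {G : Matrix (Fin n) (Fin n) (RatFunc ℂ)}
    {coef : ℕ → Matrix (Fin n) (Fin n) ℂ} {B : Matrix (Fin r) (Fin n) ℂ}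
    {E A : Matrix (Fin r) (Fin r) ℂ} (hmin : IsMinimalRealization G (polyMat m coef) Bᵀ E A B)
    (hm : pz + 2 * qz + 2 * qw + 1 = m)
    {tw tz : List ℕ} (htw : ∀ i ∈ tw, i < 2 * qw) (htz : ∀ i ∈ tz, i < pz + 2 * qz)
    {k : Fin m} (hk1 : ∀ a, lw m a = 0 → ∀ c, (leftW (fun i => -coef i) (fun j => coef (m - j)) tw tz *
      wp (lw m) (fun i => -coef i) (prs 0 qw) : Matrix (Fin m) (Fin m) _) c a = if c = k then 1 else 0)
    (hk2 : ∀ a, lw m a = 0 → ∀ c, rightF (fun i => -coef i) (fun j => coef (m - j)) pz qz qw tw tz a c =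
      if c = k then 1 else 0)
    (hp : (coef m).det = 0 → pz = 0) (h0 : (coef 0).det = 0 → 0 ∉ tw)
    (hz : (coef m).det = 0 → 0 ∉ tz) {ε : Fin m → ℤˣ} (hε : ε k = 1) :
    IsRosenbrockStrongLinearization m
      (Matrix.fromBlocks (cst (quasiIdentity n ε) * gfprP m coef (castL (adm 0 qw))
          (castL (cpl 0 qw)) (castL tw) (subL m (adm pz qz)) (subL m (cpl pz qz)) (subL m tz))
        (-cst (eCol m ((k : ℤ) + 1) Bᵀ)) (cst (eRow m ((k : ℤ) + 1) B)) (pencil E A))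
      (Matrix.fromBlocks (polyMat m coef) (cst (-Bᵀ)) (cst B) (pencil E A)) G := by
  have hm0 : 0 < m := by omega
  have hX0 : 0 ∈ tw → IsUnit (-coef 0) := fun h => by
    refine IsUnit.neg ((Matrix.isUnit_iff_isUnit_det _).2 (isUnit_iff_ne_zero.2 fun e => h0 e h))
  have hZm : (coef m).det ≠ 0 → IsUnit (coef (m - 0)) := fun h =>
    (Matrix.isUnit_iff_isUnit_det _).2 (isUnit_iff_ne_zero.2 h)
  have htw' : ∀ i ∈ tw, i < m := fun i hi => by
    have := htw i hi
    omega
  have htz' : ∀ i ∈ tz, i < m := fun i hi => by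
    have := htz i hi
    omega
  have hL : IsUnit (leftW (m := m) (fun i => -coef i) (fun j => coef (m - j)) tw tz) :=
    isUnit_leftW htw' htz' hX0 fun h => hZm fun e => hz e h
  have hR : IsUnit (rightF (m := m) (fun i => -coef i) (fun j => coef (m - j)) pz qz qw tw tz) :=
    isUnit_rightF hm htw' htz' hX0 (fun h => hZm fun e => hz e h) fun h => hZm fun e => h (hp e)
  have hE := hmin.1.1
  have hK : (-E).det ≠ 0 := by
    rw [Matrix.det_neg]
    exact mul_ne_zero (pow_ne_zero _ (by norm_num)) hE
  obtain ⟨U, V, hU, hV, hUV, hUc, hVr⟩ := exists_system_equivalence (r := r) hm htw htz hk1 hk2 hL hR hε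
  obtain ⟨Ol, Or, hOl, hOr, hO⟩ := exists_infinity_equivalence (A := A) (B := B) (C := Bᵀ) hE hm htw
    htz hk1 hk2 hL hR hε
  have hpen : ∃ Xc Yc : Matrix (Fin m × Fin n) (Fin m × Fin n) ℂ,
      cst Xc - (Polynomial.X : ℂ[X]) • cst Yc = cst (quasiIdentity n ε) * gfprP m coef
        (castL (adm 0 qw)) (castL (cpl 0 qw)) (castL tw) (subL m (adm pz qz)) (subL m (cpl pz qz))
        (subL m tz) := by
    rw [gfprP_eq_pencil coef hm tw tz htw htz, cst_mul_pencil]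
    generalize quasiIdentity n ε * fl _ = M
    generalize quasiIdentity n ε * fl _ = N
    refine ⟨-N, -M, ?_⟩
    rw [pencil, cst_neg, cst_neg, smul_neg]
    abel
  obtain ⟨Xc, Yc, hXY⟩ := hpen
  rw [← hXY] at hUV hO ⊢
  have htr : toRat U * transfer (cst Xc - (Polynomial.X : ℂ[X]) • cst Yc)
      (-eCol m ((k : ℤ) + 1) Bᵀ) (-E) (-A) (eRow m ((k : ℤ) + 1) B) * toRat V = padId m G := by
    rw [transfer_neg _ _ hE, hmin.1.2, padId_transfer hm0, ← hUV, ← hUc, ← hVr, transfer]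
    simp only [toRat_mul, Matrix.mul_add, Matrix.add_mul, Matrix.mul_assoc]
  refine ⟨Xc, Yc, -eCol m ((k : ℤ) + 1) Bᵀ, eRow m ((k : ℤ) + 1) B, -A, -E, ?_,
    isMinimalRealization_of_unimodular hmin hm0 hK htr,
    ⟨U, V, 1, 1, hU, hV, by simp, by simp, ?_⟩, Ol, Or, hOl, hOr, ?_⟩
  · congr 1
    · rw [cst_neg]
    · rw [pencil, cst_neg, cst_neg, smul_neg]
      abel
  · rw [Matrix.fromBlocks_multiply, Matrix.fromBlocks_multiply, cst_one, padIdSystem]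
    simp only [Matrix.zero_mul, Matrix.mul_zero, add_zero, zero_add, Matrix.one_mul, Matrix.mul_one,
      Matrix.mul_neg, neg_zero, hUV, hUc, hVr, Matrix.toBlocks_fromBlocks₁₁, Matrix.toBlocks_fromBlocks₁₂,
      Matrix.toBlocks_fromBlocks₂₁, Matrix.toBlocks_fromBlocks₂₂, ← cst_eCol, ← cst_eRow]
    congr 1
    rw [← cst_neg]
    congr 1
    ext p j
    simp only [eCol, Matrix.of_apply, Matrix.neg_apply]
    split_ifs <;> simp
  · rw [transfer_neg _ _ hE, hO, hmin.1.2]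

/-- With `B = 0` the function `G` would equal its polynomial part, which has a realization of size
`0`. -/
theorem minimal_ne_zero {n r : ℕ} {G : Matrix (Fin n) (Fin n) (RatFunc ℂ)}
    {P : Matrix (Fin n) (Fin n) ℂ[X]} {B : Matrix (Fin r) (Fin n) ℂ}
    {E A : Matrix (Fin r) (Fin r) ℂ} (hmin : IsMinimalRealization G P Bᵀ E A B) (hr : r ≠ 0) :
    B ≠ 0 := by
  rintro rfl
  have h0 : toRat (cst (0 : Matrix (Fin r) (Fin n) ℂ)) = 0 := by
    ext i j
    simp [toRat, cst]
  refine hr (Nat.le_zero.1 (hmin.2 0 P 0 1 0 0 ⟨by simp, ?_⟩))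
  rw [hmin.1.2, transfer, transfer, h0, Matrix.mul_zero]
  congr 1

theorem quasiIdentity_smul {n m : ℕ} (σ : ℤˣ) (ε : Fin m → ℤˣ) :
    (((σ : ℤˣ) : ℤ) : ℂ) • quasiIdentity n ε = quasiIdentity n (fun a => σ * ε a) := by
  ext p q
  by_cases h : p = q
  · subst h
    simp [quasiIdentity]
  · simp [quasiIdentity, h]

theorem quasiIdentity_mul_fl {n m : ℕ} (ε : Fin m → ℤˣ)
    (M : Matrix (Fin m) (Fin m) (Matrix (Fin n) (Fin n) ℂ)) :
    quasiIdentity n ε * fl M = fl (sgn ε * M) := by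
  rw [map_mul, fl_sgn]

theorem cst_extId_mul {ι : Type*} [Fintype ι] [DecidableEq ι] {r : ℕ} (Q : Matrix ι ι ℂ)
    (M : Matrix ι ι ℂ[X]) (N : Matrix ι (Fin r) ℂ[X]) (P : Matrix (Fin r) ι ℂ[X])
    (T : Matrix (Fin r) (Fin r) ℂ[X]) :
    cst (extId r Q) * Matrix.fromBlocks M N P T = Matrix.fromBlocks (cst Q * M) (cst Q * N) P T := by
  rw [extId, cst_fromBlocks, Matrix.fromBlocks_multiply]
  simp [cst_zero, cst_one]

theorem signs_ext {m : ℕ} {ε ε' : Fin m → ℤˣ}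
    (h : ∀ a, (ε * ε') a = 1) : ε = ε' := by
  funext a
  have := h a
  rw [Pi.mul_apply] at this
  rcases Int.units_eq_one_or (ε a) with e1 | e1 <;> rcases Int.units_eq_one_or (ε' a) with e2 | e2 <;>
    simp_all

end GFPR

end

open GFPR

/-! ### Assembly of the theorem -/

theorem theorem4p22
    {n r m h pw pz : ℕ}
    -- the skew-symmetric rational matrix and its minimal skew-symmetric realization
    (G : Matrix (Fin n) (Fin n) (RatFunc ℂ)) (hG : IsSkewSymm G)
    (coef : ℕ → Matrix (Fin n) (Fin n) ℂ) (hlead : coef m ≠ 0)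
    (hP : IsSkewSymm (polyMat m coef))
    (E A : Matrix (Fin r) (Fin r) ℂ) (hEA : IsSkewSymm (pencil E A))
    (B : Matrix (Fin r) (Fin n) ℂ)
    (hmin : IsMinimalRealization G (polyMat m coef) Bᵀ E A B)
    -- the index tuples
    (hhm : h < m) (hh : Even h)
    (w cw tw z cz tz : List ℤ)
    (hw : IsAdmissible h pw w) (hpw : pw = 0 ∨ pw = 1) (hcw : cw = symmCompl h pw)
    (hz : IsAdmissible (m - h - 1) pz (shift z m)) (hcz : shift cz m = symmCompl (m - h - 1) pz)
    (htw : IsRightTypeOne h w.reverse tw)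
    (htz : IsRightTypeOne (m - h - 1) (shift z m).reverse (shift tz m))
    -- the system matrix, the two pencils, and α
    (S : Matrix (Fin n ⊕ Fin r) (Fin n ⊕ Fin r) ℂ[X])
    (hS : S = Matrix.fromBlocks (polyMat m coef) (cst (-Bᵀ)) (cst B) (pencil E A))
    (L : Matrix (Fin m × Fin n) (Fin m × Fin n) ℂ[X])
    (hL : L = gfprP m coef w cw tw z cz tz)
    (LL : Matrix ((Fin m × Fin n) ⊕ Fin r) ((Fin m × Fin n) ⊕ Fin r) ℂ[X])
    (hLL : LL = gfprS m coef (-Bᵀ) (-E) (-A) B w cw tw z cz tz)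
    (α : ℤ) (hα : α = consec 0 (w ++ cw ++ tw)) :
    -- `k` is the block with number `m - α`
    ∃ k : Fin m, (k : ℤ) + 1 = m - α ∧
      -- there is a quasi-identity `Q` with `Q L(λ)` skew-symmetric
      (∃ ε : Fin m → ℤˣ, IsSkewSymm (cst (quasiIdentity n ε) * L)) ∧
      -- every such `Q`, with `(m - α)`-th parameter `s`, has the following properties
      (∀ ε : Fin m → ℤˣ, IsSkewSymm (cst (quasiIdentity n ε) * L) →
        ∀ sQ : Matrix (Fin m × Fin n) (Fin m × Fin n) ℂ,
          sQ = (((ε k : ℤˣ) : ℤ) : ℂ) • quasiIdentity n ε →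
          cst (extId r sQ) * LL =
            Matrix.fromBlocks (cst sQ * L) (-cst (eCol m (m - α) Bᵀ))
              (cst (eRow m (m - α) B)) (pencil E A) ∧
          IsSkewSymm (cst (extId r sQ) * LL) ∧
          IsSkewSymm (transfer (cst sQ * L) (eCol m (m - α) Bᵀ) E A (eRow m (m - α) B)) ∧
          (((coef m).det = 0 → pz = 0) → ((coef 0).det = 0 → (0 : ℤ) ∉ tw) →
            ((coef m).det = 0 → -(m : ℤ) ∉ tz) →
            IsRosenbrockStrongLinearization m (cst (extId r sQ) * LL) S G)) ∧
      -- uniqueness of `diag(Q', I_r)`; for `r = 0` the sign is fixed by the `(m - α)`-th parameter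
      (((0 : ℤ) ∈ tw → coef 0 ≠ 0) →
        ∃! QQ : Matrix ((Fin m × Fin n) ⊕ Fin r) ((Fin m × Fin n) ⊕ Fin r) ℂ,
          (∃ δ : Fin m → ℤˣ, (r = 0 → δ k = 1) ∧ QQ = extId r (quasiIdentity n δ)) ∧
          IsSkewSymm (cst QQ * LL)) := by
  obtain ⟨qw, hq, rfl⟩ := adm_eq hw
  -- A simple tuple has index `0` or `1`, and `h - pw` is even with `h` even.
  have hpw0 : pw = 0 := by
    rcases hpw with h | h
    · exact h
    · obtain ⟨a, ha⟩ := hh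
      omega
  subst hpw0
  obtain ⟨qz, hq', hz'⟩ := adm_eq hz
  have hm : pz + 2 * qz + 2 * qw + 1 = m := by omega
  rw [hq] at hcw htw
  rw [hq'] at hcz htz
  rw [cpl_eq] at hcw hcz
  rw [hz'] at htz
  obtain ⟨tw, rfl, htw', hhw⟩ := rightTypeOne_hop htw
  obtain ⟨tz, htz₀, htz', hhz⟩ := rightTypeOne_hop htz
  rw [zero_add] at htw'
  obtain rfl := eq_subL htz₀
  obtain rfl := eq_subL hz'
  obtain rfl := eq_subL hcz
  subst hcw hL hLL hS
  have hX : ∀ i < m, (-coef i)ᵀ = - -coef i := fun i hi => by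
    rw [Matrix.transpose_neg, isSkewSymm_polyMat hP hi.le]
  have hZ : ∀ j < m, (coef (m - j))ᵀ = -coef (m - j) := fun j _ =>
    isSkewSymm_polyMat hP (Nat.sub_le m j)
  obtain ⟨a₀, ha₀⟩ := lw_surj (m := m) (j := 0) (by omega)
  obtain ⟨k, hk, hk1, hk2⟩ := track (fun i => -coef i) (fun j => coef (m - j)) hm tw tz htw' htz'
    hhw ha₀
  have huniq : ∀ a, lw m a = 0 → a = a₀ := fun a ha => lw_inj m (ha.trans ha₀.symm)
  have hk1' : ∀ a, lw m a = 0 → ∀ c, (leftW (fun i => -coef i) (fun j => coef (m - j)) tw tz *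
      wp (lw m) (fun i => -coef i) (prs 0 qw) : Matrix (Fin m) (Fin m) _) c a =
        if c = k then 1 else 0 := fun a ha => by
    rw [huniq a ha]
    exact hk1
  have hk2' : ∀ a, lw m a = 0 → ∀ c,
      rightF (fun i => -coef i) (fun j => coef (m - j)) pz qz qw tw tz a c =
        if c = k then 1 else 0 := fun a ha => by
    rw [huniq a ha]
    exact hk2
  have hkα : (k : ℤ) + 1 = m - α := by
    rw [hk, hα, castL_append, castL_append]
  have hstr := gfprS_eq coef B E A hm tw tz htw' htz' hk1' hk2'
  have hskew : ∀ δ : Fin m → ℤˣ, IsSkewSymm (cst (quasiIdentity n δ) * gfprP m coef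
      (castL (adm 0 qw)) (castL (cpl 0 qw)) (castL tw) (subL m (adm pz qz)) (subL m (cpl pz qz))
      (subL m tz)) ↔
      IsSkewSymm (fl (sgn δ * kz (fun i => -coef i) (fun j => coef (m - j)) pz qz qw tw tz)) ∧
      IsSkewSymm (fl (sgn δ * kw (fun i => -coef i) (fun j => coef (m - j)) pz qz qw tw tz)) := by
    intro δ
    rw [gfprP_eq_pencil coef hm tw tz htw' htz', cst_mul_pencil, isSkewSymm_pencil,
      quasiIdentity_mul_fl, quasiIdentity_mul_fl]
  have hprod : ∀ δ : Fin m → ℤˣ, cst (extId r (quasiIdentity n δ)) * gfprS m coef (-Bᵀ) (-E) (-A) B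
      (castL (adm 0 qw)) (castL (cpl 0 qw)) (castL tw) (subL m (adm pz qz)) (subL m (cpl pz qz))
      (subL m tz) = Matrix.fromBlocks (cst (quasiIdentity n δ) * gfprP m coef
      (castL (adm 0 qw)) (castL (cpl 0 qw)) (castL tw) (subL m (adm pz qz)) (subL m (cpl pz qz))
      (subL m tz)) (-cst ((((δ k : ℤˣ) : ℤ) : ℂ) • eCol m ((k : ℤ) + 1) Bᵀ))
      (cst (eRow m ((k : ℤ) + 1) B)) (pencil E A) := by
    intro δ
    rw [hstr, cst_extId_mul, Matrix.mul_neg, ← cst_mul, quasiIdentity_mul_eCol]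
  have hcorner : (cst (eRow m ((k : ℤ) + 1) B))ᵀ = - -cst (eCol m ((k : ℤ) + 1) Bᵀ) := by
    rw [neg_neg, cst_transpose, transpose_eRow]
  have hsq : ∀ σ : ℤˣ, σ * σ = 1 := Int.units_mul_self
  have hscale : ∀ (σ : ℤˣ) (δ : Fin m → ℤˣ), IsSkewSymm (cst (quasiIdentity n δ) * gfprP m coef
      (castL (adm 0 qw)) (castL (cpl 0 qw)) (castL tw) (subL m (adm pz qz)) (subL m (cpl pz qz))
      (subL m tz)) → IsSkewSymm (cst (quasiIdentity n fun a => σ * δ a) * gfprP m coef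
      (castL (adm 0 qw)) (castL (cpl 0 qw)) (castL tw) (subL m (adm pz qz)) (subL m (cpl pz qz))
      (subL m tz)) := by
    intro σ δ h
    rw [← quasiIdentity_smul, cst_smul, Matrix.smul_mul, IsSkewSymm, Matrix.transpose_smul, h,
      smul_neg]
  obtain ⟨ε₀, hε₀⟩ := exists_isSkewSymm (n := n) hm hX hZ htw' htz' hhw hhz
  refine ⟨k, hkα, ⟨ε₀, (hskew ε₀).2 hε₀⟩, ?_, ?_⟩
  · rintro ε hε sQ rfl
    rw [quasiIdentity_smul, ← hkα, hprod]
    have h1 := hscale (ε k) ε hε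
    have h2 := isSkewSymm_transfer h1 hEA (eRow m ((k : ℤ) + 1) B)
    simp only [hsq, Units.val_one, Int.cast_one, one_smul]
    refine ⟨trivial, isSkewSymm_fromBlocks.2 ⟨h1, hcorner, hEA⟩, h2, fun h3 h4 h5 => ?_⟩
    refine isRosenbrockStrongLinearization_gfpr hmin hm htw' htz' hk1' hk2' h3
      (fun h => fun h' => h4 h ?_) (fun h => fun h' => h5 h ?_) (hsq _)
    · exact List.mem_map.2 ⟨0, h', rfl⟩
    · exact List.mem_map.2 ⟨0, h', by simp⟩
  · intro hA0
    -- Multiplying an arbitrary valid sign vector by its own sign at `k` makes that parameter equal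
    -- to `1`.
    refine ⟨extId r (quasiIdentity n fun a => ε₀ k * ε₀ a),
      ⟨⟨_, fun _ => hsq _, rfl⟩, ?_⟩, ?_⟩
    · rw [hprod]
      refine isSkewSymm_fromBlocks.2 ⟨hscale _ _ ((hskew ε₀).2 hε₀), ?_, hEA⟩
      simp only [hsq, Units.val_one, Int.cast_one, one_smul]
      exact hcorner
    · rintro _ ⟨⟨δ, hδ, rfl⟩, hQ⟩
      rw [hprod] at hQ
      obtain ⟨hQ1, hQ2, -⟩ := isSkewSymm_fromBlocks.1 hQ
      have hδk : δ k = 1 := by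
        -- For `r > 0` the corner blocks decide the sign: `δ k = -1` would give `B = -B`, against
        -- `minimal_ne_zero`.
        rcases Nat.eq_zero_or_pos r with hr | hr
        · exact hδ hr
        · rcases Int.units_eq_one_or (δ k) with h | h
          · exact h
          · exfalso
            refine minimal_ne_zero hmin hr.ne' ?_
            rw [h, neg_neg, cst_transpose, transpose_eRow] at hQ2
            have h6 := cst_injective hQ2
            ext i j
            have h7 := congrFun (congrFun h6 (k, j)) i
            simp only [eCol, Matrix.of_apply, if_true, Matrix.smul_apply, Matrix.transpose_apply,
              Units.val_neg, Units.val_one, Int.cast_neg, Int.cast_one, smul_eq_mul] at h7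
            have h8 : (2 : ℂ) * B i j = 0 := by linear_combination h7
            simpa using h8
      -- `A_m ≠ 0` excludes empty blocks; `blocks_connected` needs a nontrivial block ring.
      have hn : n ≠ 0 := by
        rintro rfl
        exact hlead (Subsingleton.elim _ _)
      have : Nonempty (Fin n) := ⟨⟨0, Nat.pos_of_ne_zero hn⟩⟩
      have hδ' := (hskew δ).1 hQ1
      -- The product of the two sign vectors is constant along nonzero blocks, hence constant, and
      -- its value at `k` is `1`.
      have hconst := blocks_connected (m := m) (fun i => -coef i) (fun j => coef (m - j)) hm tw tz
        htw' htz' hhw hhz (fun h => neg_ne_zero.2 (hA0 (List.mem_map.2 ⟨0, h, rfl⟩))) (by simpa using hlead)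
        (δ * fun a => ε₀ k * ε₀ a) (fun a b hab => signs_eq hδ'.1
          ((hskew _).1 (hscale _ _ ((hskew ε₀).2 hε₀))).1 hab) (fun a b hab => signs_eq hδ'.2
          ((hskew _).1 (hscale _ _ ((hskew ε₀).2 hε₀))).2 hab)
      congr 2
      refine signs_ext fun a => ?_
      rw [hconst a k, Pi.mul_apply, hδk, hsq, mul_one]
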